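/- Let $M$ be a smooth ($C^\infty$) Hausdorff manifold of dimension $n$ without boundary, and let $X_1,\dots,X_d$ be smooth vector fields on $M$ that are bracket generating (at every point their iterated Lie brackets span the tangent space). They define a subriemannian structure with distribution $D_q=\operatorname{span}\{X_1(q),\dots,X_d(q)\}$ and norm $\|v\|=\min\{|a| : a\in\mathbb{R}^d,\ v=\sum_i a_iX_i(q)\}$ for $v\in D_q$, where $|\cdot|$ is the Euclidean norm on $\mathbb{R}^d$; if the $X_i(q)$ are linearly independent, this is the norm that makes them orthonormal. A curve is horizontal if it is absolutely continuous and its derivative lies in the distribution almost everywhere; its length is the integral of the norm of its derivative. Fix $x,y\in M$ and $1<p<\infty$. For $u\in L^p([0,1],\mathbb{R}^d)$ let $\gamma_u$ be the absolutely continuous solution of $\dot\gamma=\sum_{i=1}^d u_iX_i(\gamma)$, $\gamma(0)=x$. Let $\Omega\subset L^p([0,1],\mathbb{R}^d)$ be the (open) set of those $u$ for which $\gamma_u$ is defined on all of $[0,1]$, let $F:\Omega\to M$, $F(u)=\gamma_u(1)$, be the endpoint map centered at $x$, and put $\Omega(y)=F^{-1}(y)$. Let $J_p(u)=\|u\|_p^p=\int_0^1|u(t)|^p\,dt$.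 Suppose that $y$ is a regular value of $F$, that is, $d_uF$ is surjective for every $u\in\Omega(y)$. Let $u\in\Omega(y)$ be a critical point of $J_p|_{\Omega(y)}$, that is, $d_uJ_p$ vanishes on $T_u\Omega(y)=\ker d_uF$. Then $\gamma_u$ is a subriemannian geodesic joining $x$ to $y$: it is a horizontal curve $[0,1]\to M$ with $\gamma_u(0)=x$ and $\gamma_u(1)=y$; it is parametrized proportionally to arc length (there is a constant $c\ge 0$ with $\|\dot\gamma_u(t)\|=c$ for almost every $t$); and it is locally length minimizing (for every $t\in[0,1]$ there is $\delta>0$ such that the restriction of $\gamma_u$ to $[t-\delta,t+\delta]\cap[0,1]$ has minimal length among all horizontal curves with the same endpoints). -/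

import Mathlib

open MeasureTheory Set
open scoped Manifold ContDiff ENNReal NNReal

noncomputable section

namespace SubRiem

/-- The space `L^p([0,1], ℝ^d)` of controls (`ℝ^d` with its Euclidean norm). -/
abbrev Control (d : ℕ) (p : ℝ≥0∞) : Type :=
  Lp (EuclideanSpace ℝ (Fin d)) p (volume.restrict (Icc (0 : ℝ) 1))

/-- The `p`-energy `J_p(u) = ‖u‖_p^p = ∫₀¹ |u(t)|^p dt`, where `|·|` is the Euclidean norm. -/
def energy {d : ℕ} {p : ℝ≥0∞} (u : Control d p) : ℝ :=
  ∫ t in Icc (0 : ℝ) 1, ‖u t‖ ^ p.toReal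

section Manifold

variable {n d : ℕ} {M : Type*} [TopologicalSpace M] [ChartedSpace (EuclideanSpace ℝ (Fin n)) M]

/-- `X_1, …, X_d` are smooth vector fields. -/
def SmoothFields [IsManifold (𝓡 n) ∞ M] (X : Fin d → (q : M) → TangentSpace (𝓡 n) q) : Prop :=
  ∀ i, ContMDiff (𝓡 n) (𝓡 n).tangent ∞
    (fun q : M => (⟨q, X i q⟩ : TangentBundle (𝓡 n) M))

/-- The iterated Lie brackets of the fields `X_1, …, X_d` (the fields themselves included). -/
inductive IsIteratedBracket (X : Fin d → (q : M) → TangentSpace (𝓡 n) q) :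
    ((q : M) → TangentSpace (𝓡 n) q) → Prop
  | base (i : Fin d) : IsIteratedBracket X (X i)
  | bracket {V W : (q : M) → TangentSpace (𝓡 n) q} (hV : IsIteratedBracket X V)
      (hW : IsIteratedBracket X W) :
      IsIteratedBracket X (VectorField.mlieBracket (𝓡 n) V W)

/-- Hörmander's condition: at every point the iterated brackets span the tangent space. -/
def BracketGenerating (X : Fin d → (q : M) → TangentSpace (𝓡 n) q) : Prop :=
  ∀ q : M, Submodule.span ℝ
    {v : TangentSpace (𝓡 n) q | ∃ V, IsIteratedBracket X V ∧ V q = v} = ⊤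

/-- The tangent vector `∑ a_i X_i(q)`. -/
def combination (X : Fin d → (q : M) → TangentSpace (𝓡 n) q) (q : M)
    (a : EuclideanSpace ℝ (Fin d)) : TangentSpace (𝓡 n) q :=
  ∑ i, a i • X i q

/-- The subriemannian distribution `D_q = span {X_1(q), …, X_d(q)}`. -/
def distribution (X : Fin d → (q : M) → TangentSpace (𝓡 n) q) (q : M) :
    Submodule ℝ (TangentSpace (𝓡 n) q) :=
  Submodule.span ℝ (range fun i => X i q)

/-- The subriemannian norm of `v ∈ T_q M`: the least Euclidean norm of a vector of coefficients `a`
with `v = ∑ a_i X_i(q)`; it is `∞` if `v` is not in the distribution. If the `X_i(q)` are linearly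
independent this is the norm for which they are orthonormal. -/
def srNorm (X : Fin d → (q : M) → TangentSpace (𝓡 n) q) (q : M) (v : TangentSpace (𝓡 n) q) :
    ℝ≥0∞ :=
  ⨅ (a : EuclideanSpace ℝ (Fin d)) (_ : combination X q a = v), ‖a‖ₑ

/-- The velocity of a curve (meaningful where the curve is differentiable). -/
def velocity (γ : ℝ → M) (t : ℝ) : TangentSpace (𝓡 n) (γ t) :=
  mfderiv 𝓘(ℝ, ℝ) (𝓡 n) γ t (1 : ℝ)

/-- `γ` is absolutely continuous on `[a,b]`: it is continuous there and near each time of `[a,b]`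
it is absolutely continuous in a chart. -/
def AbsContCurve (n : ℕ) {M : Type*} [TopologicalSpace M]
    [ChartedSpace (EuclideanSpace ℝ (Fin n)) M] (γ : ℝ → M) (a b : ℝ) : Prop :=
  ContinuousOn γ (Icc a b) ∧ ∀ t ∈ Icc a b, ∃ ε > 0,
    MapsTo γ (Icc (max a (t - ε)) (min b (t + ε))) (extChartAt (𝓡 n) (γ t)).source ∧
    AbsolutelyContinuousOnInterval (fun s => extChartAt (𝓡 n) (γ t) (γ s))
      (max a (t - ε)) (min b (t + ε))

/-- Horizontal curve on `[a,b]`: absolutely continuous, with derivative almost everywhere in the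
distribution. -/
structure IsHorizontal (X : Fin d → (q : M) → TangentSpace (𝓡 n) q) (γ : ℝ → M) (a b : ℝ) :
    Prop where
  absCont : AbsContCurve n γ a b
  tangent : ∀ᵐ t ∂(volume.restrict (Icc a b)),
    MDifferentiableAt 𝓘(ℝ, ℝ) (𝓡 n) γ t ∧ velocity γ t ∈ distribution X (γ t)

/-- The subriemannian length of `γ` on `[a,b]`. -/
def srLength (X : Fin d → (q : M) → TangentSpace (𝓡 n) q) (γ : ℝ → M) (a b : ℝ) : ℝ≥0∞ :=
  ∫⁻ t in Icc a b, srNorm X (γ t) (velocity γ t)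

/-- `γ` has minimal length on `[a,b]` among all horizontal curves (defined on any compact interval)
that join `γ(a)` to `γ(b)`. -/
def IsLengthMinimizing (X : Fin d → (q : M) → TangentSpace (𝓡 n) q) (γ : ℝ → M) (a b : ℝ) :
    Prop :=
  ∀ (σ : ℝ → M) (a' b' : ℝ), a' ≤ b' → IsHorizontal X σ a' b' → σ a' = γ a → σ b' = γ b →
    srLength X γ a b ≤ srLength X σ a' b'

/-- Subriemannian geodesic `γ : [0,1] → M` from `x` to `y`: a horizontal curve, parametrized
proportionally to arc length, that is locally length minimizing. -/
structure IsGeodesic (X : Fin d → (q : M) → TangentSpace (𝓡 n) q) (x y : M) (γ : ℝ → M) :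
    Prop where
  horizontal : IsHorizontal X γ 0 1
  constSpeed : ∃ c : ℝ≥0, ∀ᵐ t ∂(volume.restrict (Icc (0 : ℝ) 1)),
    srNorm X (γ t) (velocity γ t) = c
  start : γ 0 = x
  finish : γ 1 = y
  locMin : ∀ t ∈ Icc (0 : ℝ) 1, ∃ δ > 0,
    IsLengthMinimizing X γ (max 0 (t - δ)) (min 1 (t + δ))

variable {p : ℝ≥0∞}

/-- `γ` is, on `[0,1]`, an absolutely continuous solution of the control system
`γ' = ∑ u_i X_i(γ)`, `γ(0) = x`. -/
structure IsTrajectory (X : Fin d → (q : M) → TangentSpace (𝓡 n) q) (x : M) (u : Control d p)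
    (γ : ℝ → M) : Prop where
  absCont : AbsContCurve n γ 0 1
  start : γ 0 = x
  deriv : ∀ᵐ t ∂(volume.restrict (Icc (0 : ℝ) 1)), HasMFDerivAt 𝓘(ℝ, ℝ) (𝓡 n) γ t
    ((1 : ℝ →L[ℝ] ℝ).smulRight (combination X (γ t) (u t)))

/-- The domain of the endpoint map: the controls whose trajectory from `x` is defined on all of
`[0,1]`. -/
def admissible (X : Fin d → (q : M) → TangentSpace (𝓡 n) q) (x : M) (p : ℝ≥0∞) :
    Set (Control d p) :=
  {u | ∃ γ, IsTrajectory X x u γ}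

open Classical in
/-- The endpoint map centered at `x`, `u ↦ γ_u(1)` (with an irrelevant value outside
`admissible X x p`). -/
def endpoint (X : Fin d → (q : M) → TangentSpace (𝓡 n) q) (x : M) (u : Control d p) : M :=
  if h : ∃ γ, IsTrajectory X x u γ then h.choose 1 else x

/-- The fiber `Ω(y)` of the endpoint map. -/
def fiber (X : Fin d → (q : M) → TangentSpace (𝓡 n) q) (x : M) (p : ℝ≥0∞) (y : M) :
    Set (Control d p) :=
  {u ∈ admissible X x p | endpoint X x u = y}

variable [Fact (1 ≤ p)]

/-- The differential of the endpoint map at the control `u`. -/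
def dEndpoint (X : Fin d → (q : M) → TangentSpace (𝓡 n) q) (x : M) (u : Control d p) :
    Control d p →L[ℝ] TangentSpace (𝓡 n) (endpoint X x u) :=
  mfderiv 𝓘(ℝ, Control d p) (𝓡 n) (endpoint X x : Control d p → M) u

/-- `y` is a regular value of the endpoint map centered at `x`, defined on `L^p` controls. -/
def IsRegularValue (X : Fin d → (q : M) → TangentSpace (𝓡 n) q) (x : M) (p : ℝ≥0∞)
    [Fact (1 ≤ p)] (y : M) : Prop :=
  ∀ u ∈ fiber X x p y, Function.Surjective (dEndpoint X x u)

/-- `u` is a critical point of `J_p` restricted to the fiber `Ω(y)` over a regular value `y`: the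
differential of `J_p` at `u` vanishes on the tangent space `T_u Ω(y) = ker d_u F`. -/
def IsCriticalOnFiber (X : Fin d → (q : M) → TangentSpace (𝓡 n) q) (x y : M)
    (u : Control d p) : Prop :=
  u ∈ fiber X x p y ∧ ∀ v : Control d p, dEndpoint X x u v = 0 →
    fderiv ℝ (energy : Control d p → ℝ) u v = 0

end Manifold

end SubRiem

end

/-! Criticality is localised. On a short time interval [a, b] the trajectory stays in one chart,
where the system reads f' = Y(f)u. A variation v of the control supported in (a, b), whose
linearised displacement vanishes at b, does not move the end point to first order. Such a v lies in
ker d_uF, so d_uJ_p v = ∫⟨p|u|^(p-2)u, v⟩ = 0. The vanishing of the displacement at b amounts to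
finitely many linear conditions on v, so the Lagrange multiplier rule (`exists_adjoint_of_critical`)
yields a solution η of the adjoint equation with p|u|^(p-2)u = Y(f)*η almost everywhere: locally the
trajectory is a normal extremal.

The vector of momenta h = Y(f)*η has constant norm, because the derivative of |h|²/2 is ⟨η, DY(Yu)h
- DY(Yh)u⟩, which vanishes when h is a multiple of u (`norm_momentum_const`). As p > 1, |u| is then
a constant c. If c > 0, rescaling η by a constant turns u itself into the vector of momenta, and (f,
η) becomes a C¹ solution of the Hamiltonian system of ½|Y*η|² (`exists_hamiltonian_lift`). A vector
of momenta is the shortest coefficient vector of its velocity, so the subriemannian speed is c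
(`IsChartModel.srNorm_eq`). If c = 0 the length is locally zero and there is nothing to minimise.

For c > 0, minimality comes from a calibration. The Hamilton-Jacobi equation is not solved; a
subsolution that is sharp on the curve is enough, namely a C¹ function S near γ(t₀) with S(γ(t)) =
c(t - t₀) and dS(Y a) ≤ |a| for all a. `exists_concave_potential` produces S with the right
differential on the curve and with its derivative in the direction of the curve lowered by K/2 times
a squared transversal distance. Hamilton's equation cancels the first-order error of the dual norm
of dS, and a large K absorbs the second-order one (`BoundedField.inner_le_norm`). Integrating dS
shows that a competitor staying in the domain of S has length at least c(b - a). A competitor that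
leaves it has length bounded below by means of a bump function, and this bound is at least c(b - a)
on a short interval (`exists_isLengthMinimizing`). -/

namespace SubRiem

open Filter Topology

/-! ### Absolutely continuous functions and the fundamental theorem of calculus. -/

section AbsolutelyContinuous

variable {V : Type*} [NormedAddCommGroup V]

/-- A function whose increments are controlled by those of two absolutely continuous functions is
absolutely continuous. -/
theorem absolutelyContinuousOnInterval_of_dist_le {X₀ X₁ X₂ : Type*} [PseudoMetricSpace X₀]
    [PseudoMetricSpace X₁] [PseudoMetricSpace X₂] {h : ℝ → X₀} {f : ℝ → X₁} {g : ℝ → X₂}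
    {a b C D : ℝ} (hf : AbsolutelyContinuousOnInterval f a b)
    (hg : AbsolutelyContinuousOnInterval g a b)
    (hle : ∀ s ∈ uIcc a b, ∀ t ∈ uIcc a b,
      dist (h s) (h t) ≤ C * dist (f s) (f t) + D * dist (g s) (g t)) :
    AbsolutelyContinuousOnInterval h a b := by
  have hlim := (Tendsto.const_mul C hf).add (Tendsto.const_mul D hg)
  simp only [mul_zero, add_zero] at hlim
  refine tendsto_of_tendsto_of_tendsto_of_le_of_le' tendsto_const_nhds hlim
    (Eventually.of_forall fun E => Finset.sum_nonneg fun i _ => dist_nonneg) ?_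
  have : ∀ᶠ E in AbsolutelyContinuousOnInterval.totalLengthFilter ⊓
      𝓟 (AbsolutelyContinuousOnInterval.disjWithin a b),
      E ∈ AbsolutelyContinuousOnInterval.disjWithin a b :=
    mem_inf_of_right (mem_principal_self _)
  filter_upwards [this] with E hE
  rw [Finset.mul_sum, Finset.mul_sum, ← Finset.sum_add_distrib]
  exact Finset.sum_le_sum fun i hi => hle _ (hE.1 i hi).1 _ (hE.1 i hi).2

/-- A Lipschitz function of an absolutely continuous function is absolutely continuous. -/
theorem _root_.LipschitzOnWith.comp_absolutelyContinuousOnInterval {X₁ X₂ : Type*}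
    [PseudoMetricSpace X₁] [PseudoMetricSpace X₂] {φ : X₁ → X₂} {f : ℝ → X₁} {s : Set X₁}
    {K : ℝ≥0} {a b : ℝ} (hφ : LipschitzOnWith K φ s)
    (hf : AbsolutelyContinuousOnInterval f a b) (hs : MapsTo f (uIcc a b) s) :
    AbsolutelyContinuousOnInterval (fun t => φ (f t)) a b :=
  absolutelyContinuousOnInterval_of_dist_le (C := K) (D := 0) hf hf fun t ht t' ht' => by
    simpa using hφ.dist_le_mul _ (hs ht) _ (hs ht')

variable [NormedSpace ℝ V]

/-- The increments are dominated by those of the primitive of ‖g‖, which reduces the vector-valued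
case to the real one. -/
theorem absolutelyContinuousOnInterval_integral {g : ℝ → V} {a b c : ℝ}
    (hg : IntervalIntegrable g volume a b) (hc : c ∈ uIcc a b) :
    AbsolutelyContinuousOnInterval (fun t => ∫ r in c..t, g r) a b := by
  have h := hg.norm.absolutelyContinuousOnInterval_intervalIntegral hc
  have hi : ∀ s ∈ uIcc a b, IntervalIntegrable g volume c s := fun s hs =>
    hg.mono_set (uIcc_subset_uIcc hc hs)
  refine absolutelyContinuousOnInterval_of_dist_le (C := 1) (D := 0) h h fun s hs t ht => ?_
  rw [dist_eq_norm, dist_eq_norm, intervalIntegral.integral_interval_sub_left (hi s hs) (hi t ht),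
    intervalIntegral.integral_interval_sub_left (hi s hs).norm (hi t ht).norm]
  simpa using intervalIntegral.norm_integral_le_abs_integral_norm (f := g) (a := t) (b := s)

/-- The fundamental theorem of calculus for absolutely continuous functions with prescribed
derivative. -/
theorem eq_add_integral_of_ae_hasDerivAt [CompleteSpace V] {f g : ℝ → V} {a b : ℝ} (hab : a ≤ b)
    (hf : AbsolutelyContinuousOnInterval f a b) (hg : IntervalIntegrable g volume a b)
    (h : ∀ᵐ t ∂volume.restrict (Icc a b), HasDerivAt f (g t) t) :
    ∀ t ∈ Icc a b, f t = f a + ∫ r in a..t, g r := by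
  have hac := hf.sub (absolutelyContinuousOnInterval_integral hg left_mem_uIcc)
  rw [ae_restrict_iff' measurableSet_Icc] at h
  obtain ⟨C, hC⟩ := hac.const_of_ae_hasDerivAt_zero (by
    filter_upwards [h, hg.ae_hasDerivAt_integral] with t h1 h2 ht
    have := (h1 (by rwa [uIcc_of_le hab] at ht)).sub (h2 ht a left_mem_uIcc)
    rwa [sub_self] at this)
  intro t ht
  have h1 := hC t (by rwa [uIcc_of_le hab])
  have h2 := hC a left_mem_uIcc
  simp only [Pi.sub_apply, intervalIntegral.integral_same, sub_zero] at h1 h2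
  rw [h2, ← h1]; abel

theorem absolutelyContinuousOnInterval_of_eq_integral {f g : ℝ → V} {a b : ℝ} (hab : a ≤ b)
    (hg : IntervalIntegrable g volume a b)
    (h : ∀ t ∈ Icc a b, f t = f a + ∫ r in a..t, g r) :
    AbsolutelyContinuousOnInterval f a b := by
  have := absolutelyContinuousOnInterval_integral hg left_mem_uIcc
  refine absolutelyContinuousOnInterval_of_dist_le (C := 1) (D := 0) this this fun s hs t ht => ?_
  rw [uIcc_of_le hab] at hs ht
  rw [h s hs, h t ht, dist_add_left]; simp

theorem ae_hasDerivAt_of_eq_integral [CompleteSpace V] {f g : ℝ → V} {a b : ℝ} (hab : a ≤ b)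
    (hg : IntervalIntegrable g volume a b)
    (h : ∀ t ∈ Icc a b, f t = f a + ∫ r in a..t, g r) :
    ∀ᵐ t ∂volume.restrict (Icc a b), HasDerivAt f (g t) t := by
  -- The integral formula is known only on [a, b]; it yields a two-sided derivative away from the
  -- two end points, which are null.
  have hne : ∀ c : ℝ, ∀ᵐ x : ℝ, x ≠ c := fun c => by simp [ae_iff, measure_singleton]
  rw [ae_restrict_iff' measurableSet_Icc]
  filter_upwards [hg.ae_hasDerivAt_integral, hne a, hne b] with t h1 ha hb ht
  have h2 := (h1 (by rwa [uIcc_of_le hab]) a left_mem_uIcc).const_add (f a)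
  refine h2.congr_of_eventuallyEq ?_
  filter_upwards [Icc_mem_nhds (lt_of_le_of_ne ht.1 (Ne.symm ha)) (lt_of_le_of_ne ht.2 hb)]
    with s hs using h s hs

/-- Concatenation of absolutely continuous functions. -/
theorem _root_.AbsolutelyContinuousOnInterval.trans [CompleteSpace V] {f g : ℝ → V} {a b c : ℝ}
    (hab : a ≤ b) (hbc : b ≤ c) (hg : IntervalIntegrable g volume a c)
    (h1 : AbsolutelyContinuousOnInterval f a b) (h2 : AbsolutelyContinuousOnInterval f b c)
    (h : ∀ᵐ t ∂volume.restrict (Icc a c), HasDerivAt f (g t) t) :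
    AbsolutelyContinuousOnInterval f a c := by
  have hb : b ∈ uIcc a c := by rw [uIcc_of_le (hab.trans hbc)]; exact ⟨hab, hbc⟩
  have g1 : IntervalIntegrable g volume a b := hg.mono_set (uIcc_subset_uIcc_left hb)
  have g2 : IntervalIntegrable g volume b c := hg.mono_set (uIcc_subset_uIcc_right hb)
  have e1 := eq_add_integral_of_ae_hasDerivAt hab h1 g1
    (ae_restrict_of_ae_restrict_of_subset (Icc_subset_Icc_right hbc) h)
  have e2 := eq_add_integral_of_ae_hasDerivAt hbc h2 g2
    (ae_restrict_of_ae_restrict_of_subset (Icc_subset_Icc_left hab) h)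
  refine absolutelyContinuousOnInterval_of_eq_integral (hab.trans hbc) hg fun t ht => ?_
  rcases le_total t b with htb | htb
  · exact e1 t ⟨ht.1, htb⟩
  · rw [e2 t ⟨htb, ht.2⟩, e1 b ⟨hab, le_rfl⟩, add_assoc,
      intervalIntegral.integral_add_adjacent_intervals g1]
    refine g2.mono_set (uIcc_subset_uIcc_left ?_)
    rw [uIcc_of_le hbc]; exact ⟨htb, ht.2⟩

end AbsolutelyContinuous

/-- A reflexive transitive relation between times that holds locally holds globally. -/
theorem relation_of_locally {R : ℝ → ℝ → Prop} {a b : ℝ} (hab : a ≤ b)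
    (hrefl : ∀ t ∈ Icc a b, R t t)
    (htrans : ∀ r s t, a ≤ r → r ≤ s → s ≤ t → t ≤ b → R r s → R s t → R r t)
    (hloc : ∀ t ∈ Icc a b, ∃ ε > 0, ∀ r s, r ∈ Icc a b → s ∈ Icc a b → t - ε < r → r ≤ s →
      s < t + ε → R r s) : R a b := by
  choose! ε hε hR using hloc
  -- A monotone subdivision, eventually equal to b, each of whose steps lies in one of the local
  -- intervals; transitivity then chains the steps.
  obtain ⟨t, h0, hmono, ⟨m, hm⟩, hsub⟩ := exists_monotone_Icc_subset_open_cover_Icc hab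
    (c := fun x : Icc a b => {y : Icc a b | (y : ℝ) ∈ Ioo (x - ε x : ℝ) (x + ε x)})
    (fun x => isOpen_Ioo.preimage continuous_subtype_val)
    (fun x _ => mem_iUnion.2 ⟨x, by
      have := hε x x.2
      constructor <;> linarith⟩)
  have key : ∀ k, R a (t k) := by
    intro k
    induction k with
    | zero => rw [h0]; exact hrefl a ⟨le_rfl, hab⟩
    | succ k ih =>
      obtain ⟨x, hx⟩ := hsub k
      have hle : (t k : ℝ) ≤ t (k + 1) := hmono (Nat.le_succ k)
      have h1 := hx (left_mem_Icc.2 (hmono (Nat.le_succ k)))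
      have h2 := hx (right_mem_Icc.2 (hmono (Nat.le_succ k)))
      exact htrans a (t k) _ le_rfl (t k).2.1 hle (t (k + 1)).2.2 ih
        (hR x x.2 _ _ (t k).2 (t (k + 1)).2 h1.1 hle h2.2)
  have := key m
  rwa [hm m le_rfl] at this

/-! ### Integral equations by contraction. -/

section Caratheodory

open scoped BoundedContinuousFunction

variable {V : Type*} [NormedAddCommGroup V] [NormedSpace ℝ V]

/-- The function `t ↦ c + ∫_{t₀}^t g`, for an integrable function `g`. -/
noncomputable def primitive (g : ℝ → V) (hg : Integrable g) (t₀ : ℝ) (c : V) : ℝ →ᵇ V :=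
  BoundedContinuousFunction.ofNormedAddCommGroup (fun t => c + ∫ r in t₀..t, g r)
    (continuous_const.add (intervalIntegral.continuous_primitive
      (fun _ _ => hg.intervalIntegrable) t₀)) (‖c‖ + ∫ r, ‖g r‖) (fun t => by
    refine (norm_add_le _ _).trans (add_le_add le_rfl ?_)
    refine intervalIntegral.norm_integral_le_integral_norm_uIoc.trans ?_
    exact setIntegral_le_integral hg.norm (Eventually.of_forall fun _ => norm_nonneg _))

/-- Existence, and stability under approximation, of a solution of the integral equation
`f(t) = c + ∫_{t₀}^t G(f)`, for a Lipschitz operator `G` with small constant. -/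
theorem exists_integral_solution [CompleteSpace V] (G : (ℝ →ᵇ V) → ℝ → V)
    (hG : ∀ f, Integrable (G f))
    {β : ℝ → ℝ} (hβ : Integrable β) (hLip : ∀ f g t, ‖G f t - G g t‖ ≤ β t * dist f g)
    {K : ℝ} (hK0 : 0 ≤ K) (hK : ∫ t, β t ≤ K) (hK1 : K < 1) (t₀ : ℝ) (c : V) :
    ∃ f : ℝ →ᵇ V, (∀ t, f t = c + ∫ r in t₀..t, G f r) ∧
      ∀ (g : ℝ →ᵇ V) (ρ : ℝ), (∀ t, ‖g t - (c + ∫ r in t₀..t, G g r)‖ ≤ ρ) →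
        dist g f ≤ ρ / (1 - K) := by
  lift K to ℝ≥0 using hK0
  set T : (ℝ →ᵇ V) → (ℝ →ᵇ V) := fun f => primitive (G f) (hG f) t₀ c with hT
  have hTap : ∀ f t, T f t = c + ∫ r in t₀..t, G f r := fun f t => rfl
  have hcontr : ContractingWith K T := by
    refine ⟨by exact_mod_cast hK1, LipschitzWith.of_dist_le_mul fun f g => ?_⟩
    refine (BoundedContinuousFunction.dist_le (by positivity)).2 fun t => ?_
    rw [hTap, hTap, dist_add_left, dist_eq_norm, ← intervalIntegral.integral_sub
      (hG f).intervalIntegrable (hG g).intervalIntegrable]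
    refine intervalIntegral.norm_integral_le_integral_norm_uIoc.trans ?_
    refine (setIntegral_le_integral ((hG f).sub (hG g)).norm
      (Eventually.of_forall fun _ => norm_nonneg _)).trans ?_
    refine (integral_mono ((hG f).sub (hG g)).norm (hβ.mul_const _)
      (fun t => hLip f g t)).trans ?_
    rw [integral_mul_const]
    exact mul_le_mul_of_nonneg_right hK dist_nonneg
  refine ⟨hcontr.fixedPoint, fun t => ?_, fun g ρ hg => ?_⟩
  · rw [← hTap, hcontr.fixedPoint_isFixedPt]
  -- The a posteriori estimate of the contraction principle, in terms of the defect of g. It later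
  -- gives both uniqueness (zero defect) and differentiability in a parameter (small defect).
  · refine (hcontr.dist_fixedPoint_le g).trans ?_
    have hρ : 0 ≤ ρ := (norm_nonneg _).trans (hg 0)
    refine div_le_div_of_nonneg_right ?_ (sub_nonneg.2 hK1.le)
    exact (BoundedContinuousFunction.dist_le hρ).2 fun t => by
      rw [dist_eq_norm, hTap]; exact hg t

end Caratheodory

end SubRiem

/-! ### Bounded fields on the model space. -/

namespace SubRiem

open Filter Topology Asymptotics
open scoped BoundedContinuousFunction

/-- Uniform bounds, up to second order, for a family of vector fields `Y(z)a = ∑ a_i Y_i(z)`. -/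
structure BoundedField {E A : Type*} [NormedAddCommGroup E] [NormedSpace ℝ E]
    [NormedAddCommGroup A] [NormedSpace ℝ A] (Y : E → A →L[ℝ] E) (L : ℝ) : Prop where
  nonneg : 0 ≤ L
  contDiff : ContDiff ℝ 2 Y
  norm_le : ∀ z, ‖Y z‖ ≤ L
  norm_fderiv_le : ∀ z, ‖fderiv ℝ Y z‖ ≤ L
  lip : ∀ z z', ‖Y z - Y z'‖ ≤ L * ‖z - z'‖
  taylor : ∀ z h, ‖Y (z + h) - Y z - fderiv ℝ Y z h‖ ≤ L * ‖h‖ ^ 2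

section Field

variable {E A : Type*} [NormedAddCommGroup E] [NormedSpace ℝ E]
  [NormedAddCommGroup A] [NormedSpace ℝ A] {Y : E → A →L[ℝ] E} {L : ℝ}

theorem norm_sub_le_of_norm_fderiv_le {V W : Type*} [NormedAddCommGroup V] [NormedSpace ℝ V]
    [NormedAddCommGroup W] [NormedSpace ℝ W] {f : V → W} {C : ℝ} (hd : Differentiable ℝ f)
    (h : ∀ x, ‖fderiv ℝ f x‖ ≤ C) (x y : V) : ‖f x - f y‖ ≤ C * ‖x - y‖ :=
  convex_univ.norm_image_sub_le_of_norm_fderiv_le (fun x _ => hd x) (fun x _ => h x)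
    (mem_univ y) (mem_univ x)

/-- The mean value inequality for f minus its linear part at z, on the ball of radius ‖v‖, where the
derivative has moved by at most C‖v‖. -/
theorem norm_sub_sub_le_of_lipschitz_fderiv {V W : Type*} [NormedAddCommGroup V] [NormedSpace ℝ V]
    [NormedAddCommGroup W] [NormedSpace ℝ W] {f : V → W} {C : ℝ} (hC : 0 ≤ C)
    (hd : Differentiable ℝ f)
    (h : ∀ x y, ‖fderiv ℝ f x - fderiv ℝ f y‖ ≤ C * ‖x - y‖) (z v : V) :
    ‖f (z + v) - f z - fderiv ℝ f z v‖ ≤ C * ‖v‖ ^ 2 := by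
  have hb : ∀ x ∈ Metric.closedBall z ‖v‖, ‖fderiv ℝ f x - fderiv ℝ f z‖ ≤ C * ‖v‖ :=
    fun x hx => (h x z).trans (mul_le_mul_of_nonneg_left (by simpa [dist_eq_norm] using hx) hC)
  have := (convex_closedBall z ‖v‖).norm_image_sub_le_of_norm_fderiv_le' (fun x _ => hd x) hb
    (Metric.mem_closedBall_self (norm_nonneg _)) (show z + v ∈ _ by simp)
  rw [add_sub_cancel_left] at this
  rwa [pow_two, ← mul_assoc]

theorem exists_norm_fderiv_le {V W : Type*} [NormedAddCommGroup V] [NormedSpace ℝ V]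
    [NormedAddCommGroup W] [NormedSpace ℝ W] {f : V → W} (hf : ContDiff ℝ 1 f)
    (hc : HasCompactSupport f) : ∃ C : ℝ, 0 ≤ C ∧ ∀ x, ‖fderiv ℝ f x‖ ≤ C := by
  obtain ⟨C, h⟩ := (hc.fderiv (𝕜 := ℝ)).exists_bound_of_continuous
    (hf.continuous_fderiv one_ne_zero)
  exact ⟨C, (norm_nonneg _).trans (h 0), h⟩

/-- Compact support bounds Y and its first two derivatives; the sum of the three bounds serves for
every clause. -/
theorem exists_boundedField (hY : ContDiff ℝ 2 Y) (hc : HasCompactSupport Y) :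
    ∃ L, BoundedField Y L := by
  have h1 : ContDiff ℝ 1 (fderiv ℝ Y) := hY.fderiv_right (by norm_num)
  obtain ⟨C₀, h₀⟩ := hc.exists_bound_of_continuous hY.continuous
  obtain ⟨C₁, n₁, h₁⟩ := exists_norm_fderiv_le (hY.of_le (by norm_num)) hc
  obtain ⟨C₂, n₂, h₂⟩ := exists_norm_fderiv_le h1 (hc.fderiv (𝕜 := ℝ))
  have n₀ : 0 ≤ C₀ := (norm_nonneg _).trans (h₀ 0)
  have e₁ := norm_sub_le_of_norm_fderiv_le (hY.differentiable two_ne_zero) h₁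
  have e₂ := norm_sub_le_of_norm_fderiv_le (h1.differentiable one_ne_zero) h₂
  have e₃ := norm_sub_sub_le_of_lipschitz_fderiv n₂ (hY.differentiable two_ne_zero) e₂
  refine ⟨C₀ + C₁ + C₂, ?_⟩
  exact
    { nonneg := by positivity
      contDiff := hY
      norm_le := fun z => (h₀ z).trans (by linarith)
      norm_fderiv_le := fun z => (h₁ z).trans (by linarith)
      lip := fun z z' => (e₁ z z').trans (mul_le_mul_of_nonneg_right (by linarith) (norm_nonneg _))
      taylor := fun z h => (e₃ z h).trans
        (mul_le_mul_of_nonneg_right (by linarith) (sq_nonneg _)) }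

theorem BoundedField.continuous (hY : BoundedField Y L) : Continuous Y := hY.contDiff.continuous

theorem BoundedField.continuous_fderiv (hY : BoundedField Y L) : Continuous (fderiv ℝ Y) :=
  hY.contDiff.continuous_fderiv two_ne_zero

end Field

/-! ### Extension of curves by constants and of controls by zero. -/

section Extension

variable {V : Type*} [NormedAddCommGroup V]

/-- Extension of a continuous function on `[a,b]` by constants. -/
theorem exists_constant_extension {f : ℝ → V} {a b : ℝ} (hab : a ≤ b)
    (hf : ContinuousOn f (Icc a b)) :
    ∃ F : ℝ →ᵇ V, EqOn F f (Icc a b) ∧ (∀ t ≤ a, F t = F a) ∧ ∀ t, b ≤ t → F t = F b := by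
  obtain ⟨C, hC⟩ := isCompact_Icc.exists_bound_of_continuousOn hf
  have hC' : ∀ t, ‖IccExtend hab ((Icc a b).domRestrict f) t‖ ≤ C :=
    fun t => hC _ (projIcc a b hab t).2
  have hmk : ∀ t, BoundedContinuousFunction.ofNormedAddCommGroup _
      hf.domRestrict.Icc_extend' C hC' t = IccExtend hab ((Icc a b).domRestrict f) t :=
    fun t => rfl
  refine ⟨BoundedContinuousFunction.ofNormedAddCommGroup _ hf.domRestrict.Icc_extend' C hC',
    fun t ht => ?_, fun t ht => ?_, fun t ht => ?_⟩
  · rw [hmk, IccExtend_of_mem hab _ ht]; rfl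
  · rw [hmk, hmk, IccExtend_of_le_left hab _ ht, IccExtend_of_le_left hab _ le_rfl]
  · rw [hmk, hmk, IccExtend_of_right_le hab _ ht, IccExtend_of_right_le hab _ le_rfl]

theorem integrable_indicator_Ioc {g : ℝ → V} {a b : ℝ} (hab : a ≤ b)
    (hg : IntervalIntegrable g volume a b) : Integrable ((Ioc a b).indicator g) :=
  (integrable_indicator_iff measurableSet_Ioc).2
    ((intervalIntegrable_iff_integrableOn_Ioc_of_le hab).1 hg)

theorem integral_norm_indicator_Ioc {g : ℝ → V} {a b : ℝ} (hab : a ≤ b) :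
    ∫ r, ‖(Ioc a b).indicator g r‖ = ∫ r in a..b, ‖g r‖ := by
  simp_rw [norm_indicator_eq_indicator_norm]
  rw [integral_indicator measurableSet_Ioc, intervalIntegral.integral_of_le hab]

variable [NormedSpace ℝ V]

theorem integral_indicator_Ioc {g : ℝ → V} {a b t : ℝ} (ht : t ∈ Icc a b) :
    ∫ r in a..t, (Ioc a b).indicator g r = ∫ r in a..t, g r := by
  refine intervalIntegral.integral_congr_ae (Eventually.of_forall fun r hr => ?_)
  rw [uIoc_of_le ht.1] at hr
  exact indicator_of_mem (show r ∈ Ioc a b from ⟨hr.1, hr.2.trans ht.2⟩) g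

/-- Both sides are constant outside [a, b]. This moves an integral equation from [a, b] to the whole
line, where the contraction argument takes place in bounded continuous functions. -/
theorem eq_integral_indicator {F g : ℝ → V} {a b : ℝ} (hab : a ≤ b)
    (h0 : ∀ t ≤ a, F t = F a) (h1 : ∀ t, b ≤ t → F t = F b)
    (h : ∀ t ∈ Icc a b, F t = F a + ∫ r in a..t, g r) (t : ℝ) :
    F t = F a + ∫ r in a..t, (Ioc a b).indicator g r := by
  rcases le_total t a with hta | hta
  · have : ∫ r in a..t, (Ioc a b).indicator g r = ∫ r in a..t, (0 : V) := by
      refine intervalIntegral.integral_congr_ae (Eventually.of_forall fun r hr => ?_)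
      rw [uIoc_of_ge hta] at hr
      exact indicator_of_notMem (fun h => not_lt_of_ge hr.2 h.1) g
    rw [this, h0 t hta]; simp
  rcases le_total t b with htb | htb
  · rw [integral_indicator_Ioc ⟨hta, htb⟩]; exact h t ⟨hta, htb⟩
  · rw [h1 t htb, h b ⟨hab, le_rfl⟩, intervalIntegral.integral_of_le hta,
      intervalIntegral.integral_of_le hab, setIntegral_indicator measurableSet_Ioc,
      inter_eq_self_of_subset_right (Ioc_subset_Ioc_right htb)]

end Extension

/-! ### The control system: uniqueness and first-order perturbation. -/

section Solutions

variable {E A : Type*} [NormedAddCommGroup E] [NormedSpace ℝ E]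
  [NormedAddCommGroup A] [NormedSpace ℝ A] {Y : E → A →L[ℝ] E} {L : ℝ}

/-- `f` is a solution on `[a,b]` of the control system `f' = Y(f) w`. -/
structure IsSol (Y : E → A →L[ℝ] E) (w : ℝ → A) (f : ℝ → E) (a b : ℝ) : Prop where
  continuousOn : ContinuousOn f (Icc a b)
  eq : ∀ t ∈ Icc a b, f t = f a + ∫ r in a..t, Y (f r) (w r)

/-- `ξ` is a solution on `[a,b]` of the equation linearised at the solution `f` with control `w`,
for the variation `v` of the control. -/
structure IsLinearised (Y : E → A →L[ℝ] E) (w : ℝ → A) (f : ℝ → E) (v : ℝ → A) (ξ : ℝ → E)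
    (a b : ℝ) : Prop where
  continuousOn : ContinuousOn ξ (Icc a b)
  eq : ∀ t ∈ Icc a b,
    ξ t = ξ a + ∫ r in a..t, (fderiv ℝ Y (f r) (ξ r) (w r) + Y (f r) (v r))

theorem integrable_clm_apply {P : ℝ → A →L[ℝ] E} {w : ℝ → A} {C : ℝ}
    (hP : AEStronglyMeasurable P) (hC : ∀ t, ‖P t‖ ≤ C) (hw : Integrable w) :
    Integrable fun t => P t (w t) := by
  refine Integrable.mono' (hw.norm.const_mul C)
    ((ContinuousLinearMap.id ℝ (A →L[ℝ] E)).aestronglyMeasurable_comp₂ hP hw.1)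
    (Eventually.of_forall fun t => ?_)
  exact ((P t).le_opNorm _).trans (mul_le_mul_of_nonneg_right (hC t) (norm_nonneg _))

theorem BoundedField.integrable (hY : BoundedField Y L) {w : ℝ → A} (hw : Integrable w)
    {f : ℝ → E} (hf : Continuous f) : Integrable fun t => Y (f t) (w t) :=
  integrable_clm_apply (hY.continuous.comp hf).aestronglyMeasurable (fun _ => hY.norm_le _) hw

theorem BoundedField.integrable_fderiv (hY : BoundedField Y L) {w : ℝ → A} (hw : Integrable w)
    {f : ℝ → E} (hf : Continuous f) (ξ : ℝ →ᵇ E) :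
    Integrable fun t => fderiv ℝ Y (f t) (ξ t) (w t) := by
  refine integrable_clm_apply (C := L * ‖ξ‖)
    ((hY.continuous_fderiv.comp hf).clm_apply ξ.continuous).aestronglyMeasurable
    (fun t => ?_) hw
  exact ((fderiv ℝ Y (f t)).le_opNorm _).trans
    (mul_le_mul (hY.norm_fderiv_le _) (ξ.norm_coe_le_norm t) (norm_nonneg _) hY.nonneg)

/-- The extension of a solution by constants is a solution for the extension by zero of the
control. -/
theorem IsSol.exists_extension {w : ℝ → A} {f : ℝ → E} {a b : ℝ} (hab : a ≤ b)
    (hf : IsSol Y w f a b) : ∃ F : ℝ →ᵇ E, EqOn F f (Icc a b) ∧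
      ∀ t, F t = F a + ∫ r in a..t, Y (F r) ((Ioc a b).indicator w r) := by
  obtain ⟨F, hF, h0, h1⟩ := exists_constant_extension hab hf.continuousOn
  refine ⟨F, hF, fun t => ?_⟩
  have := eq_integral_indicator (g := fun r => Y (F r) (w r)) hab h0 h1 (fun t ht => by
    rw [hF ht, hF ⟨le_rfl, hab⟩, hf.eq t ht]
    congr 1
    refine intervalIntegral.integral_congr fun r hr => ?_
    rw [uIcc_of_le ht.1] at hr
    simp only [hF (show r ∈ Icc a b from ⟨hr.1, hr.2.trans ht.2⟩)]) t
  rw [this]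
  congr 2
  ext r
  by_cases hr : r ∈ Ioc a b <;> simp [hr]

theorem BoundedField.intervalIntegrable (hY : BoundedField Y L) {w : ℝ → A} {f : ℝ → E} {a b : ℝ}
    (hab : a ≤ b) (hf : ContinuousOn f (Icc a b)) (hw : IntervalIntegrable w volume a b) :
    IntervalIntegrable (fun r => Y (f r) (w r)) volume a b := by
  obtain ⟨F, hF, -⟩ := exists_constant_extension hab hf
  have := (hY.integrable (integrable_indicator_Ioc hab hw) F.continuous).intervalIntegrable
    (a := a) (b := b)
  refine this.congr fun r hr => ?_
  rw [uIoc_of_le hab] at hr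
  simp [hF (Ioc_subset_Icc_self hr), hr]

theorem IsSol.intervalIntegrable (hY : BoundedField Y L) {w : ℝ → A} {f : ℝ → E} {a b : ℝ}
    (hab : a ≤ b) (hf : IsSol Y w f a b) (hw : IntervalIntegrable w volume a b) :
    IntervalIntegrable (fun r => Y (f r) (w r)) volume a b :=
  hY.intervalIntegrable hab hf.continuousOn hw

variable [CompleteSpace E]

/-- Solutions of the control system on a short interval: existence and stability. -/
theorem BoundedField.exists_solution (hY : BoundedField Y L) {w : ℝ → A} (hw : Integrable w)
    {K : ℝ} (hK : L * ∫ t, ‖w t‖ ≤ K) (hK1 : K < 1) (t₀ : ℝ) (c : E) :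
    ∃ f : ℝ →ᵇ E, (∀ t, f t = c + ∫ r in t₀..t, Y (f r) (w r)) ∧
      ∀ (g : ℝ →ᵇ E) (ρ : ℝ), (∀ t, ‖g t - (c + ∫ r in t₀..t, Y (g r) (w r))‖ ≤ ρ) →
        dist g f ≤ ρ / (1 - K) := by
  refine exists_integral_solution (fun f r => Y (f r) (w r)) (fun f => hY.integrable hw f.continuous)
    (hw.norm.const_mul L) (fun f g t => ?_)
    ((mul_nonneg hY.nonneg (integral_nonneg fun _ => norm_nonneg _)).trans hK)
    (by rwa [integral_const_mul]) hK1 t₀ c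
  rw [← _root_.sub_apply]
  refine ((Y (f t) - Y (g t)).le_opNorm _).trans ?_
  have h1 : ‖Y (f t) - Y (g t)‖ ≤ L * dist f g := (hY.lip _ _).trans
    (mul_le_mul_of_nonneg_left (by rw [← dist_eq_norm]; exact BoundedContinuousFunction.dist_coe_le_dist t)
      hY.nonneg)
  calc _ ≤ L * dist f g * ‖w t‖ := mul_le_mul_of_nonneg_right h1 (norm_nonneg _)
    _ = _ := by ring

/-- Both extended solutions have defect zero in the same fixed-point equation, so both are at
distance zero from its fixed point. -/
theorem IsSol.unique (hY : BoundedField Y L) {w : ℝ → A} {f g : ℝ → E} {a b : ℝ} (hab : a ≤ b)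
    (hw : IntervalIntegrable w volume a b) (hK : L * ∫ t in a..b, ‖w t‖ ≤ 1 / 2)
    (hf : IsSol Y w f a b) (hg : IsSol Y w g a b) (h : f a = g a) : EqOn f g (Icc a b) := by
  obtain ⟨F, hF, hF'⟩ := hf.exists_extension hab
  obtain ⟨G, hG, hG'⟩ := hg.exists_extension hab
  have ha : a ∈ Icc a b := ⟨le_rfl, hab⟩
  obtain ⟨φ, -, hφ⟩ := hY.exists_solution (integrable_indicator_Ioc hab hw) (K := 1 / 2)
    (by rwa [integral_norm_indicator_Ioc hab]) (by norm_num) a (f a)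
  have h1 := hφ F 0 fun t => by rw [← hF ha, ← hF' t]; simp
  have h2 := hφ G 0 fun t => by rw [h, ← hG ha, ← hG' t]; simp
  rw [zero_div] at h1 h2
  have h3 : F = G := (dist_le_zero.1 h1).trans (dist_le_zero.1 h2).symm
  intro t ht
  rw [← hF ht, ← hG ht, h3]

/-- Perturbation of a solution, to first order, together with control and initial point. -/
theorem exists_perturbed_solutions (hY : BoundedField Y L) {w v : ℝ → A} {f ξ : ℝ → E} {a b : ℝ}
    (hab : a ≤ b) (hw : IntervalIntegrable w volume a b) (hv : IntervalIntegrable v volume a b)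
    (hK : L * ∫ t in a..b, ‖w t‖ ≤ 1 / 2) (hf : IsSol Y w f a b)
    (hξ : IsLinearised Y w f v ξ a b) {c : ℝ → E}
    (hc : (fun s => c s - f a - s • ξ a) =o[𝓝 0] fun s : ℝ => s) :
    ∃ (σ : ℝ → ℝ → E) (ρ : ℝ → ℝ), ρ =o[𝓝 0] (fun s : ℝ => s) ∧
      ∀ᶠ s in 𝓝 0, IsSol Y (fun t => w t + s • v t) (σ s) a b ∧ σ s a = c s ∧
        ∀ t ∈ Icc a b, ‖σ s t - f t - s • ξ t‖ ≤ ρ s := by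
  obtain ⟨F, hF, hF'⟩ := hf.exists_extension hab
  have ha : a ∈ Icc a b := ⟨le_rfl, hab⟩
  set W := (Ioc a b).indicator w with hWdef
  set Z := (Ioc a b).indicator v with hZdef
  have hW : Integrable W := integrable_indicator_Ioc hab hw
  have hZ : Integrable Z := integrable_indicator_Ioc hab hv
  obtain ⟨Ξ, hΞ, hΞ0, hΞ1⟩ := exists_constant_extension hab hξ.continuousOn
  have hΞ' : ∀ t, Ξ t = Ξ a + ∫ r in a..t, (fderiv ℝ Y (F r) (Ξ r) (W r) + Y (F r) (Z r)) := by
    intro t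
    have := eq_integral_indicator (g := fun r => fderiv ℝ Y (F r) (Ξ r) (w r) + Y (F r) (v r))
      hab hΞ0 hΞ1 (fun t ht => by
        rw [hΞ ht, hΞ ha, hξ.eq t ht]
        congr 1
        refine intervalIntegral.integral_congr fun r hr => ?_
        rw [uIcc_of_le ht.1] at hr
        have hr' : r ∈ Icc a b := ⟨hr.1, hr.2.trans ht.2⟩
        simp only [hF hr', hΞ hr']) t
    rw [this]
    congr 2
    ext r
    by_cases hr : r ∈ Ioc a b <;> simp [hr, hWdef, hZdef]
  have hWn : L * ∫ r, ‖W r‖ ≤ 1 / 2 := by rwa [integral_norm_indicator_Ioc hab]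
  have hZn : ∀ᶠ s : ℝ in 𝓝 0, |s| * (L * ∫ r, ‖Z r‖) < 1 / 4 := by
    have : Tendsto (fun s : ℝ => |s| * (L * ∫ r, ‖Z r‖)) (𝓝 0) (𝓝 (|0| * (L * ∫ r, ‖Z r‖))) :=
      (continuous_abs.mul continuous_const).tendsto 0
    exact this.eventually_lt_const (by simp)
  -- For small s the perturbed control has contraction constant at most 1/2 + 1/4 = 3/4. For other s
  -- the choice of σ is arbitrary.
  have hex : ∀ s : ℝ, ∃ σ : ℝ →ᵇ E, |s| * (L * ∫ r, ‖Z r‖) < 1 / 4 →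
      (∀ t, σ t = c s + ∫ r in a..t, Y (σ r) (W r + s • Z r)) ∧
      ∀ (g : ℝ →ᵇ E) (ρ : ℝ), (∀ t, ‖g t - (c s + ∫ r in a..t, Y (g r) (W r + s • Z r))‖ ≤ ρ) →
        dist g σ ≤ ρ / (1 - 3 / 4) := by
    intro s
    by_cases hs : |s| * (L * ∫ r, ‖Z r‖) < 1 / 4
    · have hle : L * ∫ r, ‖W r + s • Z r‖ ≤ 3 / 4 := by
        have : ∫ r, ‖W r + s • Z r‖ ≤ (∫ r, ‖W r‖) + |s| * ∫ r, ‖Z r‖ := by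
          rw [← integral_const_mul, ← integral_add hW.norm (hZ.norm.const_mul _)]
          refine integral_mono (hW.add (hZ.smul s)).norm (hW.norm.add (hZ.norm.const_mul _))
            fun r => ?_
          refine (norm_add_le _ _).trans ?_
          rw [norm_smul, Real.norm_eq_abs]
        have := mul_le_mul_of_nonneg_left this hY.nonneg
        linarith
      obtain ⟨σ, h⟩ := hY.exists_solution (hW.add (hZ.smul s)) hle (by norm_num) a (c s)
      exact ⟨σ, fun _ => h⟩
    · exact ⟨0, fun h => absurd h hs⟩
  choose σ hσ using hex
  -- The defect of the first-order ansatz F + s • Ξ is at most the error in the initial point plus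
  -- s²D: the first term of D comes from the Taylor remainder of Y acting on the control, the second
  -- from the variation of Y acting on that of the control.
  set D : ℝ := L * ‖Ξ‖ ^ 2 * (∫ r, ‖W r‖) + L * ‖Ξ‖ * ∫ r, ‖Z r‖ with hD
  refine ⟨fun s t => σ s t, fun s => (‖c s - f a - s • ξ a‖ + s ^ 2 * D) / (1 - 3 / 4), ?_, ?_⟩
  · have h2 : (fun s : ℝ => s ^ 2 * D) =o[𝓝 0] fun s : ℝ => s := by
      have := (isLittleO_pow_id (𝕜 := ℝ) (n := 2) (by norm_num)).const_mul_left D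
      simpa [mul_comm] using this
    have := (hc.norm_left.add h2).const_mul_left (1 - 3 / 4 : ℝ)⁻¹
    exact this.congr_left fun s => (div_eq_inv_mul _ _).symm
  · filter_upwards [hZn] with s hs
    obtain ⟨h1, h2⟩ := hσ s hs
    refine ⟨⟨(σ s).continuous.continuousOn, fun t ht => ?_⟩, ?_, fun t ht => ?_⟩
    · have e1 : σ s a = c s := by rw [h1 a]; simp
      rw [h1 t, e1]
      congr 1
      refine intervalIntegral.integral_congr_ae (Eventually.of_forall fun r hr => ?_)
      rw [uIoc_of_le ht.1] at hr
      have hr' : r ∈ Ioc a b := ⟨hr.1, hr.2.trans ht.2⟩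
      simp [hWdef, hZdef, hr']
    · rw [h1 a]; simp
    · have key := h2 (F + s • Ξ) (‖c s - f a - s • ξ a‖ + s ^ 2 * D) fun t => ?_
      · have h3 := (BoundedContinuousFunction.dist_coe_le_dist t).trans key
        rw [dist_comm, dist_eq_norm] at h3
        refine le_trans (le_of_eq ?_) h3
        simp only [BoundedContinuousFunction.add_apply, BoundedContinuousFunction.smul_apply, hF ht, hΞ ht]
        congr 1; abel
      · have iY : ∀ g : ℝ →ᵇ E, Integrable fun r => Y (g r) (W r + s • Z r) := fun g =>
          hY.integrable (hW.add (hZ.smul s)) g.continuous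
        have iL : Integrable fun r => fderiv ℝ Y (F r) (Ξ r) (W r) + Y (F r) (Z r) :=
          (hY.integrable_fderiv hW F.continuous Ξ).add (hY.integrable hZ F.continuous)
        have iF := hY.integrable hW F.continuous
        have e : (F + s • Ξ) t - (c s + ∫ r in a..t, Y ((F + s • Ξ) r) (W r + s • Z r)) =
            -(c s - f a - s • ξ a) + ∫ r in a..t, (Y (F r) (W r) +
              s • (fderiv ℝ Y (F r) (Ξ r) (W r) + Y (F r) (Z r)) -
              Y ((F + s • Ξ) r) (W r + s • Z r)) := by
          have iLs : Integrable fun r => s • (fderiv ℝ Y (F r) (Ξ r) (W r) + Y (F r) (Z r)) :=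
            iL.smul s
          rw [intervalIntegral.integral_sub (iF.intervalIntegrable.add iLs.intervalIntegrable)
            (iY _).intervalIntegrable, intervalIntegral.integral_add iF.intervalIntegrable
            iLs.intervalIntegrable, intervalIntegral.integral_smul,
            BoundedContinuousFunction.add_apply, BoundedContinuousFunction.smul_apply, hF' t, hΞ' t,
            hF ha, hΞ ha, smul_add]
          abel
        rw [e]
        refine (norm_add_le _ _).trans (add_le_add (by rw [norm_neg]) ?_)
        refine intervalIntegral.norm_integral_le_integral_norm_uIoc.trans ?_
        have iR : Integrable fun r => Y (F r) (W r) +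
              s • (fderiv ℝ Y (F r) (Ξ r) (W r) + Y (F r) (Z r)) -
              Y ((F + s • Ξ) r) (W r + s • Z r) := (iF.add (iL.smul s)).sub (iY _)
        refine (setIntegral_le_integral iR.norm
          (Eventually.of_forall fun _ => norm_nonneg _)).trans ?_
        have hbound : ∀ r, ‖Y (F r) (W r) + s • (fderiv ℝ Y (F r) (Ξ r) (W r) + Y (F r) (Z r)) -
              Y ((F + s • Ξ) r) (W r + s • Z r)‖ ≤
            s ^ 2 * (L * ‖Ξ‖ ^ 2) * ‖W r‖ + s ^ 2 * (L * ‖Ξ‖) * ‖Z r‖ := by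
          intro r
          -- After the first-order terms cancel, what remains is a Taylor remainder at s • Ξ and an
          -- increment of Y multiplied by s; both are quadratic in s.
          have e2 : Y (F r) (W r) + s • (fderiv ℝ Y (F r) (Ξ r) (W r) + Y (F r) (Z r)) -
              Y ((F + s • Ξ) r) (W r + s • Z r) =
              -((Y (F r + s • Ξ r) - Y (F r) - fderiv ℝ Y (F r) (s • Ξ r)) (W r)) -
              s • ((Y (F r + s • Ξ r) - Y (F r)) (Z r)) := by
            simp only [BoundedContinuousFunction.add_apply, BoundedContinuousFunction.smul_apply, map_add,
              map_smul, _root_.sub_apply, _root_.smul_apply, smul_sub,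
              smul_add]
            abel
          have hΞr : ‖s • Ξ r‖ ≤ |s| * ‖Ξ‖ := by
            rw [norm_smul, Real.norm_eq_abs]
            exact mul_le_mul_of_nonneg_left (Ξ.norm_coe_le_norm r) (abs_nonneg _)
          rw [e2]
          refine (norm_sub_le _ _).trans (add_le_add ?_ ?_)
          · rw [norm_neg]
            refine (ContinuousLinearMap.le_opNorm _ _).trans
              (mul_le_mul_of_nonneg_right ?_ (norm_nonneg _))
            refine (hY.taylor _ _).trans ?_
            have := pow_le_pow_left₀ (norm_nonneg _) hΞr 2
            rw [mul_pow, sq_abs] at this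
            calc L * ‖s • Ξ r‖ ^ 2 ≤ L * (s ^ 2 * ‖Ξ‖ ^ 2) :=
                  mul_le_mul_of_nonneg_left this hY.nonneg
              _ = _ := by ring
          · rw [norm_smul, Real.norm_eq_abs]
            have h4 : ‖Y (F r + s • Ξ r) - Y (F r)‖ ≤ L * (|s| * ‖Ξ‖) := by
              refine (hY.lip _ _).trans (mul_le_mul_of_nonneg_left ?_ hY.nonneg)
              rwa [add_sub_cancel_left]
            have h5 := (ContinuousLinearMap.le_opNorm (Y (F r + s • Ξ r) - Y (F r)) (Z r)).trans
              (mul_le_mul_of_nonneg_right h4 (norm_nonneg _))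
            calc _ ≤ |s| * (L * (|s| * ‖Ξ‖) * ‖Z r‖) :=
                  mul_le_mul_of_nonneg_left h5 (abs_nonneg _)
              _ = |s| ^ 2 * (L * ‖Ξ‖) * ‖Z r‖ := by ring
              _ = _ := by rw [sq_abs]
        refine (integral_mono iR.norm ((hW.norm.const_mul _).add (hZ.norm.const_mul _))
          hbound).trans (le_of_eq ?_)
        simp only [Pi.add_apply]
        rw [integral_add (hW.norm.const_mul _) (hZ.norm.const_mul _), integral_const_mul,
          integral_const_mul, hD]
        ring

end Solutions

end SubRiem

/-! ### Linearised and adjoint equations; the Lagrange multiplier rule. -/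

namespace SubRiem

open Filter Topology
open scoped BoundedContinuousFunction

set_option linter.unusedSectionVars false

/-- Solutions of linear integral equations on a short interval. -/
theorem exists_linear_solution {V : Type*} [NormedAddCommGroup V] [NormedSpace ℝ V]
    [CompleteSpace V] {B : ℝ → V →L[ℝ] V} (hB : Integrable B) (hB1 : ∫ t, ‖B t‖ ≤ 1 / 2)
    {g : ℝ → V} (hg : Integrable g) (t₀ : ℝ) (c : V) :
    ∃ ξ : ℝ →ᵇ V, ∀ t, ξ t = c + ∫ r in t₀..t, (B r (ξ r) + g r) := by
  have hint : ∀ f : ℝ →ᵇ V, Integrable fun r => B r (f r) + g r := fun f => by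
    refine Integrable.add (Integrable.mono' (hB.norm.mul_const ‖f‖)
      ((ContinuousLinearMap.id ℝ (V →L[ℝ] V)).aestronglyMeasurable_comp₂ hB.1
        f.continuous.aestronglyMeasurable) (Eventually.of_forall fun t => ?_)) hg
    exact ((B t).le_opNorm _).trans
      (mul_le_mul_of_nonneg_left (f.norm_coe_le_norm t) (norm_nonneg _))
  obtain ⟨ξ, h, -⟩ := exists_integral_solution (fun f r => B r (f r) + g r) hint hB.norm
    (fun f h t => by
      rw [add_sub_add_right_eq_sub, ← map_sub]
      refine ((B t).le_opNorm _).trans (mul_le_mul_of_nonneg_left ?_ (norm_nonneg _))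
      rw [← dist_eq_norm]; exact BoundedContinuousFunction.dist_coe_le_dist t)
    (by norm_num) hB1 (by norm_num) t₀ c
  exact ⟨ξ, h⟩

section Adjoint

variable {E A : Type*} [NormedAddCommGroup E] [InnerProductSpace ℝ E] [FiniteDimensional ℝ E]
  [NormedAddCommGroup A] [InnerProductSpace ℝ A] [FiniteDimensional ℝ A]
  {Y : E → A →L[ℝ] E} {L : ℝ}

/-- `η` is a solution on `[a,b]` of the adjoint of the linearised equation. -/
structure IsAdjoint (Y : E → A →L[ℝ] E) (w : ℝ → A) (f η : ℝ → E) (a b : ℝ) : Prop where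
  continuousOn : ContinuousOn η (Icc a b)
  eq : ∀ t ∈ Icc a b, η t = η a + ∫ r in a..t,
    -ContinuousLinearMap.adjoint ((fderiv ℝ Y (f r)).flip (w r)) (η r)

theorem BoundedField.integrable_flip (hY : BoundedField Y L) {w : ℝ → A} (hw : Integrable w)
    {f : ℝ → E} (hf : Continuous f) : Integrable fun t => (fderiv ℝ Y (f t)).flip (w t) :=
  integrable_clm_apply (C := L)
    ((ContinuousLinearMap.flipₗᵢ ℝ E A E).continuous.comp
      (hY.continuous_fderiv.comp hf)).aestronglyMeasurable
    (fun t => by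
      exact (ContinuousLinearMap.opNorm_flip _).trans_le (hY.norm_fderiv_le _)) hw

theorem BoundedField.norm_flip_le (hY : BoundedField Y L) (z : E) (w : A) :
    ‖(fderiv ℝ Y z).flip w‖ ≤ L * ‖w‖ :=
  ((fderiv ℝ Y z).flip.le_opNorm w).trans
    (mul_le_mul_of_nonneg_right (by rw [ContinuousLinearMap.opNorm_flip]; exact hY.norm_fderiv_le z)
      (norm_nonneg _))

theorem exists_isLinearised (hY : BoundedField Y L) {w v : ℝ → A} {f : ℝ → E} {a b : ℝ}
    (hab : a ≤ b) (hw : IntervalIntegrable w volume a b) (hv : IntervalIntegrable v volume a b)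
    (hK : L * ∫ t in a..b, ‖w t‖ ≤ 1 / 2) (hf : ContinuousOn f (Icc a b)) :
    ∃ ξ, IsLinearised Y w f v ξ a b ∧ ξ a = 0 := by
  obtain ⟨F, hF, -⟩ := exists_constant_extension hab hf
  have hW := integrable_indicator_Ioc hab hw
  have hZ := integrable_indicator_Ioc hab hv
  have hB := hY.integrable_flip hW F.continuous
  have hB1 : ∫ t, ‖(fderiv ℝ Y (F t)).flip ((Ioc a b).indicator w t)‖ ≤ 1 / 2 := by
    refine (integral_mono hB.norm (hW.norm.const_mul L) fun t => hY.norm_flip_le _ _).trans ?_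
    rwa [integral_const_mul, integral_norm_indicator_Ioc hab]
  obtain ⟨ξ, hξ⟩ := exists_linear_solution hB hB1 (hY.integrable hZ F.continuous) a 0
  have h0 : ξ a = 0 := by rw [hξ a]; simp
  refine ⟨ξ, ⟨ξ.continuous.continuousOn, fun t ht => ?_⟩, h0⟩
  rw [hξ t, h0]
  congr 1
  refine intervalIntegral.integral_congr_ae (Eventually.of_forall fun r hr => ?_)
  rw [uIoc_of_le ht.1] at hr
  have hr' : r ∈ Ioc a b := ⟨hr.1, hr.2.trans ht.2⟩
  simp [hr', hF (Ioc_subset_Icc_self hr')]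

/-- Passing to the adjoint preserves the norm of the coefficient, so the contraction argument
applies as it does for the linearised equation. It is run with base point b, since a terminal value
is prescribed, and the equation is then rewritten with base point a. -/
theorem exists_isAdjoint (hY : BoundedField Y L) {w : ℝ → A} {f : ℝ → E} {a b : ℝ}
    (hab : a ≤ b) (hw : IntervalIntegrable w volume a b)
    (hK : L * ∫ t in a..b, ‖w t‖ ≤ 1 / 2) (hf : ContinuousOn f (Icc a b)) (e : E) :
    ∃ η, IsAdjoint Y w f η a b ∧ η b = e := by
  obtain ⟨F, hF, -⟩ := exists_constant_extension hab hf
  have hW := integrable_indicator_Ioc hab hw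
  have hB := hY.integrable_flip hW F.continuous
  set B : ℝ → E →L[ℝ] E := fun t =>
    -ContinuousLinearMap.adjoint ((fderiv ℝ Y (F t)).flip ((Ioc a b).indicator w t)) with hBdef
  have hBn : ∀ t, ‖B t‖ = ‖(fderiv ℝ Y (F t)).flip ((Ioc a b).indicator w t)‖ := fun t => by
    rw [hBdef, norm_neg, LinearIsometryEquiv.norm_map]
  have hBi : Integrable B := by
    refine Integrable.mono' hB.norm ?_ (Eventually.of_forall fun t => (hBn t).le)
    exact ((ContinuousLinearMap.adjoint (𝕜 := ℝ) (E := E) (F := E)).continuous.comp_aestronglyMeasurable hB.1).neg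
  have hB1 : ∫ t, ‖B t‖ ≤ 1 / 2 := by
    simp_rw [hBn]
    refine (integral_mono hB.norm (hW.norm.const_mul L) fun t => hY.norm_flip_le _ _).trans ?_
    rwa [integral_const_mul, integral_norm_indicator_Ioc hab]
  obtain ⟨η, hη⟩ := exists_linear_solution hBi hB1 (integrable_zero ℝ E volume) b e
  have hint : Integrable fun r => B r (η r) := by
    refine Integrable.mono' (hBi.norm.mul_const ‖η‖)
      ((ContinuousLinearMap.id ℝ (E →L[ℝ] E)).aestronglyMeasurable_comp₂ hBi.1
        η.continuous.aestronglyMeasurable) (Eventually.of_forall fun t => ?_)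
    exact ((B t).le_opNorm _).trans
      (mul_le_mul_of_nonneg_left (η.norm_coe_le_norm t) (norm_nonneg _))
  simp only [Pi.zero_apply, add_zero] at hη
  refine ⟨η, ⟨η.continuous.continuousOn, fun t ht => ?_⟩, by rw [hη b]; simp⟩
  have e1 : η t = η a + ∫ r in a..t, B r (η r) := by
    rw [hη t, hη a, add_assoc, intervalIntegral.integral_add_adjacent_intervals
      hint.intervalIntegrable hint.intervalIntegrable]
  rw [e1]
  congr 1
  refine intervalIntegral.integral_congr_ae (Eventually.of_forall fun r hr => ?_)
  rw [uIoc_of_le ht.1] at hr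
  have hr' : r ∈ Ioc a b := ⟨hr.1, hr.2.trans ht.2⟩
  simp [hBdef, hr', hF (Ioc_subset_Icc_self hr')]

theorem IsAdjoint.intervalIntegrable (hY : BoundedField Y L) {w : ℝ → A} {f η : ℝ → E} {a b : ℝ}
    (hab : a ≤ b) (hw : IntervalIntegrable w volume a b) (hf : ContinuousOn f (Icc a b))
    (hη : IsAdjoint Y w f η a b) : IntervalIntegrable (fun r =>
      -ContinuousLinearMap.adjoint ((fderiv ℝ Y (f r)).flip (w r)) (η r)) volume a b := by
  obtain ⟨F, hF, -⟩ := exists_constant_extension hab hf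
  obtain ⟨H, hH, -⟩ := exists_constant_extension hab hη.continuousOn
  have hB := hY.integrable_flip (integrable_indicator_Ioc hab hw) F.continuous
  have hB' := (ContinuousLinearMap.adjoint (𝕜 := ℝ) (E := E) (F := E)).continuous.comp_aestronglyMeasurable hB.1
  have hint : Integrable fun r => -ContinuousLinearMap.adjoint
      ((fderiv ℝ Y (F r)).flip ((Ioc a b).indicator w r)) (H r) := by
    refine Integrable.neg (Integrable.mono' (hB.norm.mul_const ‖H‖)
      ((ContinuousLinearMap.id ℝ (E →L[ℝ] E)).aestronglyMeasurable_comp₂ hB'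
        H.continuous.aestronglyMeasurable) (Eventually.of_forall fun t => ?_))
    refine (ContinuousLinearMap.le_opNorm _ _).trans
      (mul_le_mul (le_of_eq (LinearIsometryEquiv.norm_map _ _)) (H.norm_coe_le_norm t)
        (norm_nonneg _) (norm_nonneg _))
  refine (hint.intervalIntegrable (a := a) (b := b)).congr fun r hr => ?_
  rw [uIoc_of_le hab] at hr
  simp [hF (Ioc_subset_Icc_self hr), hH (Ioc_subset_Icc_self hr), hr]

theorem IsLinearised.intervalIntegrable (hY : BoundedField Y L) {w v : ℝ → A} {f ξ : ℝ → E}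
    {a b : ℝ} (hab : a ≤ b) (hw : IntervalIntegrable w volume a b)
    (hv : IntervalIntegrable v volume a b) (hf : ContinuousOn f (Icc a b))
    (hξ : IsLinearised Y w f v ξ a b) : IntervalIntegrable (fun r =>
      fderiv ℝ Y (f r) (ξ r) (w r) + Y (f r) (v r)) volume a b := by
  obtain ⟨F, hF, -⟩ := exists_constant_extension hab hf
  obtain ⟨Ξ, hΞ, -⟩ := exists_constant_extension hab hξ.continuousOn
  have := (hY.integrable_fderiv (integrable_indicator_Ioc hab hw) F.continuous Ξ).add
    (hY.integrable (integrable_indicator_Ioc hab hv) F.continuous)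
  refine (this.intervalIntegrable (a := a) (b := b)).congr fun r hr => ?_
  rw [uIoc_of_le hab] at hr
  simp [hF (Ioc_subset_Icc_self hr), hΞ (Ioc_subset_Icc_self hr), hr]

/-- The integrated product rule for the inner product of two absolutely continuous functions. -/
theorem inner_sub_inner_eq_integral {f g f' g' : ℝ → E} {a b : ℝ} (hab : a ≤ b)
    (hfi : IntervalIntegrable f' volume a b) (hgi : IntervalIntegrable g' volume a b)
    (hf : ∀ t ∈ Icc a b, f t = f a + ∫ r in a..t, f' r)
    (hg : ∀ t ∈ Icc a b, g t = g a + ∫ r in a..t, g' r) :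
    inner ℝ (f b) (g b) - inner ℝ (f a) (g a) =
      ∫ t in a..b, (inner ℝ (f t) (g' t) + inner ℝ (f' t) (g t)) := by
  have cf := absolutelyContinuousOnInterval_of_eq_integral hab hfi hf
  have cg := absolutelyContinuousOnInterval_of_eq_integral hab hgi hg
  obtain ⟨C, hC⟩ := cf.exists_bound
  obtain ⟨D, hD⟩ := cg.exists_bound
  have hac : AbsolutelyContinuousOnInterval (fun t => inner ℝ (f t) (g t)) a b := by
    refine absolutelyContinuousOnInterval_of_dist_le (C := D) (D := C) cf cg
      fun s hs t ht => ?_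
    have e : inner ℝ (f s) (g s) - inner ℝ (f t) (g t) =
        inner ℝ (f s - f t) (g s) + inner ℝ (f t) (g s - g t) := by
      rw [inner_sub_left, inner_sub_right]; ring
    rw [Real.dist_eq, e, dist_eq_norm, dist_eq_norm]
    refine (abs_add_le _ _).trans (add_le_add ?_ ?_)
    · rw [mul_comm]
      exact (abs_real_inner_le_norm _ _).trans
        (mul_le_mul_of_nonneg_left (hD s hs) (norm_nonneg _))
    · exact (abs_real_inner_le_norm _ _).trans
        (mul_le_mul_of_nonneg_right (hC t ht) (norm_nonneg _))
  rw [← hac.integral_deriv_eq_sub]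
  have df := ae_hasDerivAt_of_eq_integral hab hfi hf
  have dg := ae_hasDerivAt_of_eq_integral hab hgi hg
  rw [ae_restrict_iff' measurableSet_Icc] at df dg
  refine intervalIntegral.integral_congr_ae ?_
  filter_upwards [df, dg] with t h1 h2 ht
  rw [uIoc_of_le hab] at ht
  have ht' := Ioc_subset_Icc_self ht
  exact ((h1 ht').inner ℝ (h2 ht')).deriv

/-- The pairing of a solution of the adjoint equation with one of the linearised equation. -/
theorem IsAdjoint.inner_eq_integral (hY : BoundedField Y L) {w v : ℝ → A} {f ξ η : ℝ → E}
    {a b : ℝ} (hab : a ≤ b) (hw : IntervalIntegrable w volume a b)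
    (hv : IntervalIntegrable v volume a b) (hf : ContinuousOn f (Icc a b))
    (hξ : IsLinearised Y w f v ξ a b) (hξ0 : ξ a = 0) (hη : IsAdjoint Y w f η a b) :
    inner ℝ (η b) (ξ b) = ∫ t in a..b, inner ℝ (η t) (Y (f t) (v t)) := by
  have := inner_sub_inner_eq_integral hab (hη.intervalIntegrable hY hab hw hf)
    (hξ.intervalIntegrable hY hab hw hv hf) hη.eq hξ.eq
  rw [hξ0, inner_zero_right, sub_zero] at this
  rw [this]
  -- The two terms containing the derivative of Y cancel, by the definition of the adjoint.
  refine intervalIntegral.integral_congr fun t _ => ?_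
  simp only [inner_add_right, inner_neg_left, ContinuousLinearMap.adjoint_inner_left,
    ContinuousLinearMap.flip_apply]
  ring

/-- The Lagrange multiplier rule: a functional `v ↦ ∫ ⟨g, v⟩` that vanishes on the variations that
fix the end point to first order is represented by a solution of the adjoint equation. -/
theorem exists_adjoint_of_critical (hY : BoundedField Y L) {w g : ℝ → A} {f : ℝ → E} {a b : ℝ}
    (hab : a ≤ b) (hw : IntervalIntegrable w volume a b) (hg : IntervalIntegrable g volume a b)
    (hK : L * ∫ t in a..b, ‖w t‖ ≤ 1 / 2) (hf : ContinuousOn f (Icc a b))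
    (hcrit : ∀ (v : ℝ →ᵇ A) (ξ : ℝ → E), IsLinearised Y w f v ξ a b → ξ a = 0 → ξ b = 0 →
      ∫ t in a..b, inner ℝ (g t) (v t) = 0) :
    ∃ η, IsAdjoint Y w f η a b ∧
      ∀ᵐ t ∂volume.restrict (Icc a b), g t = ContinuousLinearMap.adjoint (Y (f t)) (η t) := by
  set e := stdOrthonormalBasis ℝ E with he
  -- Pairing with the adjoint solution that ends at the basis vector e j reads off the coordinate j
  -- of ξ b as an integral functional of the variation.
  choose η hη hηb using fun j => exists_isAdjoint hY hab hw hK hf (e j)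
  have hvi : ∀ v : ℝ →ᵇ A, IntervalIntegrable v volume a b := fun v =>
    v.continuous.intervalIntegrable a b
  have hpair : ∀ (h : ℝ → A), IntervalIntegrable h volume a b → ∀ v : ℝ →ᵇ A,
      IntervalIntegrable (fun t => inner ℝ (h t) (v t)) volume a b := fun h hh v => by
    refine (hh.norm.mul_const ‖v‖).mono_fun ?_ (Eventually.of_forall fun t => ?_)
    · exact AEStronglyMeasurable.inner (intervalIntegrable_iff.1 hh).aestronglyMeasurable
        v.continuous.aestronglyMeasurable
    · refine (norm_inner_le_norm _ _).trans ?_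
      refine le_trans ?_ (Real.le_norm_self _)
      exact mul_le_mul_of_nonneg_left (v.norm_coe_le_norm t) (norm_nonneg _)
  let ℓ : ∀ h : ℝ → A, IntervalIntegrable h volume a b → (ℝ →ᵇ A) →ₗ[ℝ] ℝ := fun h hh =>
    { toFun := fun v => ∫ t in a..b, inner ℝ (h t) (v t)
      map_add' := fun v v' => by
        rw [← intervalIntegral.integral_add (hpair h hh v) (hpair h hh v')]
        simp [inner_add_right]
      map_smul' := fun r v => by
        rw [RingHom.id_apply, smul_eq_mul, ← intervalIntegral.integral_const_mul]
        simp [inner_smul_right] }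
  have hkc : ∀ j, ContinuousOn (fun t => ContinuousLinearMap.adjoint (Y (f t)) (η j t))
      (Icc a b) := fun j => by
    have h1 : ContinuousOn (fun t => ContinuousLinearMap.adjoint (Y (f t))) (Icc a b) :=
      (ContinuousLinearMap.adjoint (𝕜 := ℝ) (E := A) (F := E)).continuous.comp_continuousOn
        (hY.continuous.comp_continuousOn hf)
    exact h1.clm_apply (hη j).continuousOn
  have hki : ∀ j, IntervalIntegrable (fun t => ContinuousLinearMap.adjoint (Y (f t)) (η j t))
      volume a b := fun j => (hkc j).intervalIntegrable_of_Icc hab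
  -- A functional that vanishes on the common kernel of finitely many functionals is a combination
  -- of them. The common kernel here consists of the variations with ξ b = 0.
  have hspan : ℓ g hg ∈ Submodule.span ℝ (range fun j => ℓ _ (hki j)) := by
    refine mem_span_of_iInf_ker_le_ker fun v hv => ?_
    obtain ⟨ξ, hξ, hξ0⟩ := exists_isLinearised hY hab hw (hvi v) hK hf
    have hξb : ξ b = 0 := by
      refine InnerProductSpace.ext_inner_left_basis e.toBasis fun j => ?_
      rw [OrthonormalBasis.coe_toBasis, ← hηb j,
        (hη j).inner_eq_integral hY hab hw (hvi v) hf hξ hξ0, inner_zero_right]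
      have := (Submodule.mem_iInf _).1 hv j
      rw [LinearMap.mem_ker] at this
      rw [← this]
      refine intervalIntegral.integral_congr fun t _ => ?_
      exact (ContinuousLinearMap.adjoint_inner_left _ _ _).symm
    exact hcrit v ξ hξ hξ0 hξb
  obtain ⟨c, hc⟩ := (Submodule.mem_span_range_iff_exists_fun ℝ).1 hspan
  refine ⟨fun t => ∑ j, c j • η j t, ⟨?_, fun t ht => ?_⟩, ?_⟩
  · exact continuousOn_finsetSum _ fun j _ => (hη j).continuousOn.const_smul (c j)
  · simp only [map_sum, map_smul]
    have : ∀ r, -∑ j, c j • ContinuousLinearMap.adjoint ((fderiv ℝ Y (f r)).flip (w r)) (η j r) =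
        ∑ j, c j • -ContinuousLinearMap.adjoint ((fderiv ℝ Y (f r)).flip (w r)) (η j r) := by
      intro r; simp
    simp_rw [this]
    rw [intervalIntegral.integral_finsetSum, ← Finset.sum_add_distrib]
    · refine Finset.sum_congr rfl fun j _ => ?_
      rw [intervalIntegral.integral_smul, ← smul_add, ← (hη j).eq t ht]
    · intro j _
      refine (((hη j).intervalIntegrable hY hab hw hf).smul (c j)).mono_set ?_
      exact uIcc_subset_uIcc_left (by rwa [uIcc_of_le hab])
  · set k : ℝ → A := fun t => ∑ j, c j • ContinuousLinearMap.adjoint (Y (f t)) (η j t) with hk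
    have hkint : IntervalIntegrable k volume a b := by
      have : ContinuousOn k (Icc a b) :=
        continuousOn_finsetSum _ fun j _ => (hkc j).const_smul (c j)
      exact this.intervalIntegrable_of_Icc hab
    have hzero : ∀ v : ℝ →ᵇ A, ∫ t in a..b, inner ℝ (g t - k t) (v t) = 0 := by
      intro v
      have h1 : ∫ t in a..b, inner ℝ (g t) (v t) = ∫ t in a..b, inner ℝ (k t) (v t) := by
        have h2 : ℓ g hg v = (∑ j, c j • ℓ _ (hki j)) v := by rw [hc]
        rw [LinearMap.sum_apply] at h2
        have h3 : ∀ t, inner ℝ (k t) (v t) = ∑ j, c j * inner ℝ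
            (ContinuousLinearMap.adjoint (Y (f t)) (η j t)) (v t) := fun t => by
          rw [hk, sum_inner]
          exact Finset.sum_congr rfl fun j _ => real_inner_smul_left _ _ _
        simp_rw [h3]
        rw [intervalIntegral.integral_finsetSum
          (fun j _ => (hpair _ (hki j) v).const_mul (c j))]
        refine h2.trans (Finset.sum_congr rfl fun j _ => ?_)
        rw [intervalIntegral.integral_const_mul]; rfl
      simp_rw [inner_sub_left]
      rw [intervalIntegral.integral_sub (hpair g hg v) (hpair k hkint v), h1, sub_self]
    have hint := integrable_indicator_Ioc hab (hg.sub hkint)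
    -- The fundamental lemma of the calculus of variations, tested with a scalar bump times a fixed
    -- vector x.
    have hae := ae_eq_zero_of_integral_contDiff_smul_eq_zero hint.locallyIntegrable
      (fun φ hφ hφc => by
        obtain ⟨C, hC⟩ := hφc.exists_bound_of_continuous hφ.continuous
        have hφi : Integrable fun t => φ t • (Ioc a b).indicator (fun x => g x - k x) t := by
          refine Integrable.mono' (hint.norm.const_mul C)
            (hφ.continuous.aestronglyMeasurable.smul hint.1) (Eventually.of_forall fun t => ?_)
          rw [norm_smul]
          exact mul_le_mul_of_nonneg_right (hC t) (norm_nonneg _)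
        refine ext_inner_left ℝ fun x => ?_
        rw [inner_zero_right, ← integral_inner hφi]
        let v : ℝ →ᵇ A := BoundedContinuousFunction.ofNormedAddCommGroup (fun t => φ t • x)
          (hφ.continuous.smul continuous_const) (C * ‖x‖) (fun t => by
            rw [norm_smul]; exact mul_le_mul_of_nonneg_right (hC t) (norm_nonneg _))
        rw [← hzero v, intervalIntegral.integral_of_le hab, ← integral_indicator measurableSet_Ioc]
        refine integral_congr_ae (Eventually.of_forall fun t => ?_)
        change _ = (Ioc a b).indicator (fun t => inner ℝ (g t - k t) (φ t • x)) t
        by_cases ht : t ∈ Ioc a b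
        · simp [ht, inner_smul_right, real_inner_comm]
        · simp [ht])
    have hne : ∀ᵐ x : ℝ, x ≠ a := by simp [ae_iff, measure_singleton]
    rw [ae_restrict_iff' measurableSet_Icc]
    filter_upwards [hae, hne] with t h1 h2 ht
    rw [indicator_of_mem (show t ∈ Ioc a b from ⟨lt_of_le_of_ne ht.1 (Ne.symm h2), ht.2⟩),
      sub_eq_zero] at h1
    rw [h1, hk]
    simp

end Adjoint

end SubRiem

/-! ### The power q of the norm and its derivative. -/

namespace SubRiem

open Filter Topology

set_option linter.unusedSectionVars false

section NormPow

variable {F : Type*} [NormedAddCommGroup F] [InnerProductSpace ℝ F]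

/-- The derivative of `x ↦ ‖x‖ ^ q`. -/
noncomputable def normPowDeriv (q : ℝ) (x : F) : F →L[ℝ] ℝ := (q * ‖x‖ ^ (q - 2)) • innerSL ℝ x

theorem normPowDeriv_apply (q : ℝ) (x y : F) :
    normPowDeriv q x y = q * ‖x‖ ^ (q - 2) * inner ℝ x y := rfl

theorem normPowDeriv_smul {q r : ℝ} (hr : 0 < r) (x : F) :
    normPowDeriv q (r • x) = r ^ (q - 1) • normPowDeriv q x := by
  ext y
  rw [_root_.smul_apply, normPowDeriv_apply, normPowDeriv_apply, norm_smul, Real.norm_eq_abs,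
    abs_of_pos hr, Real.mul_rpow hr.le (norm_nonneg _), real_inner_smul_left, smul_eq_mul,
    show q - 1 = q - 2 + 1 by ring, Real.rpow_add_one hr.ne']
  ring

theorem abs_normPowDeriv_apply_le {q : ℝ} (hq : 1 < q) (x y : F) :
    |normPowDeriv q x y| ≤ q * (‖x‖ ^ (q - 1) * ‖y‖) := by
  rcases eq_or_ne x 0 with rfl | hx
  · rw [normPowDeriv_apply, inner_zero_left, mul_zero, abs_zero]; positivity
  have hx' : 0 < ‖x‖ := norm_pos_iff.2 hx
  rw [normPowDeriv_apply, abs_mul, abs_of_nonneg (by positivity : 0 ≤ q * ‖x‖ ^ (q - 2)),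
    show q - 1 = q - 2 + 1 by ring, Real.rpow_add_one hx'.ne', mul_assoc, mul_assoc]
  have := abs_real_inner_le_norm x y
  gcongr

variable [FiniteDimensional ℝ F]

theorem continuous_normPowDeriv {q : ℝ} (hq : 1 < q) :
    Continuous (normPowDeriv q : F → F →L[ℝ] ℝ) := by
  have := (contDiff_norm_rpow (E := F) hq).continuous_fderiv one_ne_zero
  convert! this using 1
  ext1 x
  exact (fderiv_norm_rpow x hq).symm

/-- A quantitative first order expansion of `x ↦ ‖x‖ ^ q`. -/
theorem exists_norm_rpow_expansion {q : ℝ} (hq : 1 < q) {ε : ℝ} (hε : 0 < ε) :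
    ∃ C : ℝ, 0 ≤ C ∧ ∀ a b : F, |‖a + b‖ ^ q - ‖a‖ ^ q - normPowDeriv q a b| ≤
      ε * (‖a‖ ^ (q - 1) * ‖b‖) + C * ‖b‖ ^ q := by
  -- By homogeneity only unit vectors a matter, up to scaling. A perturbation of relative size at
  -- most δ ≤ 1 stays in the ball of radius 2, where the derivative is uniformly continuous.
  have huc := (isCompact_closedBall (0 : F) 2).uniformContinuousOn_of_continuous
    (continuous_normPowDeriv hq).continuousOn
  obtain ⟨δ', hδ', h⟩ := Metric.uniformContinuousOn_iff_le.1 huc ε hε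
  set δ := min δ' 1 with hδdef
  have hδ : 0 < δ := lt_min hδ' one_pos
  have hδ1 : δ ≤ 1 := min_le_right _ _
  have hq0 : 0 < q := one_pos.trans hq
  refine ⟨(1 / δ + 1) ^ q + (1 / δ) ^ q + q * (1 / δ) ^ (q - 1), by positivity, fun a b => ?_⟩
  rcases le_or_gt ‖b‖ (δ * ‖a‖) with hb | hb
  · rcases eq_or_ne a 0 with rfl | ha
    · have : b = 0 := by simpa using hb
      subst this
      simp [Real.zero_rpow hq0.ne', normPowDeriv]
    have ha' : 0 < ‖a‖ := norm_pos_iff.2 ha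
    have hbound : ∀ x ∈ Metric.closedBall a ‖b‖,
        ‖normPowDeriv q x - normPowDeriv q a‖ ≤ ε * ‖a‖ ^ (q - 1) := by
      intro x hx
      rw [Metric.mem_closedBall, dist_eq_norm] at hx
      have e : ∀ z : F, normPowDeriv q z = ‖a‖ ^ (q - 1) • normPowDeriv q (‖a‖⁻¹ • z) := by
        intro z
        rw [← normPowDeriv_smul ha', smul_inv_smul₀ ha'.ne']
      have n1 : ‖‖a‖⁻¹ • a‖ = 1 := by
        rw [norm_smul, norm_inv, norm_norm, inv_mul_cancel₀ ha'.ne']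
      have n2 : ‖‖a‖⁻¹ • x - ‖a‖⁻¹ • a‖ ≤ δ := by
        rw [← smul_sub, norm_smul, norm_inv, norm_norm, inv_mul_le_iff₀ ha', mul_comm]
        exact hx.trans hb
      have n3 : ‖‖a‖⁻¹ • x‖ ≤ 2 := by
        have := norm_add_le (‖a‖⁻¹ • x - ‖a‖⁻¹ • a) (‖a‖⁻¹ • a)
        rw [sub_add_cancel] at this
        linarith
      have := h (‖a‖⁻¹ • x) (by simpa using n3) (‖a‖⁻¹ • a)
        (by rw [Metric.mem_closedBall, dist_zero_right, n1]; norm_num)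
        (by rw [dist_eq_norm]; exact n2.trans (min_le_left _ _))
      have e' : normPowDeriv q x - normPowDeriv q a = ‖a‖ ^ (q - 1) •
          (normPowDeriv q (‖a‖⁻¹ • x) - normPowDeriv q (‖a‖⁻¹ • a)) := by
        ext y
        rw [e x, e a]
        simp [mul_sub]
      rw [e', norm_smul, Real.norm_of_nonneg (by positivity), mul_comm]
      rw [dist_eq_norm] at this
      gcongr
    have := (convex_closedBall a ‖b‖).norm_image_sub_le_of_norm_hasFDerivWithin_le'
      (fun x _ => (hasFDerivAt_norm_rpow x hq).hasFDerivWithinAt) hbound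
      (Metric.mem_closedBall_self (norm_nonneg _)) (show a + b ∈ _ by simp)
    rw [add_sub_cancel_left, Real.norm_eq_abs, mul_assoc] at this
    exact this.trans (le_add_of_nonneg_right (by positivity))
  -- When b is not small relative to a, no cancellation is needed: each of the three terms is a
  -- multiple of ‖b‖ ^ q, which explains the three summands of C.
  · have ha : ‖a‖ ≤ 1 / δ * ‖b‖ := by
      rw [div_mul_eq_mul_div, one_mul, le_div_iff₀ hδ, mul_comm]; exact hb.le
    have hb0 : 0 < ‖b‖ := lt_of_le_of_lt (by positivity) hb
    have e1 : ‖a + b‖ ^ q ≤ (1 / δ + 1) ^ q * ‖b‖ ^ q := by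
      rw [← Real.mul_rpow (by positivity) (norm_nonneg _)]
      refine Real.rpow_le_rpow (norm_nonneg _) ((norm_add_le _ _).trans ?_) hq0.le
      linarith
    have e2 : ‖a‖ ^ q ≤ (1 / δ) ^ q * ‖b‖ ^ q := by
      rw [← Real.mul_rpow (by positivity) (norm_nonneg _)]
      exact Real.rpow_le_rpow (norm_nonneg _) ha hq0.le
    have e3 : |normPowDeriv q a b| ≤ q * (1 / δ) ^ (q - 1) * ‖b‖ ^ q := by
      refine (abs_normPowDeriv_apply_le hq a b).trans ?_
      have : ‖a‖ ^ (q - 1) ≤ (1 / δ) ^ (q - 1) * ‖b‖ ^ (q - 1) := by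
        rw [← Real.mul_rpow (by positivity) (norm_nonneg _)]
        exact Real.rpow_le_rpow (norm_nonneg _) ha (by linarith)
      have e4 : ‖b‖ ^ q = ‖b‖ ^ (q - 1) * ‖b‖ := by
        rw [← Real.rpow_add_one hb0.ne', sub_add_cancel]
      rw [e4]
      calc q * (‖a‖ ^ (q - 1) * ‖b‖) ≤ q * ((1 / δ) ^ (q - 1) * ‖b‖ ^ (q - 1) * ‖b‖) := by gcongr
        _ = _ := by ring
    have p1 : 0 ≤ ‖a + b‖ ^ q := by positivity
    have p2 : 0 ≤ ‖a‖ ^ q := by positivity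
    have e5 : 0 ≤ ε * (‖a‖ ^ (q - 1) * ‖b‖) := by positivity
    have e6 := abs_le.1 e3
    rw [add_mul, add_mul, abs_le]
    constructor <;> linarith [e6.1, e6.2]

end NormPow

/-! ### Differentiability of the p-energy on L^p. -/

section Energy

variable {α F : Type*} [MeasurableSpace α] {μ : Measure α} [NormedAddCommGroup F]
  {p : ℝ≥0∞}

theorem integrable_norm_rpow_Lp (hp0 : p ≠ 0) (hp' : p ≠ ⊤) (u : Lp F p μ) :
    Integrable (fun t => ‖u t‖ ^ p.toReal) μ :=
  (Lp.memLp u).integrable_norm_rpow hp0 hp'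

theorem integral_norm_rpow_Lp (hp0 : p ≠ 0) (hp' : p ≠ ⊤) (u : Lp F p μ) :
    ∫ t, ‖u t‖ ^ p.toReal ∂μ = ‖u‖ ^ p.toReal := by
  have hq := ENNReal.toReal_pos hp0 hp'
  have h0 : 0 ≤ ∫ t, ‖u t‖ ^ p.toReal ∂μ := integral_nonneg fun t => by positivity
  rw [Lp.norm_def, (Lp.memLp u).eLpNorm_eq_integral_rpow_norm hp0 hp',
    ENNReal.toReal_ofReal (by positivity), ← Real.rpow_mul h0, inv_mul_cancel₀ hq.ne',
    Real.rpow_one]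

/-- A crude Young inequality: for s = 1 replace the smaller of x and y by the larger, then apply
this to y / s. The free parameter s makes the integrated bound linear in the norm of y. -/
theorem rpow_mul_le_of_pos {q s x y : ℝ} (hq : 1 < q) (hs : 0 < s) (hx : 0 ≤ x) (hy : 0 ≤ y) :
    x ^ (q - 1) * y ≤ s * (x ^ q + (s ^ q)⁻¹ * y ^ q) := by
  have hz : 0 ≤ s⁻¹ * y := by positivity
  have key : ∀ z, 0 ≤ z → x ^ (q - 1) * z ≤ x ^ q + z ^ q := by
    intro z hz
    have hmul : ∀ w : ℝ, 0 ≤ w → w ^ (q - 1) * w = w ^ q := fun w hw => by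
      rw [← Real.rpow_add_one' hw (by linarith), sub_add_cancel]
    rcases le_total z x with h | h
    · calc x ^ (q - 1) * z ≤ x ^ (q - 1) * x := by gcongr
        _ = x ^ q := hmul x hx
        _ ≤ _ := le_add_of_nonneg_right (by positivity)
    · calc x ^ (q - 1) * z ≤ z ^ (q - 1) * z := by
            gcongr
        _ = z ^ q := hmul z hz
        _ ≤ _ := le_add_of_nonneg_left (by positivity)
  have := mul_le_mul_of_nonneg_left (key _ hz) hs.le
  rw [Real.mul_rpow (by positivity) hy, Real.inv_rpow hs.le] at this
  calc x ^ (q - 1) * y = s * (x ^ (q - 1) * (s⁻¹ * y)) := by field_simp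
    _ ≤ _ := this

theorem integrable_rpow_mul_norm (hp : 1 < p) (hp' : p ≠ ⊤) (u v : Lp F p μ) :
    Integrable (fun t => ‖u t‖ ^ (p.toReal - 1) * ‖v t‖) μ := by
  have hp0 : p ≠ 0 := (one_pos.trans hp).ne'
  have hq : 1 < p.toReal := by
    rwa [← ENNReal.toReal_one, ENNReal.toReal_lt_toReal ENNReal.one_ne_top hp']
  refine Integrable.mono' ((integrable_norm_rpow_Lp hp0 hp' u).add
    (integrable_norm_rpow_Lp hp0 hp' v)) ?_ (Eventually.of_forall fun t => ?_)
  · have h1 : Continuous fun x : ℝ => x ^ (p.toReal - 1) :=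
      Real.continuous_rpow_const (by linarith)
    exact (h1.comp_aestronglyMeasurable (Lp.aestronglyMeasurable u).norm).mul
      (Lp.aestronglyMeasurable v).norm
  · rw [Real.norm_of_nonneg (by positivity)]
    simpa using rpow_mul_le_of_pos hq one_pos (norm_nonneg (u t)) (norm_nonneg (v t))

/-- A substitute for Hölder's inequality: with s = ‖v‖ in the preceding inequality, the normalised
integral of ‖v‖ ^ q equals 1. -/
theorem integral_rpow_mul_norm_le [Fact (1 ≤ p)] (hp : 1 < p) (hp' : p ≠ ⊤) (u v : Lp F p μ) :
    ∫ t, ‖u t‖ ^ (p.toReal - 1) * ‖v t‖ ∂μ ≤ (‖u‖ ^ p.toReal + 1) * ‖v‖ := by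
  have hp0 : p ≠ 0 := (one_pos.trans hp).ne'
  have hq : 1 < p.toReal := by
    rwa [← ENNReal.toReal_one, ENNReal.toReal_lt_toReal ENNReal.one_ne_top hp']
  rcases eq_or_ne v 0 with rfl | hv
  · have : ∫ t, ‖u t‖ ^ (p.toReal - 1) * ‖(0 : Lp F p μ) t‖ ∂μ = ∫ t, (0 : ℝ) ∂μ := by
      refine integral_congr_ae ?_
      filter_upwards [Lp.coeFn_zero F p μ] with t ht
      rw [ht, Pi.zero_apply, norm_zero, mul_zero]
    rw [this]; simp
  have hs : 0 < ‖v‖ := norm_pos_iff.2 hv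
  have hi := (integrable_norm_rpow_Lp hp0 hp' v).const_mul (‖v‖ ^ p.toReal)⁻¹
  refine (integral_mono (integrable_rpow_mul_norm hp hp' u v)
    (((integrable_norm_rpow_Lp hp0 hp' u).add hi).const_mul ‖v‖) fun t =>
    rpow_mul_le_of_pos hq hs (norm_nonneg (u t)) (norm_nonneg (v t))).trans (le_of_eq ?_)
  simp only [Pi.add_apply]
  rw [integral_const_mul, integral_add (integrable_norm_rpow_Lp hp0 hp' u) hi, integral_const_mul,
    integral_norm_rpow_Lp hp0 hp', integral_norm_rpow_Lp hp0 hp', inv_mul_cancel₀ (by positivity),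
    mul_comm]

variable [InnerProductSpace ℝ F] [FiniteDimensional ℝ F]

theorem integrable_normPowDeriv (hp : 1 < p) (hp' : p ≠ ⊤) (u v : Lp F p μ) :
    Integrable (fun t => normPowDeriv p.toReal (u t) (v t)) μ := by
  have hq : 1 < p.toReal := by
    rwa [← ENNReal.toReal_one, ENNReal.toReal_lt_toReal ENNReal.one_ne_top hp']
  refine Integrable.mono' ((integrable_rpow_mul_norm hp hp' u v).const_mul p.toReal) ?_
    (Eventually.of_forall fun t => abs_normPowDeriv_apply_le hq _ _)
  exact (ContinuousLinearMap.id ℝ (F →L[ℝ] ℝ)).aestronglyMeasurable_comp₂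
    ((continuous_normPowDeriv hq).comp_aestronglyMeasurable (Lp.aestronglyMeasurable u))
    (Lp.aestronglyMeasurable v)

/-- The `p`-energy is differentiable on `L^p`, for `1 < p < ∞`. -/
theorem exists_hasFDerivAt_integral_norm_rpow [Fact (1 ≤ p)] (hp : 1 < p) (hp' : p ≠ ⊤)
    (u : Lp F p μ) :
    ∃ D : Lp F p μ →L[ℝ] ℝ,
      HasFDerivAt (fun u : Lp F p μ => ∫ t, ‖u t‖ ^ p.toReal ∂μ) D u ∧
      ∀ v : Lp F p μ, D v = ∫ t, normPowDeriv p.toReal (u t) (v t) ∂μ := by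
  have hp0 : p ≠ 0 := (one_pos.trans hp).ne'
  have hq : 1 < p.toReal := by
    rwa [← ENNReal.toReal_one, ENNReal.toReal_lt_toReal ENNReal.one_ne_top hp']
  set q := p.toReal with hqdef
  have hi : ∀ v : Lp F p μ, Integrable (fun t => normPowDeriv q (u t) (v t)) μ :=
    integrable_normPowDeriv hp hp' u
  let D₀ : Lp F p μ →ₗ[ℝ] ℝ :=
    { toFun := fun v => ∫ t, normPowDeriv q (u t) (v t) ∂μ
      map_add' := fun v v' => by
        rw [← integral_add (hi v) (hi v')]
        refine integral_congr_ae ?_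
        filter_upwards [Lp.coeFn_add v v'] with t ht
        rw [ht, Pi.add_apply, map_add]
      map_smul' := fun r v => by
        rw [RingHom.id_apply, smul_eq_mul, ← integral_const_mul]
        refine integral_congr_ae ?_
        filter_upwards [Lp.coeFn_smul r v] with t ht
        rw [ht, Pi.smul_apply, map_smul, smul_eq_mul] }
  let D := D₀.mkContinuous (q * (‖u‖ ^ q + 1)) (fun v => by
    refine (norm_integral_le_integral_norm _).trans ?_
    refine (integral_mono (hi v).norm ((integrable_rpow_mul_norm hp hp' u v).const_mul q)
      fun t => abs_normPowDeriv_apply_le hq _ _).trans ?_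
    rw [integral_const_mul, mul_assoc]
    exact mul_le_mul_of_nonneg_left (integral_rpow_mul_norm_le hp hp' u v) (by linarith))
  have hD : ∀ v, D v = ∫ t, normPowDeriv q (u t) (v t) ∂μ := fun v => rfl
  refine ⟨D, ?_, hD⟩
  rw [hasFDerivAt_iff_isLittleO_nhds_zero, Asymptotics.isLittleO_iff]
  intro c hc
  have hM : 0 < ‖u‖ ^ q + 1 := by positivity
  -- This ε makes the term linear in b contribute at most c/2 · ‖v‖ after integration; the other
  -- term, C‖v‖ ^ q, is o(‖v‖) because q > 1.
  obtain ⟨C, hC0, hC⟩ := exists_norm_rpow_expansion (F := F) hq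
    (show 0 < c / 2 / (‖u‖ ^ q + 1) by positivity)
  have hlim : Tendsto (fun v : Lp F p μ => C * ‖v‖ ^ (q - 1)) (𝓝 0) (𝓝 0) := by
    have h1 : Continuous fun x : ℝ => x ^ (q - 1) := Real.continuous_rpow_const (by linarith)
    have h2 := ((h1.comp (continuous_norm (E := Lp F p μ))).const_mul C).tendsto 0
    simpa [Real.zero_rpow (by linarith : q - 1 ≠ 0)] using h2
  filter_upwards [hlim.eventually_lt_const (by positivity : 0 < c / 2)] with v hv
  have iu : Integrable (fun t => ‖u t‖ ^ q) μ := integrable_norm_rpow_Lp hp0 hp' u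
  have iuv : Integrable (fun t => ‖(u + v : Lp F p μ) t‖ ^ q) μ := integrable_norm_rpow_Lp hp0 hp' (u + v)
  have iv : Integrable (fun t => ‖v t‖ ^ q) μ := integrable_norm_rpow_Lp hp0 hp' v
  have iuu : Integrable (fun t => ‖(u + v : Lp F p μ) t‖ ^ q - ‖u t‖ ^ q) μ := iuv.sub iu
  rw [hD v, ← integral_sub iuv iu, ← integral_sub iuu (hi v)]
  refine (norm_integral_le_integral_norm _).trans ?_
  have hmono := integral_mono_ae (iuu.sub (hi v)).norm
    (((integrable_rpow_mul_norm hp hp' u v).const_mul (c / 2 / (‖u‖ ^ q + 1))).add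
      (iv.const_mul C)) (by
      filter_upwards [Lp.coeFn_add u v] with t ht
      simp only [Pi.sub_apply, Pi.add_apply]
      rw [ht, Pi.add_apply]
      exact hC (u t) (v t))
  refine hmono.trans ?_
  simp only [Pi.add_apply]
  rw [integral_add ((integrable_rpow_mul_norm hp hp' u v).const_mul _) (iv.const_mul C),
    integral_const_mul, integral_const_mul, integral_norm_rpow_Lp hp0 hp']
  have e1 : c / 2 / (‖u‖ ^ q + 1) * ∫ t, ‖u t‖ ^ (q - 1) * ‖v t‖ ∂μ ≤ c / 2 * ‖v‖ := by
    refine (mul_le_mul_of_nonneg_left (integral_rpow_mul_norm_le hp hp' u v)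
      (by positivity)).trans (le_of_eq ?_)
    rw [← hqdef]; field_simp
  have e2 : C * ‖v‖ ^ q ≤ c / 2 * ‖v‖ := by
    have : ‖v‖ ^ q = ‖v‖ ^ (q - 1) * ‖v‖ := by
      rw [← Real.rpow_add_one' (norm_nonneg _) (by linarith), sub_add_cancel]
    rw [this, ← mul_assoc]
    exact mul_le_mul_of_nonneg_right hv.le (norm_nonneg _)
  linarith

end Energy

end SubRiem

/-! ### Normal extremals and the Hamiltonian system. -/

namespace SubRiem

open Filter Topology
open scoped BoundedContinuousFunction

set_option linter.unusedSectionVars false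

theorem hasDerivWithinAt_of_eq_integral {V : Type*} [NormedAddCommGroup V] [NormedSpace ℝ V]
    [CompleteSpace V] {f g : ℝ → V} {a b : ℝ} (hab : a ≤ b) (hg : ContinuousOn g (Icc a b))
    (h : ∀ t ∈ Icc a b, f t = f a + ∫ r in a..t, g r) {t : ℝ} (ht : t ∈ Icc a b) :
    HasDerivWithinAt f (g t) (Icc a b) t := by
  obtain ⟨G, hG, -⟩ := exists_constant_extension hab hg
  have h1 : HasDerivAt (fun s => f a + ∫ r in a..s, G r) (G t) t :=
    (G.continuous.integral_hasStrictDerivAt a t).hasDerivAt.const_add (f a)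
  have h2 : ∀ s ∈ Icc a b, f s = f a + ∫ r in a..s, G r := fun s hs => by
    rw [h s hs]
    congr 1
    refine intervalIntegral.integral_congr fun r hr => ?_
    rw [uIcc_of_le hs.1] at hr
    exact (hG ⟨hr.1, hr.2.trans hs.2⟩).symm
  rw [← hG ht]
  exact h1.hasDerivWithinAt.congr h2 (h2 t ht)

/-- Uniqueness for autonomous differential equations with prescribed value at an interior time. -/
theorem eqOn_of_hasDerivWithinAt {V : Type*} [NormedAddCommGroup V] [NormedSpace ℝ V]
    {v : V → V} {s : Set V} {K : ℝ≥0} (hv : LipschitzOnWith K v s) {f g : ℝ → V} {c d t₀ : ℝ}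
    (ht₀ : t₀ ∈ Icc c d) (hf : ∀ t ∈ Icc c d, HasDerivWithinAt f (v (f t)) (Icc c d) t)
    (hfs : MapsTo f (Icc c d) s)
    (hg : ∀ t ∈ Icc c d, HasDerivWithinAt g (v (g t)) (Icc c d) t)
    (hgs : MapsTo g (Icc c d) s) (h : f t₀ = g t₀) : EqOn f g (Icc c d) := by
  have cf : ContinuousOn f (Icc c d) := fun t ht => (hf t ht).continuousWithinAt
  have cg : ContinuousOn g (Icc c d) := fun t ht => (hg t ht).continuousWithinAt
  have hR : EqOn f g (Icc t₀ d) := by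
    have hsub : Icc t₀ d ⊆ Icc c d := Icc_subset_Icc_left ht₀.1
    have hmem : ∀ t ∈ Ico t₀ d, t ∈ Icc c d := fun t ht => hsub (Ico_subset_Icc_self ht)
    have hnhds : ∀ t ∈ Ico t₀ d, Icc c d ∈ 𝓝[Ici t] t := fun t ht =>
      mem_of_superset (Icc_mem_nhdsGE ht.2) (Icc_subset_Icc_left (hmem t ht).1)
    exact ODE_solution_unique_of_mem_Icc_right (v := fun _ => v) (s := fun _ => s)
      (fun _ _ => hv) (cf.mono hsub)
      (fun t ht => (hf t (hmem t ht)).mono_of_mem_nhdsWithin (hnhds t ht))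
      (fun t ht => hfs (hmem t ht)) (cg.mono hsub)
      (fun t ht => (hg t (hmem t ht)).mono_of_mem_nhdsWithin (hnhds t ht))
      (fun t ht => hgs (hmem t ht)) h
  have hL : EqOn f g (Icc c t₀) := by
    have hsub : Icc c t₀ ⊆ Icc c d := Icc_subset_Icc_right ht₀.2
    have hmem : ∀ t ∈ Ioc c t₀, t ∈ Icc c d := fun t ht => hsub (Ioc_subset_Icc_self ht)
    have hnhds : ∀ t ∈ Ioc c t₀, Icc c d ∈ 𝓝[Iic t] t := fun t ht =>
      mem_of_superset (Icc_mem_nhdsLE ht.1) (Icc_subset_Icc_right (hmem t ht).2)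
    exact ODE_solution_unique_of_mem_Icc_left (v := fun _ => v) (s := fun _ => s)
      (fun _ _ => hv) (cf.mono hsub)
      (fun t ht => (hf t (hmem t ht)).mono_of_mem_nhdsWithin (hnhds t ht))
      (fun t ht => hfs (hmem t ht)) (cg.mono hsub)
      (fun t ht => (hg t (hmem t ht)).mono_of_mem_nhdsWithin (hnhds t ht))
      (fun t ht => hgs (hmem t ht)) h
  intro t ht
  rcases le_total t t₀ with h' | h'
  · exact hL ⟨ht.1, h'⟩
  · exact hR ⟨h', ht.2⟩

section Hamiltonian

variable {E A : Type*} [NormedAddCommGroup E] [InnerProductSpace ℝ E] [FiniteDimensional ℝ E]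
  [NormedAddCommGroup A] [InnerProductSpace ℝ A] [FiniteDimensional ℝ A]
  {Y : E → A →L[ℝ] E} {L : ℝ}

/-- The adjoint, as a real continuous linear map. -/
noncomputable def adjointL (E₁ E₂ : Type*) [NormedAddCommGroup E₁] [InnerProductSpace ℝ E₁]
    [FiniteDimensional ℝ E₁] [NormedAddCommGroup E₂] [InnerProductSpace ℝ E₂]
    [FiniteDimensional ℝ E₂] : (E₁ →L[ℝ] E₂) →L[ℝ] (E₂ →L[ℝ] E₁) :=
  LinearMap.mkContinuous
    { toFun := fun B => ContinuousLinearMap.adjoint B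
      map_add' := fun B C => map_add _ B C
      map_smul' := fun r B => by simp } 1 (fun B => by
        rw [one_mul]; exact (LinearIsometryEquiv.norm_map _ B).le)

theorem adjointL_apply {E₁ E₂ : Type*} [NormedAddCommGroup E₁] [InnerProductSpace ℝ E₁]
    [FiniteDimensional ℝ E₁] [NormedAddCommGroup E₂] [InnerProductSpace ℝ E₂]
    [FiniteDimensional ℝ E₂] (B : E₁ →L[ℝ] E₂) :
    adjointL E₁ E₂ B = ContinuousLinearMap.adjoint B := rfl

/-- The momenta `⟨η, Y_i(x)⟩` of a covector `η` at `x`. -/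
noncomputable def momentum (Y : E → A →L[ℝ] E) (x η : E) : A :=
  ContinuousLinearMap.adjoint (Y x) η

theorem inner_momentum (Y : E → A →L[ℝ] E) (x η : E) (a : A) :
    inner ℝ (momentum Y x η) a = inner ℝ η (Y x a) :=
  ContinuousLinearMap.adjoint_inner_left _ _ _

/-- The Hamiltonian vector field of `½ ∑ ⟨η, Y_i(x)⟩²`. -/
noncomputable def hamiltonianField (Y : E → A →L[ℝ] E) (z : E × E) : E × E :=
  (Y z.1 (momentum Y z.1 z.2),
    -ContinuousLinearMap.adjoint ((fderiv ℝ Y z.1).flip (momentum Y z.1 z.2)) z.2)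

theorem BoundedField.contDiff_momentum (hY : BoundedField Y L) :
    ContDiff ℝ 1 fun z : E × E => momentum Y z.1 z.2 := by
  have h : ContDiff ℝ 1 fun z : E × E => adjointL A E (Y z.1) z.2 :=
    ((adjointL A E).contDiff.comp ((hY.contDiff.of_le (by norm_num)).comp contDiff_fst)).clm_apply
      contDiff_snd
  exact h

/-- One derivative of the C² field Y is lost; C¹ is what Picard-Lindelöf and local Lipschitz
uniqueness require. -/
theorem BoundedField.contDiff_hamiltonianField (hY : BoundedField Y L) :
    ContDiff ℝ 1 (hamiltonianField Y) := by
  have h1 : ContDiff ℝ 1 fun z : E × E => Y z.1 :=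
    (hY.contDiff.of_le (by norm_num)).comp contDiff_fst
  have g1 : ContDiff ℝ 1 fun z : E × E => fderiv ℝ Y z.1 :=
    (hY.contDiff.fderiv_right (m := 1) (by norm_num)).comp contDiff_fst
  have g2 : ContDiff ℝ 1 fun B : E →L[ℝ] A →L[ℝ] E => B.flip :=
    IsBoundedLinearMap.contDiff
      { map_add := fun _ _ => rfl
        map_smul := fun _ _ => rfl
        bound := ⟨1, one_pos, fun B => by
          rw [one_mul]; exact (ContinuousLinearMap.opNorm_flip B).le⟩ }
  have h2 : ContDiff ℝ 1 fun z : E × E => (fderiv ℝ Y z.1).flip := g2.comp g1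
  have h3 : ContDiff ℝ 1 fun z : E × E =>
      adjointL E E ((fderiv ℝ Y z.1).flip (momentum Y z.1 z.2)) z.2 :=
    ((adjointL E E).contDiff.comp (h2.clm_apply hY.contDiff_momentum)).clm_apply contDiff_snd
  exact (h1.clm_apply hY.contDiff_momentum).prodMk h3.neg

/-- Along a normal extremal, the norm of the momenta is constant. -/
theorem norm_momentum_const (hY : BoundedField Y L) {u : ℝ → A} {f η : ℝ → E} {a b : ℝ}
    (hab : a ≤ b) (hu : IntervalIntegrable u volume a b) (hf : IsSol Y u f a b)
    (hη : IsAdjoint Y u f η a b) {m : ℝ → ℝ}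
    (hm : ∀ᵐ t ∂volume.restrict (Icc a b), m t • u t = momentum Y (f t) (η t)) :
    ∃ κ, ∀ t ∈ Icc a b, ‖momentum Y (f t) (η t)‖ = κ := by
  have if' := hf.intervalIntegrable hY hab hu
  have iη := hη.intervalIntegrable hY hab hu hf.continuousOn
  have cf := absolutelyContinuousOnInterval_of_eq_integral hab if' hf.eq
  have cη := absolutelyContinuousOnInterval_of_eq_integral hab iη hη.eq
  obtain ⟨D, hD⟩ := cη.exists_bound
  have hD0 : 0 ≤ D := (norm_nonneg _).trans (hD a left_mem_uIcc)
  have hadj : ∀ B : A →L[ℝ] E, ‖ContinuousLinearMap.adjoint B‖ = ‖B‖ := fun B =>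
    LinearIsometryEquiv.norm_map _ B
  have hbd : ∀ t ∈ uIcc a b, ‖momentum Y (f t) (η t)‖ ≤ L * D := fun t ht => by
    refine (ContinuousLinearMap.le_opNorm _ _).trans ?_
    rw [hadj]
    exact mul_le_mul (hY.norm_le _) (hD t ht) (norm_nonneg _) hY.nonneg
  have hac : AbsolutelyContinuousOnInterval (fun t => momentum Y (f t) (η t)) a b := by
    refine absolutelyContinuousOnInterval_of_dist_le (C := L * D) (D := L) cf cη
      fun s hs t ht => ?_
    have e : momentum Y (f s) (η s) - momentum Y (f t) (η t) =
        ContinuousLinearMap.adjoint (Y (f s) - Y (f t)) (η s) +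
          ContinuousLinearMap.adjoint (Y (f t)) (η s - η t) := by
      simp only [momentum, map_sub, _root_.sub_apply]; abel
    rw [dist_eq_norm, e, dist_eq_norm, dist_eq_norm]
    refine (norm_add_le _ _).trans (add_le_add ?_ ?_)
    · refine (ContinuousLinearMap.le_opNorm _ _).trans ?_
      rw [hadj]
      calc ‖Y (f s) - Y (f t)‖ * ‖η s‖ ≤ (L * ‖f s - f t‖) * D :=
            mul_le_mul (hY.lip _ _) (hD s hs) (norm_nonneg _)
              (mul_nonneg hY.nonneg (norm_nonneg _))
        _ = _ := by ring
    · refine (ContinuousLinearMap.le_opNorm _ _).trans ?_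
      rw [hadj]
      exact mul_le_mul_of_nonneg_right (hY.norm_le _) (norm_nonneg _)
  have hac2 : AbsolutelyContinuousOnInterval (fun t => ‖momentum Y (f t) (η t)‖ ^ 2) a b := by
    refine absolutelyContinuousOnInterval_of_dist_le (C := 2 * (L * D)) (D := 0) hac hac
      fun s hs t ht => ?_
    have h1 := hbd s hs
    have h2 := hbd t ht
    have h3 := abs_norm_sub_norm_le (momentum Y (f s) (η s)) (momentum Y (f t) (η t))
    rw [Real.dist_eq, dist_eq_norm, zero_mul, add_zero, sq_sub_sq, abs_mul,
      abs_of_nonneg (by positivity)]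
    exact mul_le_mul (by linarith) h3 (abs_nonneg _) (by have := hY.nonneg; positivity)
  have df := ae_hasDerivAt_of_eq_integral hab if' hf.eq
  have dη := ae_hasDerivAt_of_eq_integral hab iη hη.eq
  rw [ae_restrict_iff' measurableSet_Icc] at df dη hm
  obtain ⟨C, hC⟩ := hac2.const_of_ae_hasDerivAt_zero (by
    filter_upwards [df, dη, hm] with t h1 h2 h3 ht
    rw [uIcc_of_le hab] at ht
    have k1 := h1 ht
    have k2 := h2 ht
    have hYf : HasDerivAt (fun s => Y (f s)) (fderiv ℝ Y (f t) (Y (f t) (u t))) t :=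
      ((hY.contDiff.differentiable two_ne_zero) (f t)).hasFDerivAt.comp_hasDerivAt t k1
    have hmom : HasDerivAt (fun s => momentum Y (f s) (η s))
        (adjointL A E (fderiv ℝ Y (f t) (Y (f t) (u t))) (η t) + adjointL A E (Y (f t))
          (-ContinuousLinearMap.adjoint ((fderiv ℝ Y (f t)).flip (u t)) (η t))) t :=
      ((adjointL A E).hasFDerivAt.comp_hasDerivAt t hYf).clm_apply k2
    have key := hmom.norm_sq
    -- Conservation of the Hamiltonian. With h the momentum, the derivative of ‖h‖² is twice ⟨η,
    -- DY(Yu)h - DY(Yh)u⟩, which is antisymmetric in h and u and so vanishes for h = m u.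
    have hz : (2 : ℝ) * inner ℝ (momentum Y (f t) (η t))
        (adjointL A E (fderiv ℝ Y (f t) (Y (f t) (u t))) (η t) + adjointL A E (Y (f t))
          (-ContinuousLinearMap.adjoint ((fderiv ℝ Y (f t)).flip (u t)) (η t))) = 0 := by
      rw [← h3 ht, inner_add_right, adjointL_apply, adjointL_apply,
        ContinuousLinearMap.adjoint_inner_right, ContinuousLinearMap.adjoint_inner_right,
        inner_neg_right, ContinuousLinearMap.adjoint_inner_right, ContinuousLinearMap.flip_apply,
        map_smul, map_smul, map_smul, _root_.smul_apply]
      ring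
    rwa [hz] at key)
  refine ⟨√C, fun t ht => ?_⟩
  rw [← hC t (by rwa [uIcc_of_le hab]), Real.sqrt_sq (norm_nonneg _)]

theorem IsAdjoint.smul {u : ℝ → A} {f η : ℝ → E} {a b : ℝ} (hη : IsAdjoint Y u f η a b) (r : ℝ) :
    IsAdjoint Y u f (fun t => r • η t) a b := by
  refine ⟨hη.continuousOn.const_smul r, fun t ht => ?_⟩
  simp only [map_smul]
  simp_rw [← smul_neg]
  rw [intervalIntegral.integral_smul, ← smul_add, ← hη.eq t ht]

/-- A critical control has constant norm, and its trajectory lifts to a solution of the Hamiltonian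
system. -/
theorem exists_hamiltonian_lift (hY : BoundedField Y L) {u : ℝ → A} {f η : ℝ → E} {a b q : ℝ}
    (hab : a ≤ b) (hq : 1 < q) (hu : IntervalIntegrable u volume a b) (hf : IsSol Y u f a b)
    (hη : IsAdjoint Y u f η a b)
    (hm : ∀ᵐ t ∂volume.restrict (Icc a b),
      (q * ‖u t‖ ^ (q - 2)) • u t = momentum Y (f t) (η t)) :
    ∃ c : ℝ, 0 ≤ c ∧ (∀ᵐ t ∂volume.restrict (Icc a b), ‖u t‖ = c) ∧
      (0 < c → ∃ z : ℝ → E × E, (∀ t, (z t).1 = f t) ∧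
        (∀ᵐ t ∂volume.restrict (Icc a b), u t = momentum Y (z t).1 (z t).2) ∧
        ∀ t ∈ Icc a b, ‖momentum Y (z t).1 (z t).2‖ = c ∧
          HasDerivWithinAt z (hamiltonianField Y (z t)) (Icc a b) t) := by
  obtain ⟨κ, hκ⟩ := norm_momentum_const hY hab hu hf hη hm
  have hκ0 : 0 ≤ κ := (norm_nonneg _).trans_eq (hκ a ⟨le_rfl, hab⟩)
  have hq0 : 0 < q := one_pos.trans hq
  -- The nonnegative solution of q c^(q-1) = κ, the equation obtained by taking norms in `hm`.
  set c := (κ / q) ^ (q - 1)⁻¹ with hc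
  have hc0 : 0 ≤ c := by positivity
  have hnorm : ∀ᵐ t ∂volume.restrict (Icc a b), ‖u t‖ = c := by
    filter_upwards [hm, ae_restrict_mem measurableSet_Icc] with t h1 ht
    have h2 := congrArg norm h1
    rw [hκ t ht, norm_smul, Real.norm_of_nonneg (by positivity), mul_assoc] at h2
    have h3 : ‖u t‖ ^ (q - 2) * ‖u t‖ = ‖u t‖ ^ (q - 1) := by
      rw [← Real.rpow_add_one' (norm_nonneg _) (by linarith)]
      congr 1; ring
    rw [h3] at h2
    rw [hc, ← h2, mul_div_cancel_left₀ _ hq0.ne', ← Real.rpow_mul (norm_nonneg _),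
      mul_inv_cancel₀ (by linarith), Real.rpow_one]
  refine ⟨c, hc0, hnorm, fun hcpos => ?_⟩
  -- Since ‖u‖ = c almost everywhere, the multiplier q‖u‖^(q-2) is constant; its inverse rescales
  -- the covector so that u equals the momentum.
  set r := (q * c ^ (q - 2))⁻¹ with hr
  have hrpos : 0 < q * c ^ (q - 2) := by positivity
  have hη' := hη.smul r
  have hmomr : ∀ t, momentum Y (f t) (r • η t) = r • momentum Y (f t) (η t) := fun t =>
    map_smul _ _ _
  have hu' : ∀ᵐ t ∂volume.restrict (Icc a b), u t = momentum Y (f t) (r • η t) := by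
    filter_upwards [hm, hnorm] with t h1 h2
    rw [hmomr, ← h1, h2, hr, inv_smul_smul₀ hrpos.ne']
  set z : ℝ → E × E := fun t => (f t, r • η t) with hz
  have hzc : ContinuousOn z (Icc a b) := hf.continuousOn.prodMk hη'.continuousOn
  have hHc : ContinuousOn (fun t => hamiltonianField Y (z t)) (Icc a b) :=
    hY.contDiff_hamiltonianField.continuous.comp_continuousOn hzc
  -- Under the integral the merely integrable u may be replaced by the continuous momentum. The
  -- integrands become continuous, which upgrades almost everywhere derivatives to derivatives
  -- everywhere.
  have hcongr : ∀ (t : ℝ), t ∈ Icc a b → ∀ G : A → ℝ → E,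
      ∫ s in a..t, G (u s) s = ∫ s in a..t, G (momentum Y (f s) (r • η s)) s := by
    intro t ht G
    refine intervalIntegral.integral_congr_ae ?_
    rw [ae_restrict_iff' measurableSet_Icc] at hu'
    filter_upwards [hu'] with s hs hst
    rw [uIoc_of_le ht.1] at hst
    rw [← hs ⟨hst.1.le, hst.2.trans ht.2⟩]
  refine ⟨z, fun t => rfl, hu', fun t ht => ⟨?_, ?_⟩⟩
  · change ‖momentum Y (f t) (r • η t)‖ = c
    rw [hmomr, norm_smul, hκ t ht, hr, norm_inv, Real.norm_of_nonneg hrpos.le]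
    have e1 : κ = q * c ^ (q - 1) := by
      rw [hc, ← Real.rpow_mul (by positivity), inv_mul_cancel₀ (by linarith), Real.rpow_one]
      field_simp
    have e2 : c ^ (q - 1) = c ^ (q - 2) * c := by
      rw [← Real.rpow_add_one hcpos.ne']; congr 1; ring
    rw [e1, e2]
    field_simp
  · refine HasDerivWithinAt.prodMk ?_ ?_
    · exact hasDerivWithinAt_of_eq_integral (g := fun t => (hamiltonianField Y (z t)).1) hab
        hHc.fst (fun s hs => (hf.eq s hs).trans (congrArg (f a + ·)
          (hcongr s hs fun w s => Y (f s) w))) ht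
    · exact hasDerivWithinAt_of_eq_integral (g := fun t => (hamiltonianField Y (z t)).2) hab
        hHc.snd (fun s hs => (hη'.eq s hs).trans (congrArg (r • η a + ·)
          (hcongr s hs fun w s => -ContinuousLinearMap.adjoint
            ((fderiv ℝ Y (f s)).flip w) (r • η s)))) ht

/-- A solution of the Hamiltonian system on `[a,b]` extends to a neighbourhood of any time of
`[a,b]`. -/
theorem exists_hamiltonian_extension (hY : BoundedField Y L) {z : ℝ → E × E} {a b t₀ : ℝ}
    (ht₀ : t₀ ∈ Icc a b)
    (hz : ∀ t ∈ Icc a b, HasDerivWithinAt z (hamiltonianField Y (z t)) (Icc a b) t) :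
    ∃ (ζ : ℝ → E × E) (ε : ℝ), 0 < ε ∧
      (∀ t ∈ Ioo (t₀ - ε) (t₀ + ε), HasDerivAt ζ (hamiltonianField Y (ζ t)) t) ∧
      ∀ t ∈ Icc a b, |t - t₀| < ε → ζ t = z t := by
  have hH := hY.contDiff_hamiltonianField.contDiffAt (x := z t₀)
  obtain ⟨ζ, h0, ε, hε, hζ⟩ :=
    hH.exists_forall_mem_closedBall_exists_eq_forall_mem_Ioo_hasDerivAt₀ t₀
  -- The Picard-Lindelöf solution ζ through z t₀ agrees with z as long as both stay in a set where
  -- the field is Lipschitz.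
  obtain ⟨K, s, hs, hK⟩ := hH.exists_lipschitzOnWith
  have c1 : ∀ᶠ t in 𝓝 t₀, ζ t ∈ s :=
    (hζ t₀ ⟨by linarith, by linarith⟩).continuousAt.eventually_mem (by rwa [h0])
  have c2 : ∀ᶠ t in 𝓝[Icc a b] t₀, z t ∈ s := (hz t₀ ht₀).continuousWithinAt.eventually_mem hs
  rw [eventually_nhdsWithin_iff] at c2
  obtain ⟨ε', hε', hs'⟩ := Metric.eventually_nhds_iff.1 (c1.and c2)
  set ρ := min ε ε' / 2 with hρ
  have hm : 0 < min ε ε' := lt_min hε hε'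
  have hρ0 : 0 < ρ := by positivity
  have hρε : ρ < ε := by have := min_le_left ε ε'; linarith
  have hρε' : ρ < ε' := by have := min_le_right ε ε'; linarith
  refine ⟨ζ, ρ, hρ0, fun t ht => hζ t ⟨by linarith [ht.1], by linarith [ht.2]⟩, ?_⟩
  set c := max a (t₀ - ρ) with hc
  set d := min b (t₀ + ρ) with hd
  have hcd : Icc c d ⊆ Icc a b := Icc_subset_Icc (le_max_left _ _) (min_le_left _ _)
  have hclose : ∀ t ∈ Icc c d, |t - t₀| ≤ ρ := fun t ht => abs_le.2
    ⟨by linarith [(le_max_right a (t₀ - ρ)).trans ht.1],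
      by linarith [ht.2.trans (min_le_right b (t₀ + ρ))]⟩
  have hball : ∀ t ∈ Icc c d, dist t t₀ < ε' := fun t ht => by
    rw [Real.dist_eq]; exact (hclose t ht).trans_lt hρε'
  have key : EqOn ζ z (Icc c d) := by
    refine eqOn_of_hasDerivWithinAt hK (t₀ := t₀)
      ⟨max_le ht₀.1 (by linarith), le_min ht₀.2 (by linarith)⟩ (fun t ht => ?_)
      (fun t ht => (hs' (hball t ht)).1) (fun t ht => (hz t (hcd ht)).mono hcd)
      (fun t ht => (hs' (hball t ht)).2 (hcd ht)) h0
    have := abs_le.1 (hclose t ht)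
    exact (hζ t ⟨by linarith, by linarith⟩).hasDerivWithinAt
  intro t ht htρ
  have := abs_lt.1 htρ
  exact key ⟨max_le ht.1 (by linarith), le_min ht.2 (by linarith)⟩

end Hamiltonian

end SubRiem

/-! ### A potential along a curve, with prescribed transversal concavity. -/

namespace SubRiem

open Filter Topology

set_option linter.unusedSectionVars false

theorem exists_contDiffAt_inverse {φ : ℝ → ℝ} {t₀ κ : ℝ} (hφ : ContDiffAt ℝ 1 φ t₀)
    (hd : HasDerivAt φ κ t₀) (hκ : κ ≠ 0) :
    ∃ τ : ℝ → ℝ, ContDiffAt ℝ 1 τ (φ t₀) ∧ (∀ᶠ t in 𝓝 t₀, τ (φ t) = t) ∧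
      ∀ᶠ s in 𝓝 (φ t₀), φ (τ s) = s := by
  have hd' : HasFDerivAt φ ((ContinuousLinearEquiv.unitsEquivAut ℝ (Units.mk0 κ hκ) :
      ℝ ≃L[ℝ] ℝ) : ℝ →L[ℝ] ℝ) t₀ := by
    convert! hd.hasFDerivAt using 1
  exact ⟨hφ.localInverse hd' one_ne_zero, hφ.to_localInverse hd' one_ne_zero,
    (hφ.hasStrictFDerivAt' hd' one_ne_zero).eventually_left_inverse,
    (hφ.hasStrictFDerivAt' hd' one_ne_zero).eventually_right_inverse⟩

theorem contDiffAt_one_of_hasDerivAt {V : Type*} [NormedAddCommGroup V] [NormedSpace ℝ V]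
    {x x' : ℝ → V} {t₀ : ℝ} (hx : ∀ᶠ t in 𝓝 t₀, HasDerivAt x (x' t) t)
    (hx' : ∀ᶠ t in 𝓝 t₀, ContinuousAt x' t) : ContDiffAt ℝ 1 x t₀ := by
  refine contDiffAt_one_iff.2 ⟨fun t => (1 : ℝ →L[ℝ] ℝ).smulRight (x' t), _, hx.and hx',
    fun t ht => ?_, fun t ht => ht.1.hasFDerivAt⟩
  exact ((ContinuousLinearMap.smulRightL ℝ ℝ V 1).continuous.continuousAt.comp
    ht.2).continuousWithinAt

section

variable {E : Type*} [NormedAddCommGroup E] [InnerProductSpace ℝ E]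

/-- Along a curve `x` with momentum `y`, a function `S` with differential `y` along the curve and
with a prescribed concavity `K` transversally to it. -/
theorem exists_concave_potential {x y x' y' : ℝ → E} {t₀ κ : ℝ} (hκ : κ ≠ 0)
    (hx : ∀ᶠ t in 𝓝 t₀, HasDerivAt x (x' t) t) (hx' : ∀ᶠ t in 𝓝 t₀, ContinuousAt x' t)
    (hy : ∀ᶠ t in 𝓝 t₀, HasDerivAt y (y' t) t) (hy' : ∀ᶠ t in 𝓝 t₀, ContinuousAt y' t)
    (hxy : ∀ᶠ t in 𝓝 t₀, inner ℝ (y t) (x' t) = κ) :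
    ∃ C > 0, ∀ K : ℝ, 0 ≤ K → ∃ (S T : E → ℝ) (e : E → E), ContDiffAt ℝ 1 S (x t₀) ∧
      ContinuousAt T (x t₀) ∧ T (x t₀) = t₀ ∧ (∀ᶠ t in 𝓝 t₀, S (x t) = κ * (t - t₀)) ∧
      ∀ᶠ q in 𝓝 (x t₀), (∀ w, fderiv ℝ S q w = inner ℝ (y (T q) + e q) w) ∧
        ‖y (T q)‖ ≤ C ∧ ‖e q‖ ≤ C * ‖q - x (T q)‖ ∧
        inner ℝ (x' (T q)) (e q) =
          inner ℝ (y' (T q)) (q - x (T q)) - K / 2 * ‖q - x (T q)‖ ^ 2 := by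
  have cx := contDiffAt_one_of_hasDerivAt hx hx'
  have cy := contDiffAt_one_of_hasDerivAt hy hy'
  -- The derivative of φ at t₀ is κ ≠ 0. Its local inverse τ gives a time function T near the curve,
  -- constant on the hyperplanes orthogonal to y t₀.
  set φ : ℝ → ℝ := fun t => inner ℝ (y t₀) (x t) with hφ
  have cφ : ContDiffAt ℝ 1 φ t₀ := contDiffAt_const.inner ℝ cx
  have dφ : ∀ᶠ t in 𝓝 t₀, HasDerivAt φ (inner ℝ (y t₀) (x' t)) t := by
    filter_upwards [hx] with t h
    simpa using (hasDerivAt_const t (y t₀)).inner ℝ h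
  obtain ⟨τ, cτ, hτ1, hτ2⟩ := exists_contDiffAt_inverse cφ
    (by have := dφ.self_of_nhds; rwa [hxy.self_of_nhds] at this) hκ
  set s₀ := φ t₀ with hs₀
  have hτ0 : τ s₀ = t₀ := hτ1.self_of_nhds
  have cdτ : ContinuousAt (deriv τ) s₀ := by
    have h1 := cτ.fderiv_right (m := 0) (by norm_num)
    exact (ContinuousAt.clm_apply h1.continuousAt (continuousAt_const (y := (1 : ℝ))) :)
  have hτd : ∀ᶠ s in 𝓝 s₀, HasDerivAt τ (deriv τ s) s :=
    (cτ.eventually (by simp)).mono fun s h => (h.differentiableAt one_ne_zero).hasDerivAt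
  have htend : Tendsto τ (𝓝 s₀) (𝓝 t₀) := by
    have := cτ.continuousAt.tendsto; rwa [hτ0] at this
  have hτφ : ∀ᶠ s in 𝓝 s₀, deriv τ s * inner ℝ (y t₀) (x' (τ s)) = 1 := by
    filter_upwards [hτd, htend.eventually dφ, hτ2.eventually_nhds] with s h1 h2 h3
    have h4 := HasDerivAt.comp s h2 h1
    have h5 : HasDerivAt (φ ∘ τ) 1 s := (hasDerivAt_id s).congr_of_eventuallyEq h3
    rw [mul_comm]; exact h4.unique h5
  set C₀ := 1 + ‖x' t₀‖ + ‖y' t₀‖ + ‖y t₀‖ + |deriv τ s₀| with hC₀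
  have n1 := norm_nonneg (x' t₀)
  have n2 := norm_nonneg (y' t₀)
  have n3 := norm_nonneg (y t₀)
  have n4 := abs_nonneg (deriv τ s₀)
  have hC₀1 : 1 ≤ C₀ := by linarith
  -- C is fixed before K, as the later choice of K depends on C. Only the neighbourhood on which the
  -- bounds hold shrinks as K grows.
  refine ⟨C₀ ^ 2 * (2 * C₀ + 1) + 1 + C₀, by positivity, fun K hK => ?_⟩
  set P : E → ℝ := fun q => inner ℝ (y t₀) q with hP
  have cP : ContinuousAt P (x t₀) := continuousAt_const.inner continuousAt_id
  set T : E → ℝ := fun q => τ (P q) with hT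
  have hT0 : T (x t₀) = t₀ := hτ0
  have cT : ContDiffAt ℝ 1 T (x t₀) :=
    ContDiffAt.comp (x t₀) (show ContDiffAt ℝ 1 τ (P (x t₀)) from cτ)
      (contDiffAt_const.inner ℝ contDiffAt_id)
  have cxT : ContDiffAt ℝ 1 (fun q => x (T q)) (x t₀) :=
    ContDiffAt.comp (x t₀) (by rwa [hT0]) cT
  have cyT : ContDiffAt ℝ 1 (fun q => y (T q)) (x t₀) :=
    ContDiffAt.comp (x t₀) (by rwa [hT0]) cT
  set z : E → E := fun q => q - x (T q) with hz
  have cz : ContDiffAt ℝ 1 z (x t₀) := contDiffAt_id.sub cxT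
  have hz0 : z (x t₀) = 0 := by simp only [hz]; rw [hT0, sub_self]
  -- The first two terms give S the value κ(t - t₀) and the differential y on the curve. The factor
  -- T q - t₀ makes the last term contribute -K/2 ‖z‖² to the derivative in the direction x', while
  -- its remaining contributions carry the small factor K(T q - t₀).
  set S : E → ℝ := fun q => κ * (T q - t₀) + inner ℝ (y (T q)) (z q) -
    K / 2 * (T q - t₀) * ‖z q‖ ^ 2 with hS
  have cS : ContDiffAt ℝ 1 S (x t₀) :=
    ((contDiffAt_const.mul (cT.sub contDiffAt_const)).add (cyT.inner ℝ cz)).sub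
      ((contDiffAt_const.mul (cT.sub contDiffAt_const)).mul (cz.norm_sq ℝ))
  -- D is the coefficient of dT in dS - ⟨y, ·⟩; the terms κ and ⟨y, x'⟩ cancel in it. The other part
  -- of the remainder e is -K(T q - t₀) z.
  set D : E → ℝ := fun q => inner ℝ (y' (T q)) (z q) - K / 2 * ‖z q‖ ^ 2 +
    K * (T q - t₀) * inner ℝ (z q) (x' (T q)) with hD
  set e : E → E := fun q => (deriv τ (P q) * D q) • y t₀ - (K * (T q - t₀)) • z q with he
  have tT : Tendsto T (𝓝 (x t₀)) (𝓝 t₀) := by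
    have := cT.continuousAt.tendsto; rwa [hT0] at this
  refine ⟨S, T, e, cS, cT.continuousAt, hT0, ?_, ?_⟩
  · filter_upwards [hτ1] with t ht
    have h1 : T (x t) = t := ht
    simp [hS, hz, h1]
  have b1 : ∀ᶠ q in 𝓝 (x t₀), ‖x' (T q)‖ < C₀ :=
    (hx'.self_of_nhds.tendsto.comp tT).norm.eventually_lt_const (by linarith)
  have b2 : ∀ᶠ q in 𝓝 (x t₀), ‖y' (T q)‖ < C₀ :=
    (hy'.self_of_nhds.tendsto.comp tT).norm.eventually_lt_const (by linarith)
  have b3 : ∀ᶠ q in 𝓝 (x t₀), ‖y (T q)‖ < C₀ :=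
    (cy.continuousAt.tendsto.comp tT).norm.eventually_lt_const (by linarith)
  have b4 : ∀ᶠ q in 𝓝 (x t₀), |deriv τ (P q)| < C₀ :=
    (cdτ.tendsto.comp cP.tendsto).abs.eventually_lt_const (by linarith)
  have tz : Tendsto (fun q => ‖z q‖) (𝓝 (x t₀)) (𝓝 0) := by
    have := cz.continuousAt.norm.tendsto; rwa [hz0, norm_zero] at this
  have b5 : ∀ᶠ q in 𝓝 (x t₀), ‖z q‖ < 1 := tz.eventually_lt_const one_pos
  have b6 : ∀ᶠ q in 𝓝 (x t₀), K * ‖z q‖ < 1 := by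
    have : Tendsto (fun q => K * ‖z q‖) (𝓝 (x t₀)) (𝓝 0) := by simpa using tz.const_mul K
    exact this.eventually_lt_const one_pos
  have b7 : ∀ᶠ q in 𝓝 (x t₀), |K * (T q - t₀)| < 1 := by
    have : Tendsto (fun q => |K * (T q - t₀)|) (𝓝 (x t₀)) (𝓝 0) := by
      simpa using ((tT.sub_const t₀).const_mul K).abs
    exact this.eventually_lt_const one_pos
  filter_upwards [b1, b2, b3, b4, b5, b6, b7, tT.eventually hx, tT.eventually hy,
    tT.eventually hxy, cP.tendsto.eventually hτd, cP.tendsto.eventually hτφ,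
    cS.eventually (by simp)] with q b1 b2 b3 b4 b5 b6 b7 hxq hyq hxyq hτq hτφq hSq
  refine ⟨fun w => ?_, ?_, ?_, ?_⟩
  · have hline : HasDerivAt (fun s : ℝ => q + s • w) w 0 := by
      simpa using ((hasDerivAt_id (0 : ℝ)).smul_const w).const_add q
    have h0 : q + (0 : ℝ) • w = q := by simp
    have dP : HasDerivAt (fun s : ℝ => P (q + s • w)) (P w) 0 := by
      simpa using (hasDerivAt_const (0 : ℝ) (y t₀)).inner ℝ hline
    have dT : HasDerivAt (fun s : ℝ => T (q + s • w)) (deriv τ (P q) * P w) 0 :=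
      HasDerivAt.comp (0 : ℝ) (h₂ := τ) (h := fun s : ℝ => P (q + s • w))
        (by simpa only [h0] using hτq) dP
    have dx : HasDerivAt (fun s : ℝ => x (T (q + s • w))) ((deriv τ (P q) * P w) • x' (T q)) 0 :=
      HasDerivAt.scomp (0 : ℝ) (g₁ := x) (h := fun s : ℝ => T (q + s • w))
        (by simpa only [h0] using hxq) dT
    have dy : HasDerivAt (fun s : ℝ => y (T (q + s • w))) ((deriv τ (P q) * P w) • y' (T q)) 0 :=
      HasDerivAt.scomp (0 : ℝ) (g₁ := y) (h := fun s : ℝ => T (q + s • w))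
        (by simpa only [h0] using hyq) dT
    have dz : HasDerivAt (fun s : ℝ => z (q + s • w)) (w - (deriv τ (P q) * P w) • x' (T q)) 0 :=
      hline.sub dx
    have dS := (((dT.sub_const t₀).const_mul κ).add (dy.inner ℝ dz)).sub
      (((dT.sub_const t₀).const_mul (K / 2)).mul dz.norm_sq)
    have dS' : HasDerivAt (fun s : ℝ => S (q + s • w)) (fderiv ℝ S q w) 0 := by
      have h1 : HasFDerivAt S (fderiv ℝ S q) (q + (0 : ℝ) • w) := by
        rw [h0]; exact (hSq.differentiableAt one_ne_zero).hasFDerivAt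
      exact h1.comp_hasDerivAt (0 : ℝ) hline
    rw [dS'.unique dS]
    simp only [h0, he, hD, inner_add_left, inner_sub_left, inner_sub_right, inner_smul_right,
      inner_smul_left, hxyq, RCLike.conj_to_real, hP]
    rw [real_inner_comm (x' (T q)) (z q)]
    ring
  · nlinarith [sq_nonneg C₀]
  · have hDq : |D q| ≤ (2 * C₀ + 1) * ‖z q‖ := by
      have i1 : |inner ℝ (y' (T q)) (z q)| ≤ C₀ * ‖z q‖ :=
        (abs_real_inner_le_norm _ _).trans (by gcongr)
      have i2 : |K / 2 * ‖z q‖ ^ 2| ≤ 1 * ‖z q‖ := by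
        rw [abs_of_nonneg (by positivity)]
        nlinarith [norm_nonneg (z q)]
      have i3 : |K * (T q - t₀) * inner ℝ (z q) (x' (T q))| ≤ C₀ * ‖z q‖ := by
        rw [abs_mul]
        calc |K * (T q - t₀)| * |inner ℝ (z q) (x' (T q))| ≤ 1 * (‖z q‖ * C₀) := by
              refine mul_le_mul b7.le ((abs_real_inner_le_norm _ _).trans (by gcongr))
                (abs_nonneg _) zero_le_one
          _ = _ := by ring
      calc |D q| ≤ |inner ℝ (y' (T q)) (z q)| + |K / 2 * ‖z q‖ ^ 2| +
            |K * (T q - t₀) * inner ℝ (z q) (x' (T q))| :=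
            (abs_add_le _ _).trans (by gcongr; exact abs_sub _ _)
        _ ≤ _ := by linarith
    calc ‖e q‖ ≤ ‖(deriv τ (P q) * D q) • y t₀‖ + ‖(K * (T q - t₀)) • z q‖ := norm_sub_le _ _
      _ ≤ C₀ * ((2 * C₀ + 1) * ‖z q‖) * C₀ + 1 * ‖z q‖ := by
          rw [norm_smul, norm_smul, Real.norm_eq_abs, Real.norm_eq_abs, abs_mul]
          gcongr
          linarith
      _ ≤ _ := by
          have := norm_nonneg (z q)
          change _ ≤ _ * ‖z q‖
          nlinarith
  · have h1 : deriv τ (P q) * inner ℝ (y t₀) (x' (T q)) = 1 := hτφq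
    change inner ℝ (x' (T q)) (e q) = inner ℝ (y' (T q)) (z q) - K / 2 * ‖z q‖ ^ 2
    simp only [he, inner_sub_right (x' (T q)), inner_smul_right]
    rw [real_inner_comm (y t₀) (x' (T q)), real_inner_comm (z q) (x' (T q))]
    -- The differential of T takes the value 1 on x' (T q), also at points off the curve, so the
    -- terms with K(T q - t₀) cancel in the pairing with e.
    have : deriv τ (P q) * D q * inner ℝ (y t₀) (x' (T q)) = D q := by
      linear_combination D q * h1
    rw [this]
    simp only [hD]
    ring

end

/-! ### Local calibration of a normal extremal. -/

section Calibration

variable {E A : Type*} [NormedAddCommGroup E] [InnerProductSpace ℝ E] [FiniteDimensional ℝ E]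
  [NormedAddCommGroup A] [InnerProductSpace ℝ A] [FiniteDimensional ℝ A]
  {Y : E → A →L[ℝ] E} {L : ℝ}

/-- The dual norm of a covector that is transversally concave enough does not exceed that of the
covector of the extremal. -/
theorem BoundedField.inner_le_norm (hY : BoundedField Y L) {x y e z x' y' : E} {κ K C : ℝ}
    (hκ : 0 < κ) (hC : 0 < C) (hh : ‖momentum Y x y‖ = 1)
    (hx' : x' = κ • Y x (momentum Y x y))
    (hy' : inner ℝ y' z = -κ * inner ℝ y (fderiv ℝ Y x z (momentum Y x y)))
    (he : inner ℝ x' e = inner ℝ y' z - K / 2 * ‖z‖ ^ 2) (hyC : ‖y‖ ≤ C) (heC : ‖e‖ ≤ C * ‖z‖)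
    (hK : κ * (4 * L * C + 4 * L ^ 2 * C ^ 2) ≤ K) (a : A) :
    inner ℝ (y + e) (Y (x + z) a) ≤ ‖a‖ := by
  set h := momentum Y x y with hhdef
  set m := momentum Y (x + z) (y + e) with hm
  have hL := hY.nonneg
  have hz0 := norm_nonneg z
  have hlip : ‖Y (x + z) - Y x‖ ≤ L * ‖z‖ := by simpa using hY.lip (x + z) x
  have hadj : ∀ B : A →L[ℝ] E, ‖ContinuousLinearMap.adjoint B‖ = ‖B‖ := fun B =>
    LinearIsometryEquiv.norm_map _ B
  have hmh : m - h = ContinuousLinearMap.adjoint (Y (x + z) - Y x) y +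
      ContinuousLinearMap.adjoint (Y (x + z)) e := by
    simp only [hm, hhdef, momentum, map_sub, map_add, _root_.sub_apply]; abel
  have hw : ‖m - h‖ ≤ 2 * L * C * ‖z‖ := by
    rw [hmh]
    have i1 : ‖ContinuousLinearMap.adjoint (Y (x + z) - Y x) y‖ ≤ L * ‖z‖ * C := by
      refine (ContinuousLinearMap.le_opNorm _ _).trans ?_
      rw [hadj]; gcongr
    have i2 : ‖ContinuousLinearMap.adjoint (Y (x + z)) e‖ ≤ L * (C * ‖z‖) := by
      refine (ContinuousLinearMap.le_opNorm _ _).trans ?_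
      rw [hadj]; gcongr; exact hY.norm_le _
    linarith [norm_add_le (ContinuousLinearMap.adjoint (Y (x + z) - Y x) y)
      (ContinuousLinearMap.adjoint (Y (x + z)) e)]
  -- The terms linear in z cancel by Hamilton's equation, encoded in `hy'` and `he`. What remains is
  -- the concavity -K/(2κ) ‖z‖² and two quadratic errors of at most L C ‖z‖² each.
  have hin : inner ℝ h (m - h) ≤ -(K / (2 * κ)) * ‖z‖ ^ 2 + 2 * L * C * ‖z‖ ^ 2 := by
    have e1 : inner ℝ h m = inner ℝ (y + e) (Y (x + z) h) := by
      rw [real_inner_comm, hm, inner_momentum]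
    have e2 : inner ℝ h h = inner ℝ y (Y x h) := inner_momentum _ _ _ _
    have e3 : inner ℝ (y + e) (Y (x + z) h) = inner ℝ y (Y x h) +
        inner ℝ y ((Y (x + z) - Y x - fderiv ℝ Y x z) h) + inner ℝ y (fderiv ℝ Y x z h) +
        inner ℝ e ((Y (x + z) - Y x) h) + inner ℝ e (Y x h) := by
      simp only [_root_.sub_apply, inner_add_left, inner_sub_right]; ring
    have e4 : κ * inner ℝ e (Y x h) = -κ * inner ℝ y (fderiv ℝ Y x z h) - K / 2 * ‖z‖ ^ 2 := by
      rw [← hy', ← he, hx', inner_smul_left, real_inner_comm]; rfl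
    have e5 : inner ℝ y (fderiv ℝ Y x z h) + inner ℝ e (Y x h) = -(K / (2 * κ)) * ‖z‖ ^ 2 := by
      field_simp
      linarith
    have i1 : inner ℝ y ((Y (x + z) - Y x - fderiv ℝ Y x z) h) ≤ C * (L * ‖z‖ ^ 2 * 1) := by
      refine (real_inner_le_norm _ _).trans ?_
      refine mul_le_mul hyC ((ContinuousLinearMap.le_opNorm _ _).trans ?_) (norm_nonneg _) hC.le
      rw [hh]; exact mul_le_mul_of_nonneg_right (hY.taylor x z) zero_le_one
    have i2 : inner ℝ e ((Y (x + z) - Y x) h) ≤ C * ‖z‖ * (L * ‖z‖ * 1) := by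
      refine (real_inner_le_norm _ _).trans ?_
      refine mul_le_mul heC ((ContinuousLinearMap.le_opNorm _ _).trans ?_) (norm_nonneg _)
        (by positivity)
      rw [hh]; exact mul_le_mul_of_nonneg_right hlip zero_le_one
    rw [inner_sub_right, e1, e2, e3]
    nlinarith
  have hm1 : ‖m‖ ≤ 1 := by
    -- Of the threshold for K, the part 4LC comes from twice the inner product and 4L²C² from the
    -- square of m - h.
    have e1 : ‖m‖ ^ 2 = ‖h‖ ^ 2 + 2 * inner ℝ h (m - h) + ‖m - h‖ ^ 2 := by
      rw [← norm_add_sq_real]; simp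
    have i1 : ‖m - h‖ ^ 2 ≤ (2 * L * C * ‖z‖) ^ 2 := by gcongr
    have i2 : (4 * L * C + 4 * L ^ 2 * C ^ 2) ≤ K / κ := by
      rw [le_div_iff₀ hκ]; linarith
    have i3 : K / (2 * κ) = K / κ / 2 := by ring
    rw [i3] at hin
    have i4 := mul_le_mul_of_nonneg_right i2 (sq_nonneg ‖z‖)
    rw [hh] at e1
    have : ‖m‖ ^ 2 ≤ 1 ^ 2 := by nlinarith
    exact (sq_le_sq₀ (norm_nonneg _) zero_le_one).1 this
  calc inner ℝ (y + e) (Y (x + z) a) = inner ℝ m a := (inner_momentum _ _ _ _).symm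
    _ ≤ ‖m‖ * ‖a‖ := real_inner_le_norm _ _
    _ ≤ 1 * ‖a‖ := by gcongr
    _ = ‖a‖ := one_mul _

/-- A normal extremal admits a local calibration. -/
theorem exists_calibration (hY : BoundedField Y L) {ζ : ℝ → E × E} {t₀ ε κ : ℝ} (hε : 0 < ε)
    (hκ : 0 < κ)
    (hζ : ∀ t ∈ Ioo (t₀ - ε) (t₀ + ε), HasDerivAt ζ (hamiltonianField Y (ζ t)) t)
    (hm : ‖momentum Y (ζ t₀).1 (ζ t₀).2‖ = κ) :
    ∃ S : E → ℝ, (∀ᶠ q in 𝓝 (ζ t₀).1, ContDiffAt ℝ 1 S q ∧ ∀ a, fderiv ℝ S q (Y q a) ≤ ‖a‖) ∧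
      ∀ᶠ t in 𝓝 t₀, S (ζ t).1 = κ * (t - t₀) := by
  have hIoo : Ioo (t₀ - ε) (t₀ + ε) ∈ 𝓝 t₀ := Ioo_mem_nhds (by linarith) (by linarith)
  have hev : ∀ᶠ t in 𝓝 t₀, HasDerivAt ζ (hamiltonianField Y (ζ t)) t := by
    filter_upwards [hIoo] with t ht using hζ t ht
  have hcont : ∀ᶠ t in 𝓝 t₀, ContinuousAt (fun s => hamiltonianField Y (ζ s)) t :=
    hev.mono fun t ht =>
      hY.contDiff_hamiltonianField.continuous.continuousAt.comp ht.continuousAt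
  -- the norm of the momenta is constant
  have hmom : ∀ t ∈ Icc (t₀ - ε / 2) (t₀ + ε / 2), ‖momentum Y (ζ t).1 (ζ t).2‖ = κ := by
    have hsub : Icc (t₀ - ε / 2) (t₀ + ε / 2) ⊆ Ioo (t₀ - ε) (t₀ + ε) :=
      Icc_subset_Ioo (by linarith) (by linarith)
    have hab : t₀ - ε / 2 ≤ t₀ + ε / 2 := by linarith
    have cζ : ContinuousOn ζ (Icc (t₀ - ε / 2) (t₀ + ε / 2)) := fun t ht =>
      (hζ t (hsub ht)).continuousAt.continuousWithinAt
    have cu : ContinuousOn (fun t => momentum Y (ζ t).1 (ζ t).2)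
        (Icc (t₀ - ε / 2) (t₀ + ε / 2)) :=
      hY.contDiff_momentum.continuous.comp_continuousOn cζ
    have cH : ContinuousOn (fun t => hamiltonianField Y (ζ t))
        (Icc (t₀ - ε / 2) (t₀ + ε / 2)) :=
      hY.contDiff_hamiltonianField.continuous.comp_continuousOn cζ
    have hint : ∀ {V : Type _} [NormedAddCommGroup V] [NormedSpace ℝ V] [CompleteSpace V]
        (P : E × E →L[ℝ] V), ∀ t ∈ Icc (t₀ - ε / 2) (t₀ + ε / 2),
        P (ζ t) = P (ζ (t₀ - ε / 2)) +
          ∫ r in (t₀ - ε / 2)..t, P (hamiltonianField Y (ζ r)) := by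
      intro V _ _ _ P t ht
      have hs : uIcc (t₀ - ε / 2) t ⊆ Icc (t₀ - ε / 2) (t₀ + ε / 2) := by
        rw [uIcc_of_le ht.1]; exact Icc_subset_Icc_right ht.2
      rw [intervalIntegral.integral_eq_sub_of_hasDerivAt (f := fun t => P (ζ t))
        (fun r hr => P.hasFDerivAt.comp_hasDerivAt r (hζ r (hsub (hs hr))))
        ((P.continuous.comp_continuousOn (cH.mono hs)).intervalIntegrable)]
      abel
    have hsol : IsSol Y (fun t => momentum Y (ζ t).1 (ζ t).2) (fun t => (ζ t).1)
        (t₀ - ε / 2) (t₀ + ε / 2) :=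
      ⟨cζ.fst, fun t ht => hint (ContinuousLinearMap.fst ℝ E E) t ht⟩
    have hadj : IsAdjoint Y (fun t => momentum Y (ζ t).1 (ζ t).2) (fun t => (ζ t).1)
        (fun t => (ζ t).2) (t₀ - ε / 2) (t₀ + ε / 2) :=
      ⟨cζ.snd, fun t ht => hint (ContinuousLinearMap.snd ℝ E E) t ht⟩
    -- Here the control is the momentum itself, so the proportionality factor m is 1.
    obtain ⟨c, hc⟩ := norm_momentum_const hY hab
      (ContinuousOn.intervalIntegrable (by rwa [uIcc_of_le hab])) hsol hadj (m := fun _ => 1)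
      (Eventually.of_forall fun t => one_smul _ _)
    have : κ = c := by rw [← hm, hc t₀ ⟨by linarith, by linarith⟩]
    rw [this]; exact hc
  have hmom' : ∀ᶠ t in 𝓝 t₀, ‖momentum Y (ζ t).1 (ζ t).2‖ = κ := by
    filter_upwards [Icc_mem_nhds (show t₀ - ε / 2 < t₀ by linarith)
      (show t₀ < t₀ + ε / 2 by linarith)] with t ht using hmom t ht
  set x : ℝ → E := fun t => (ζ t).1 with hxdef
  -- Division by κ gives the covector dual norm 1, the value required of dS on the curve.
  set y : ℝ → E := fun t => κ⁻¹ • (ζ t).2 with hydef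
  set x' : ℝ → E := fun t => (hamiltonianField Y (ζ t)).1 with hx'def
  set y' : ℝ → E := fun t => κ⁻¹ • (hamiltonianField Y (ζ t)).2 with hy'def
  have hmy : ∀ t, momentum Y (ζ t).1 (ζ t).2 = κ • momentum Y (x t) (y t) := fun t => by
    rw [hydef]
    simp only [momentum, map_smul]
    rw [smul_inv_smul₀ hκ.ne']
  have hxy : ∀ᶠ t in 𝓝 t₀, ‖momentum Y (x t) (y t)‖ = 1 := by
    filter_upwards [hmom'] with t ht
    rw [hmy, norm_smul, Real.norm_of_nonneg hκ.le] at ht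
    exact mul_left_cancel₀ hκ.ne' (by linarith)
  have hx'eq : ∀ t, x' t = κ • Y (x t) (momentum Y (x t) (y t)) := fun t => by
    change Y (x t) (momentum Y (ζ t).1 (ζ t).2) = _
    rw [hmy, map_smul]
  have hy'eq : ∀ t w, inner ℝ (y' t) w =
      -κ * inner ℝ (y t) (fderiv ℝ Y (x t) w (momentum Y (x t) (y t))) := fun t w => by
    change inner ℝ (κ⁻¹ • -ContinuousLinearMap.adjoint
      ((fderiv ℝ Y (x t)).flip (momentum Y (ζ t).1 (ζ t).2)) (ζ t).2) w = _
    rw [inner_smul_left, inner_neg_left, ContinuousLinearMap.adjoint_inner_left,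
      ContinuousLinearMap.flip_apply, hmy, map_smul, inner_smul_right, hydef, inner_smul_left]
    simp only [RCLike.conj_to_real]
    field_simp
  obtain ⟨C, hC, hpot⟩ := exists_concave_potential (x := x) (y := y) (x' := x') (y' := y')
    (t₀ := t₀) hκ.ne' (hev.mono fun t ht => ht.fst)
    (hcont.mono fun t ht => ht.fst) (hev.mono fun t ht =>
      ((ContinuousLinearMap.snd ℝ E E).hasFDerivAt.comp_hasDerivAt t ht).const_smul κ⁻¹)
    (hcont.mono fun t ht => ht.snd.const_smul κ⁻¹) (by
      filter_upwards [hxy] with t ht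
      rw [hx'eq, inner_smul_right, ← inner_momentum, real_inner_self_eq_norm_sq, ht]
      ring)
  have hL := hY.nonneg
  obtain ⟨S, T, e, cS, cT, hT0, hSx, hS⟩ := hpot (κ * (4 * L * C + 4 * L ^ 2 * C ^ 2))
    (by positivity)
  refine ⟨S, ?_, hSx⟩
  have tT : Tendsto T (𝓝 (x t₀)) (𝓝 t₀) := by
    have := cT.tendsto; rwa [hT0] at this
  filter_upwards [cS.eventually (by simp), hS, tT.eventually hxy] with q h1 h2 h3
  refine ⟨h1, fun a => ?_⟩
  obtain ⟨k1, k2, k3, k4⟩ := h2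
  rw [k1]
  have := hY.inner_le_norm hκ hC h3 (hx'eq _) (hy'eq _ _) k4 k2 k3 le_rfl a
  rwa [add_sub_cancel] at this

end Calibration

end SubRiem

/-! ### Curves and vector fields in charts. -/

namespace SubRiem

open Filter Topology

set_option linter.unusedSectionVars false

/-- Cutting G off by a bump function, equal to 1 on the ball of radius R/4 and vanishing outside
that of radius R/2, gives a compactly supported C² field. -/
theorem exists_boundedField_of_contDiffOn {E A : Type*} [NormedAddCommGroup E]
    [InnerProductSpace ℝ E] [FiniteDimensional ℝ E] [NormedAddCommGroup A] [NormedSpace ℝ A]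
    {G : E → A →L[ℝ] E} {z₀ : E} {R : ℝ} (hR : 0 < R)
    (hG : ContDiffOn ℝ 2 G (Metric.ball z₀ R)) :
    ∃ (Y : E → A →L[ℝ] E) (L : ℝ), BoundedField Y L ∧ ∀ z ∈ Metric.ball z₀ (R / 4), Y z = G z := by
  let β : ContDiffBump z₀ := ⟨R / 4, R / 2, by positivity, by linarith⟩
  have hY : ContDiff ℝ 2 fun z => β z • G z := by
    rw [contDiff_iff_contDiffAt]
    intro z
    by_cases hz : z ∈ Metric.ball z₀ R
    · exact β.contDiffAt.smul (hG.contDiffAt (Metric.isOpen_ball.mem_nhds hz))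
    · have : (fun z => β z • G z) =ᶠ[𝓝 z] fun _ => 0 := by
        have hz' : z ∈ (Metric.closedBall z₀ (R / 2))ᶜ := fun h => hz
          (Metric.closedBall_subset_ball (by linarith) h)
        filter_upwards [Metric.isClosed_closedBall.isOpen_compl.mem_nhds hz'] with y hy
        have h0 : β y = 0 := β.zero_of_le_dist
          (not_le.1 fun h => hy (Metric.mem_closedBall.2 h)).le
        rw [h0, zero_smul]
      exact contDiffAt_const.congr_of_eventuallyEq this
  have hc : HasCompactSupport fun z => β z • G z := by
    refine HasCompactSupport.intro (isCompact_closedBall z₀ (R / 2)) fun z hz => ?_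
    have h0 : β z = 0 := β.zero_of_le_dist
      (not_le.1 fun h => hz (Metric.mem_closedBall.2 h)).le
    rw [h0, zero_smul]
  obtain ⟨L, hL⟩ := exists_boundedField hY hc
  refine ⟨_, L, hL, fun z hz => ?_⟩
  rw [β.one_of_mem_closedBall (Metric.ball_subset_closedBall hz), one_smul]

section Curves

variable {n d : ℕ} {M : Type*} [TopologicalSpace M] [ChartedSpace (EuclideanSpace ℝ (Fin n)) M]
  [IsManifold (𝓡 n) ∞ M]

theorem isManifold_one : IsManifold (𝓡 n) 1 M := IsManifold.of_le (n := ∞) (by norm_num)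

/-- The composition of an absolutely continuous curve with a `C^1` map is locally absolutely
continuous. -/
theorem AbsContCurve.exists_comp {V : Type*} [NormedAddCommGroup V] [NormedSpace ℝ V] {γ : ℝ → M}
    {a b t : ℝ} (hγ : AbsContCurve n γ a b) (ht : t ∈ Icc a b) {g : M → V}
    (hg : ContMDiffAt (𝓡 n) 𝓘(ℝ, V) 1 g (γ t)) :
    ∃ ε > 0, ∀ r s, r ∈ Icc a b → s ∈ Icc a b → t - ε < r → r ≤ s → s < t + ε →
      AbsolutelyContinuousOnInterval (fun x => g (γ x)) r s := by
  have : IsManifold (𝓡 n) 1 M := isManifold_one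
  obtain ⟨ε₁, hε₁, hmaps, hac⟩ := hγ.2 t ht
  set ψ := extChartAt (𝓡 n) (γ t) with hψ
  -- Read in the chart, g is C¹ and so Lipschitz near the point, and Lipschitz maps preserve
  -- absolute continuity.
  have hgψ : ContDiffAt ℝ 1 (fun z => g (ψ.symm z)) (ψ (γ t)) := by
    rw [← contMDiffAt_iff_contDiffAt]
    have h1 : ContMDiffAt 𝓘(ℝ, EuclideanSpace ℝ (Fin n)) (𝓡 n) 1 ψ.symm (ψ (γ t)) :=
      (contMDiffOn_extChartAt_symm (γ t)).contMDiffAt (extChartAt_target_mem_nhds (γ t))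
    refine ContMDiffAt.comp (ψ (γ t)) ?_ h1
    rwa [hψ, extChartAt_to_inv]
  obtain ⟨K, s, hs, hK⟩ := hgψ.exists_lipschitzOnWith
  have hc : ContinuousWithinAt (fun x => ψ (γ x)) (Icc a b) t :=
    (continuousAt_extChartAt (γ t)).comp_continuousWithinAt (hγ.1 t ht)
  have hev := hc.eventually_mem hs
  rw [eventually_nhdsWithin_iff] at hev
  obtain ⟨ε₂, hε₂, hs'⟩ := Metric.eventually_nhds_iff.1 hev
  refine ⟨min ε₁ ε₂, lt_min hε₁ hε₂, fun r r' hr hr' h1 h2 h3 => ?_⟩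
  have m1 := min_le_left ε₁ ε₂
  have m2 := min_le_right ε₁ ε₂
  have hsub : Icc r r' ⊆ Icc (max a (t - ε₁)) (min b (t + ε₁)) :=
    Icc_subset_Icc (max_le hr.1 (by linarith)) (le_min hr'.2 (by linarith))
  have hac' : AbsolutelyContinuousOnInterval (fun x => ψ (γ x)) r r' := by
    refine hac.mono ?_
    rw [uIcc_of_le h2, uIcc_of_le (nonempty_Icc.1 ⟨r, hsub ⟨le_rfl, h2⟩⟩)]
    exact hsub
  have hin : ∀ x ∈ uIcc r r', ψ (γ x) ∈ s ∧ ψ.symm (ψ (γ x)) = γ x := fun x hx => by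
    rw [uIcc_of_le h2] at hx
    refine ⟨hs' ?_ ⟨hr.1.trans hx.1, hx.2.trans hr'.2⟩, ψ.left_inv (hmaps (hsub hx))⟩
    rw [Real.dist_eq, abs_lt]; constructor <;> linarith [hx.1, hx.2]
  refine absolutelyContinuousOnInterval_of_dist_le (C := K) (D := 0) hac' hac'
    fun x hx x' hx' => ?_
  have := hK.dist_le_mul _ (hin x hx).1 _ (hin x' hx').1
  simp only [(hin x hx).2, (hin x' hx').2] at this
  simpa using this

theorem hasDerivAt_comp_of_hasMFDerivAt {V : Type*} [NormedAddCommGroup V] [NormedSpace ℝ V]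
    {γ : ℝ → M} {t : ℝ} {v : TangentSpace (𝓡 n) (γ t)} {g : M → V}
    (hγ : HasMFDerivAt 𝓘(ℝ, ℝ) (𝓡 n) γ t ((1 : ℝ →L[ℝ] ℝ).smulRight v))
    (hg : MDifferentiableAt (𝓡 n) 𝓘(ℝ, V) g (γ t)) :
    HasDerivAt (fun x => g (γ x)) (mfderiv (𝓡 n) 𝓘(ℝ, V) g (γ t) v) t := by
  set D : ℝ →L[ℝ] V :=
    (mfderiv (𝓡 n) 𝓘(ℝ, V) g (γ t)).comp ((1 : ℝ →L[ℝ] ℝ).smulRight v) with hD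
  have h : HasFDerivAt (fun x => g (γ x)) D t := (hg.hasMFDerivAt.comp t hγ).hasFDerivAt
  have e : D 1 = mfderiv (𝓡 n) 𝓘(ℝ, V) g (γ t) v := by
    change mfderiv (𝓡 n) 𝓘(ℝ, V) g (γ t) ((1 : ℝ) • v) = _
    rw [one_smul]
  rw [← e]
  exact h.hasDerivAt

/-- `σ` is, on `[a,b]`, an absolutely continuous solution of `σ' = ∑ w_i X_i(σ)`. -/
structure IsTrajectoryOn (X : Fin d → (q : M) → TangentSpace (𝓡 n) q)
    (w : ℝ → EuclideanSpace ℝ (Fin d)) (σ : ℝ → M) (a b : ℝ) : Prop where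
  absCont : AbsContCurve n σ a b
  deriv : ∀ᵐ t ∂(volume.restrict (Icc a b)), HasMFDerivAt 𝓘(ℝ, ℝ) (𝓡 n) σ t
    ((1 : ℝ →L[ℝ] ℝ).smulRight (combination X (σ t) (w t)))

theorem AbsContCurve.mono {γ : ℝ → M} {a b c e : ℝ} (hγ : AbsContCurve n γ a b) (hac : a ≤ c)
    (hce : c ≤ e) (heb : e ≤ b) : AbsContCurve n γ c e := by
  have hsub : Icc c e ⊆ Icc a b := Icc_subset_Icc hac heb
  refine ⟨hγ.1.mono hsub, fun t ht => ?_⟩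
  obtain ⟨ε, hε, h1, h2⟩ := hγ.2 t (hsub ht)
  have hs : Icc (max c (t - ε)) (min e (t + ε)) ⊆ Icc (max a (t - ε)) (min b (t + ε)) :=
    Icc_subset_Icc (max_le_max_right _ hac) (min_le_min_right _ heb)
  have hle : max c (t - ε) ≤ min e (t + ε) :=
    max_le (le_min hce (by linarith [ht.1])) (le_min (by linarith [ht.2]) (by linarith))
  refine ⟨ε, hε, h1.mono_left hs, h2.mono ?_⟩
  rw [uIcc_of_le hle, uIcc_of_le (nonempty_Icc.1 ⟨_, hs ⟨le_rfl, hle⟩⟩)]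
  exact hs

theorem IsTrajectoryOn.mono {X : Fin d → (q : M) → TangentSpace (𝓡 n) q}
    {w : ℝ → EuclideanSpace ℝ (Fin d)} {γ : ℝ → M} {a b c e : ℝ} (hγ : IsTrajectoryOn X w γ a b)
    (hac : a ≤ c) (hce : c ≤ e) (heb : e ≤ b) : IsTrajectoryOn X w γ c e :=
  ⟨hγ.absCont.mono hac hce heb, ae_mono (Measure.restrict_mono (Icc_subset_Icc hac heb) le_rfl)
    hγ.deriv⟩

/-- The representation of a vector field in the chart at `q₀`. -/
noncomputable def chartField (X : Fin d → (q : M) → TangentSpace (𝓡 n) q) (q₀ : M)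
    (z : EuclideanSpace ℝ (Fin n)) : EuclideanSpace ℝ (Fin d) →L[ℝ] EuclideanSpace ℝ (Fin n) :=
  ∑ i, (EuclideanSpace.proj i : EuclideanSpace ℝ (Fin d) →L[ℝ] ℝ).smulRight
    (mfderiv (𝓡 n) 𝓘(ℝ, EuclideanSpace ℝ (Fin n)) (extChartAt (𝓡 n) q₀)
      ((extChartAt (𝓡 n) q₀).symm z) (X i ((extChartAt (𝓡 n) q₀).symm z)))

theorem chartField_apply (X : Fin d → (q : M) → TangentSpace (𝓡 n) q) (q₀ : M)
    (z : EuclideanSpace ℝ (Fin n)) (a : EuclideanSpace ℝ (Fin d)) :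
    chartField X q₀ z a = mfderiv (𝓡 n) 𝓘(ℝ, EuclideanSpace ℝ (Fin n)) (extChartAt (𝓡 n) q₀)
      ((extChartAt (𝓡 n) q₀).symm z) (combination X ((extChartAt (𝓡 n) q₀).symm z) a) := by
  unfold chartField combination
  rw [map_sum, _root_.sum_apply]
  refine Finset.sum_congr rfl fun i _ => ?_
  rw [ContinuousLinearMap.map_smul]
  rfl

/-- The derivative of the chart applied to X i is the fibre coordinate of X i in the trivialisation
of the tangent bundle at q₀, and smooth sections have smooth fibre coordinates. -/
theorem contDiffOn_chartField {X : Fin d → (q : M) → TangentSpace (𝓡 n) q} (hX : SmoothFields X)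
    (q₀ : M) : ContDiffOn ℝ 2 (chartField X q₀) (extChartAt (𝓡 n) q₀).target := by
  have : IsManifold (𝓡 n) 1 M := isManifold_one
  have key : ∀ i, ContDiffOn ℝ 2 (fun z => (mfderiv (𝓡 n) 𝓘(ℝ, EuclideanSpace ℝ (Fin n))
      (extChartAt (𝓡 n) q₀) ((extChartAt (𝓡 n) q₀).symm z)
      (X i ((extChartAt (𝓡 n) q₀).symm z)) : EuclideanSpace ℝ (Fin n)))
      (extChartAt (𝓡 n) q₀).target := by
    intro i z hz
    set e := trivializationAt (EuclideanSpace ℝ (Fin n)) (TangentSpace (𝓡 n) (M := M)) q₀ with he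
    have hsrc : (extChartAt (𝓡 n) q₀).symm z ∈ (chartAt (EuclideanSpace ℝ (Fin n)) q₀).source := by
      rw [← extChartAt_source (𝓡 n)]; exact (extChartAt (𝓡 n) q₀).map_target hz
    have h1 : ContMDiffAt (𝓡 n) 𝓘(ℝ, EuclideanSpace ℝ (Fin n)) ∞
        (fun q => (e ⟨q, X i q⟩).2) ((extChartAt (𝓡 n) q₀).symm z) := by
      have := (hX i) ((extChartAt (𝓡 n) q₀).symm z)
      rwa [e.contMDiffAt_section_iff] at this
      rwa [TangentBundle.trivializationAt_baseSet]
    have h2 : ContMDiffWithinAt 𝓘(ℝ, EuclideanSpace ℝ (Fin n)) (𝓡 n) ∞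
        (extChartAt (𝓡 n) q₀).symm (extChartAt (𝓡 n) q₀).target z :=
      contMDiffOn_extChartAt_symm q₀ z hz
    have h3 := (h1.comp_contMDiffWithinAt z h2).contDiffWithinAt
    refine (h3.of_le (m := 2) (WithTop.coe_le_coe.2 le_top)).congr_of_mem (fun z' hz' => ?_) hz
    have hsrc' : (extChartAt (𝓡 n) q₀).symm z' ∈
        (chartAt (EuclideanSpace ℝ (Fin n)) q₀).source := by
      rw [← extChartAt_source (𝓡 n)]; exact (extChartAt (𝓡 n) q₀).map_target hz'
    refine (congrArg (fun D => D (X i ((extChartAt (𝓡 n) q₀).symm z')))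
      (TangentBundle.continuousLinearMapAt_trivializationAt hsrc')).symm.trans ?_
    refine e.continuousLinearMapAt_apply_of_mem (R := ℝ) ?_ _
    rwa [TangentBundle.trivializationAt_baseSet]
  refine ContDiffOn.sum fun i _ => ?_
  exact contDiffOn_const.smulRight (key i)

/-- Near every point, the system is represented in a chart by a bounded field on the whole
space. -/
theorem exists_boundedField_chart {X : Fin d → (q : M) → TangentSpace (𝓡 n) q}
    (hX : SmoothFields X) (q₀ : M) :
    ∃ (Y : EuclideanSpace ℝ (Fin n) → EuclideanSpace ℝ (Fin d) →L[ℝ] EuclideanSpace ℝ (Fin n))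
      (L r : ℝ), BoundedField Y L ∧ 0 < r ∧
      Metric.ball (extChartAt (𝓡 n) q₀ q₀) r ⊆ (extChartAt (𝓡 n) q₀).target ∧
      ∀ z ∈ Metric.ball (extChartAt (𝓡 n) q₀ q₀) r, Y z = chartField X q₀ z := by
  obtain ⟨R, hR, hsub⟩ := Metric.mem_nhds_iff.1 (extChartAt_target_mem_nhds (I := 𝓡 n) q₀)
  obtain ⟨Y, L, hY, h⟩ := exists_boundedField_of_contDiffOn hR
    ((contDiffOn_chartField hX q₀).mono hsub)
  exact ⟨Y, L, R / 4, hY, by positivity, (Metric.ball_subset_ball (by linarith)).trans hsub, h⟩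

end Curves

end SubRiem

/-! ### Trajectories in charts and their concatenation. -/

namespace SubRiem

open Filter Topology

set_option linter.unusedSectionVars false

section Trajectories

variable {n d : ℕ} {M : Type*} [TopologicalSpace M] [ChartedSpace (EuclideanSpace ℝ (Fin n)) M]
  [IsManifold (𝓡 n) ∞ M]

local notation "𝔼" => EuclideanSpace ℝ (Fin n)
local notation "𝔸" => EuclideanSpace ℝ (Fin d)

variable {X : Fin d → (q : M) → TangentSpace (𝓡 n) q}

/-- The bounded field `Y` represents the system in the chart at `q₀`, on the ball of radius `r`. -/
structure IsChartModel (X : Fin d → (q : M) → TangentSpace (𝓡 n) q) (q₀ : M)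
    (Y : EuclideanSpace ℝ (Fin n) → EuclideanSpace ℝ (Fin d) →L[ℝ] EuclideanSpace ℝ (Fin n))
    (L r : ℝ) : Prop where
  bounded : BoundedField Y L
  pos : 0 < r
  subset : Metric.ball (extChartAt (𝓡 n) q₀ q₀) r ⊆ (extChartAt (𝓡 n) q₀).target
  eq : ∀ z ∈ Metric.ball (extChartAt (𝓡 n) q₀ q₀) r, Y z = chartField X q₀ z

/-- The domain in `M` of a model of radius `r` in the chart at `q₀`. -/
def chartNhd (n : ℕ) {M : Type*} [TopologicalSpace M] [ChartedSpace (EuclideanSpace ℝ (Fin n)) M]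
    (q₀ : M) (r : ℝ) : Set M :=
  (extChartAt (𝓡 n) q₀).source ∩ extChartAt (𝓡 n) q₀ ⁻¹' Metric.ball (extChartAt (𝓡 n) q₀ q₀) r

theorem exists_isChartModel (hX : SmoothFields X) (q₀ : M) : ∃ Y L r, IsChartModel X q₀ Y L r := by
  obtain ⟨Y, L, r, h1, h2, h3, h4⟩ := exists_boundedField_chart hX q₀
  exact ⟨Y, L, r, h1, h2, h3, h4⟩

theorem isOpen_chartNhd (q₀ : M) (r : ℝ) : IsOpen (chartNhd n q₀ r) :=
  (continuousOn_extChartAt q₀).isOpen_inter_preimage (isOpen_extChartAt_source q₀)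
    Metric.isOpen_ball

theorem mem_chartNhd_self (q₀ : M) {r : ℝ} (hr : 0 < r) : q₀ ∈ chartNhd n q₀ r :=
  ⟨mem_extChartAt_source q₀, Metric.mem_ball_self hr⟩

theorem mdifferentiableAt_extChartAt_of_mem {q₀ q : M} (hq : q ∈ (extChartAt (𝓡 n) q₀).source) :
    MDifferentiableAt (𝓡 n) 𝓘(ℝ, 𝔼) (extChartAt (𝓡 n) q₀) q := by
  have : IsManifold (𝓡 n) 1 M := isManifold_one
  exact mdifferentiableAt_extChartAt (by rwa [← extChartAt_source (𝓡 n)])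

theorem contMDiffAt_extChartAt_of_mem {q₀ q : M} (hq : q ∈ (extChartAt (𝓡 n) q₀).source) :
    ContMDiffAt (𝓡 n) 𝓘(ℝ, 𝔼) 1 (extChartAt (𝓡 n) q₀) q := by
  have : IsManifold (𝓡 n) 1 M := isManifold_one
  exact contMDiffAt_extChartAt' (by rwa [← extChartAt_source (𝓡 n)])

variable {q₀ : M} {L r : ℝ}
  {Y : EuclideanSpace ℝ (Fin n) → EuclideanSpace ℝ (Fin d) →L[ℝ] EuclideanSpace ℝ (Fin n)}

theorem IsChartModel.apply (hY : IsChartModel X q₀ Y L r) {q : M} (hq : q ∈ chartNhd n q₀ r)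
    (a : 𝔸) : Y (extChartAt (𝓡 n) q₀ q) a =
      mfderiv (𝓡 n) 𝓘(ℝ, 𝔼) (extChartAt (𝓡 n) q₀) q (combination X q a) := by
  rw [hY.eq _ hq.2, chartField_apply]
  -- Tangent spaces at equal points are different types; ascribing the values to the model space
  -- allows substitution of the base point.
  have : ∀ q', q' = q → (mfderiv (𝓡 n) 𝓘(ℝ, 𝔼) (extChartAt (𝓡 n) q₀) q' (combination X q' a) : 𝔼) =
      mfderiv (𝓡 n) 𝓘(ℝ, 𝔼) (extChartAt (𝓡 n) q₀) q (combination X q a) := by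
    rintro _ rfl; rfl
  exact this _ ((extChartAt (𝓡 n) q₀).left_inv hq.1)

theorem IsTrajectoryOn.hasDerivAt_chart (hY : IsChartModel X q₀ Y L r) {w : ℝ → 𝔸} {γ : ℝ → M}
    {a b : ℝ} (hγ : IsTrajectoryOn X w γ a b) :
    ∀ᵐ t ∂volume.restrict (Icc a b), γ t ∈ chartNhd n q₀ r →
      HasDerivAt (fun x => extChartAt (𝓡 n) q₀ (γ x)) (Y (extChartAt (𝓡 n) q₀ (γ t)) (w t)) t := by
  filter_upwards [hγ.deriv] with t ht hm
  rw [hY.apply hm]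
  exact hasDerivAt_comp_of_hasMFDerivAt ht (mdifferentiableAt_extChartAt_of_mem hm.1)

/-- A trajectory in the domain of a chart solves the system in that chart. -/
theorem IsTrajectoryOn.isSol (hY : IsChartModel X q₀ Y L r) {w : ℝ → 𝔸} {γ : ℝ → M}
    {a b : ℝ} (hab : a ≤ b) (hw : IntervalIntegrable w volume a b)
    (hγ : IsTrajectoryOn X w γ a b) (hm : ∀ t ∈ Icc a b, γ t ∈ chartNhd n q₀ r) :
    IsSol Y w (fun t => extChartAt (𝓡 n) q₀ (γ t)) a b := by
  set f : ℝ → 𝔼 := fun t => extChartAt (𝓡 n) q₀ (γ t) with hf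
  have hc : ContinuousOn f (Icc a b) :=
    (continuousOn_extChartAt q₀).comp hγ.absCont.1 fun t ht => (hm t ht).1
  have hi := hY.bounded.intervalIntegrable hab hc hw
  have hi' : ∀ s ∈ Icc a b, ∀ t ∈ Icc a b,
      IntervalIntegrable (fun x => Y (f x) (w x)) volume s t := fun s hs t ht =>
    hi.mono_set (uIcc_subset_uIcc (by rwa [uIcc_of_le hab]) (by rwa [uIcc_of_le hab]))
  refine ⟨hc, fun t ht => ?_⟩
  have hsub : Icc a t ⊆ Icc a b := Icc_subset_Icc_right ht.2
  -- Absolute continuity is given only near each time, so the integral equation is proved on short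
  -- intervals and chained.
  refine relation_of_locally (R := fun s t => f t = f s + ∫ x in s..t, Y (f x) (w x)) ht.1
    (fun s _ => by simp) (fun x y z hx hxy hyz hz h1 h2 => ?_) fun s hs => ?_
  · have my := hsub ⟨hx.trans hxy, hyz.trans hz⟩
    rw [h2, h1, add_assoc, intervalIntegral.integral_add_adjacent_intervals
      (hi' _ (hsub ⟨hx, (hxy.trans hyz).trans hz⟩) _ my)
      (hi' _ my _ (hsub ⟨(hx.trans hxy).trans hyz, hz⟩))]
  · obtain ⟨ε, hε, h⟩ := hγ.absCont.exists_comp (hsub hs)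
      (contMDiffAt_extChartAt_of_mem (hm s (hsub hs)).1)
    refine ⟨ε, hε, fun x y hx hy h1 h2 h3 => ?_⟩
    have hxy : Icc x y ⊆ Icc a b := Icc_subset_Icc hx.1 (hsub hy).2
    refine eq_add_integral_of_ae_hasDerivAt h2 (h x y (hsub hx) (hsub hy) h1 h2 h3)
      (hi' _ (hsub hx) _ (hsub hy)) ?_ y ⟨h2, le_rfl⟩
    filter_upwards [ae_mono (Measure.restrict_mono hxy le_rfl) (hγ.hasDerivAt_chart hY),
      ae_restrict_mem measurableSet_Icc] with t ht ht' using ht (hm t (hxy ht'))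

/-- Continuity supplies the condition that the curve stays in the chart domain; halving ε passes
from open to closed time intervals. -/
theorem absContCurve_of_exists {σ : ℝ → M} {a b : ℝ} (hc : ContinuousOn σ (Icc a b))
    (h : ∀ t ∈ Icc a b, ∃ ε > 0, ∀ x y, x ∈ Icc a b → y ∈ Icc a b → t - ε < x → x ≤ y →
      y < t + ε → AbsolutelyContinuousOnInterval (fun s => extChartAt (𝓡 n) (σ t) (σ s)) x y) :
    AbsContCurve n σ a b := by
  refine ⟨hc, fun t ht => ?_⟩
  obtain ⟨ε₁, hε₁, h1⟩ := h t ht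
  have hev := (hc t ht).eventually_mem (extChartAt_source_mem_nhds (I := 𝓡 n) (σ t))
  rw [eventually_nhdsWithin_iff] at hev
  obtain ⟨ε₂, hε₂, h2⟩ := Metric.eventually_nhds_iff.1 hev
  have m1 := min_le_left ε₁ ε₂
  have m2 := min_le_right ε₁ ε₂
  have m0 : 0 < min ε₁ ε₂ := lt_min hε₁ hε₂
  set ε := min ε₁ ε₂ / 2 with hε
  have hε0 : 0 < ε := by positivity
  have hle : max a (t - ε) ≤ min b (t + ε) :=
    max_le (le_min (ht.1.trans ht.2) (by linarith [ht.1])) (le_min (by linarith [ht.2])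
      (by linarith))
  refine ⟨ε, hε0, fun s hs => ?_, h1 _ _ ?_ ?_ ?_ hle ?_⟩
  · have i1 := (le_max_right _ _).trans hs.1
    have i2 := hs.2.trans (min_le_right _ _)
    refine h2 ?_ ⟨(le_max_left _ _).trans hs.1, hs.2.trans (min_le_left _ _)⟩
    rw [Real.dist_eq, abs_lt]; constructor <;> linarith
  · exact ⟨le_max_left _ _, hle.trans (min_le_left _ _)⟩
  · exact ⟨(le_max_left _ _).trans hle, min_le_left _ _⟩
  · exact lt_of_lt_of_le (by linarith) (le_max_right _ _)
  · exact lt_of_le_of_lt (min_le_right _ _) (by linarith)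

/-- A solution of the system in a chart is a trajectory. -/
theorem IsChartModel.isTrajectoryOn (hY : IsChartModel X q₀ Y L r) {w : ℝ → 𝔸} {f : ℝ → 𝔼}
    {a b : ℝ} (hab : a ≤ b) (hw : IntervalIntegrable w volume a b) (hf : IsSol Y w f a b)
    (hm : ∀ t ∈ Icc a b, f t ∈ Metric.ball (extChartAt (𝓡 n) q₀ q₀) r) :
    IsTrajectoryOn X w (fun t => (extChartAt (𝓡 n) q₀).symm (f t)) a b := by
  have : IsManifold (𝓡 n) 1 M := isManifold_one
  have hi := hf.intervalIntegrable hY.bounded hab hw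
  have hac := absolutelyContinuousOnInterval_of_eq_integral hab hi hf.eq
  have hsymm : ∀ t ∈ Icc a b, ContMDiffAt 𝓘(ℝ, 𝔼) (𝓡 n) 1 (extChartAt (𝓡 n) q₀).symm (f t) :=
    fun t ht => (contMDiffOn_extChartAt_symm q₀).contMDiffAt
      ((isOpen_extChartAt_target q₀).mem_nhds (hY.subset (hm t ht)))
  refine ⟨absContCurve_of_exists (fun t ht =>
    (hsymm t ht).continuousAt.comp_continuousWithinAt (hf.continuousOn t ht)) fun t ht => ?_, ?_⟩
  · have h1 : ContDiffAt ℝ 1 (fun z => extChartAt (𝓡 n) ((extChartAt (𝓡 n) q₀).symm (f t))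
        ((extChartAt (𝓡 n) q₀).symm z)) (f t) := by
      rw [← contMDiffAt_iff_contDiffAt]
      exact ContMDiffAt.comp (f t) contMDiffAt_extChartAt (hsymm t ht)
    obtain ⟨K, s, hs, hK⟩ := h1.exists_lipschitzOnWith
    have hev := (hf.continuousOn t ht).eventually_mem hs
    rw [eventually_nhdsWithin_iff] at hev
    obtain ⟨ε, hε, h2⟩ := Metric.eventually_nhds_iff.1 hev
    refine ⟨ε, hε, fun x y hx hy h3 h4 h5 => ?_⟩
    have hxy : Icc x y ⊆ Icc a b := Icc_subset_Icc hx.1 hy.2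
    refine hK.comp_absolutelyContinuousOnInterval (hac.mono ?_) fun z hz => ?_
    · rwa [uIcc_of_le h4, uIcc_of_le hab]
    · rw [uIcc_of_le h4] at hz
      refine h2 ?_ (hxy hz)
      rw [Real.dist_eq, abs_lt]; constructor <;> linarith [hz.1, hz.2]
  · filter_upwards [ae_hasDerivAt_of_eq_integral hab hi hf.eq,
      ae_restrict_mem measurableSet_Icc] with t ht htm
    have hz := hY.subset (hm t htm)
    have h1 := ((hsymm t htm).mdifferentiableAt one_ne_zero).hasMFDerivAt
    have h2 : HasMFDerivAt 𝓘(ℝ, ℝ) 𝓘(ℝ, 𝔼) f t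
        ((1 : ℝ →L[ℝ] ℝ).smulRight (Y (f t) (w t))) := by
      convert! ht.hasFDerivAt.hasMFDerivAt using 1
    have h3 := h1.comp t h2
    -- The derivative of the inverse chart undoes that of the chart, so the coordinate velocity
    -- Y(f)w is carried back to the combination of the X i.
    have h4 := mfderivWithin_extChartAt_symm_comp_mfderiv_extChartAt (I := 𝓡 n) (x := q₀) hz
    rw [ModelWithCorners.range_eq_univ, mfderivWithin_univ] at h4
    have h5 := congrArg (fun D => D (combination X ((extChartAt (𝓡 n) q₀).symm (f t)) (w t))) h4
    have h6 : Y (f t) (w t) = chartField X q₀ (f t) (w t) := by rw [hY.eq _ (hm t htm)]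
    rw [chartField_apply] at h6
    have h7 : ((1 : ℝ →L[ℝ] ℝ).smulRight
        (combination X ((extChartAt (𝓡 n) q₀).symm (f t)) (w t) : 𝔼) : ℝ →L[ℝ] 𝔼) =
        (mfderiv 𝓘(ℝ, 𝔼) (𝓡 n) (extChartAt (𝓡 n) q₀).symm (f t) : 𝔼 →L[ℝ] 𝔼).comp
          ((1 : ℝ →L[ℝ] ℝ).smulRight (Y (f t) (w t))) := by
      refine ContinuousLinearMap.ext_ring ?_
      change (1 : ℝ) • (combination X ((extChartAt (𝓡 n) q₀).symm (f t)) (w t) : 𝔼) =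
        mfderiv 𝓘(ℝ, 𝔼) (𝓡 n) (extChartAt (𝓡 n) q₀).symm (f t) ((1 : ℝ) • Y (f t) (w t))
      rw [one_smul, one_smul, h6]
      exact h5.symm
    exact Eq.mpr (congrArg (fun D : ℝ →L[ℝ] 𝔼 => HasMFDerivAt 𝓘(ℝ, ℝ) (𝓡 n)
      (fun t => (extChartAt (𝓡 n) q₀).symm (f t)) t D) h7) h3

/-- Changing the curve outside [a, b], or the control at the two end points, affects the velocity
equation only on a null set. The freedom at the end points allows controls cut off by open intervals
to be glued. -/
theorem IsTrajectoryOn.congr {w w' : ℝ → 𝔸} {σ σ' : ℝ → M} {a b : ℝ}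
    (h : IsTrajectoryOn X w σ a b) (hσ : EqOn σ' σ (Icc a b)) (hw : ∀ t ∈ Ioo a b, w' t = w t) :
    IsTrajectoryOn X w' σ' a b := by
  have hne : ∀ c : ℝ, ∀ᵐ x : ℝ ∂volume.restrict (Icc a b), x ≠ c := fun c =>
    ae_restrict_of_ae (by simp [ae_iff, measure_singleton])
  refine ⟨⟨h.absCont.1.congr hσ, fun t ht => ?_⟩, ?_⟩
  · obtain ⟨ε, hε, h1, h2⟩ := h.absCont.2 t ht
    have hsub : Icc (max a (t - ε)) (min b (t + ε)) ⊆ Icc a b :=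
      Icc_subset_Icc (le_max_left _ _) (min_le_left _ _)
    have hle : max a (t - ε) ≤ min b (t + ε) :=
      max_le (le_min (ht.1.trans ht.2) (by linarith [ht.1])) (le_min (by linarith [ht.2])
        (by linarith))
    rw [hσ ht]
    refine ⟨ε, hε, h1.congr (hσ.mono hsub).symm, ?_⟩
    refine absolutelyContinuousOnInterval_of_dist_le (C := 1) (D := 0) h2 h2 fun x hx y hy => ?_
    rw [uIcc_of_le hle] at hx hy
    rw [hσ (hsub hx), hσ (hsub hy)]
    simp
  · filter_upwards [h.deriv, hne a, hne b, ae_restrict_mem measurableSet_Icc] with t ht ha hb hm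
    have hI : t ∈ Ioo a b := ⟨lt_of_le_of_ne hm.1 (Ne.symm ha), lt_of_le_of_ne hm.2 hb⟩
    have hev : σ' =ᶠ[𝓝 t] σ := by
      filter_upwards [Ioo_mem_nhds hI.1 hI.2] with s hs using hσ (Ioo_subset_Icc_self hs)
    have h2 := ht.congr_of_eventuallyEq hev
    have h3 : ∀ q', q' = σ t → (combination X q' (w t) : 𝔼) = combination X (σ t) (w t) := by
      rintro _ rfl; rfl
    have h4 : ((1 : ℝ →L[ℝ] ℝ).smulRight (combination X (σ' t) (w' t) : 𝔼) : ℝ →L[ℝ] 𝔼) =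
        (1 : ℝ →L[ℝ] ℝ).smulRight (combination X (σ t) (w t) : 𝔼) := by
      rw [hw t hI]
      exact congrArg _ (h3 _ (hσ hm))
    exact Eq.mpr (congrArg (fun D : ℝ →L[ℝ] 𝔼 => HasMFDerivAt 𝓘(ℝ, ℝ) (𝓡 n) σ' t D) h4) h2

theorem ae_restrict_Icc_union {P : ℝ → Prop} {a b c : ℝ} (hab : a ≤ b) (hbc : b ≤ c)
    (h1 : ∀ᵐ t ∂volume.restrict (Icc a b), P t) (h2 : ∀ᵐ t ∂volume.restrict (Icc b c), P t) :
    ∀ᵐ t ∂volume.restrict (Icc a c), P t := by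
  rw [← Icc_union_Icc_eq_Icc hab hbc, ae_restrict_union_iff]
  exact ⟨h1, h2⟩

/-- Only absolute continuity across the junction needs an argument: in a chart, both pieces are
integrals of the same integrable derivative. -/
theorem IsTrajectoryOn.trans (hX : SmoothFields X) {w : ℝ → 𝔸} {σ : ℝ → M} {a b c : ℝ}
    (hab : a ≤ b) (hbc : b ≤ c) (hw : IntervalIntegrable w volume a c)
    (h1 : IsTrajectoryOn X w σ a b) (h2 : IsTrajectoryOn X w σ b c) :
    IsTrajectoryOn X w σ a c := by
  have hac := hab.trans hbc
  have hc : ContinuousOn σ (Icc a c) := by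
    rw [← Icc_union_Icc_eq_Icc hab hbc]
    exact h1.absCont.1.union_of_isClosed h2.absCont.1 isClosed_Icc isClosed_Icc
  have hd := ae_restrict_Icc_union hab hbc h1.deriv h2.deriv
  refine ⟨absContCurve_of_exists hc fun t ht => ?_, hd⟩
  have A1 : ∃ ε > 0, ∀ x y, x ∈ Icc a b → y ∈ Icc a b → t - ε < x → x ≤ y → y < t + ε →
      AbsolutelyContinuousOnInterval (fun s => extChartAt (𝓡 n) (σ t) (σ s)) x y := by
    rcases le_or_gt t b with h | h
    · exact h1.absCont.exists_comp ⟨ht.1, h⟩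
        (contMDiffAt_extChartAt_of_mem (mem_extChartAt_source _))
    -- For t > b this radius makes the condition vacuous.
    · exact ⟨t - b, by linarith, fun x y hx _ h3 _ _ => by linarith [hx.2]⟩
  have A2 : ∃ ε > 0, ∀ x y, x ∈ Icc b c → y ∈ Icc b c → t - ε < x → x ≤ y → y < t + ε →
      AbsolutelyContinuousOnInterval (fun s => extChartAt (𝓡 n) (σ t) (σ s)) x y := by
    rcases le_or_gt b t with h | h
    · exact h2.absCont.exists_comp ⟨h, ht.2⟩
        (contMDiffAt_extChartAt_of_mem (mem_extChartAt_source _))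
    · exact ⟨b - t, by linarith, fun x y _ hy _ _ h3 => by linarith [hy.1]⟩
  obtain ⟨ε₁, hε₁, A1⟩ := A1
  obtain ⟨ε₂, hε₂, A2⟩ := A2
  obtain ⟨Y, L, r, hY⟩ := exists_isChartModel hX (σ t)
  have hev := (hc t ht).eventually_mem
    ((isOpen_chartNhd (n := n) (σ t) r).mem_nhds (mem_chartNhd_self _ hY.pos))
  rw [eventually_nhdsWithin_iff] at hev
  obtain ⟨ε₃, hε₃, h3⟩ := Metric.eventually_nhds_iff.1 hev
  refine ⟨min ε₁ (min ε₂ ε₃), lt_min hε₁ (lt_min hε₂ hε₃), fun x y hx hy k1 k2 k3 => ?_⟩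
  have m1 := min_le_left ε₁ (min ε₂ ε₃)
  have m2 := (min_le_right ε₁ (min ε₂ ε₃)).trans (min_le_left _ _)
  have m3 := (min_le_right ε₁ (min ε₂ ε₃)).trans (min_le_right _ _)
  rcases le_total y b with hyb | hyb
  · exact A1 x y ⟨hx.1, k2.trans hyb⟩ ⟨hy.1, hyb⟩ (by linarith) k2 (by linarith)
  rcases le_total b x with hbx | hbx
  · exact A2 x y ⟨hbx, hx.2⟩ ⟨hyb, hy.2⟩ (by linarith) k2 (by linarith)
  have hxy : Icc x y ⊆ Icc a c := Icc_subset_Icc hx.1 hy.2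
  have hmem : ∀ s ∈ Icc x y, σ s ∈ chartNhd n (σ t) r := fun s hs => by
    refine h3 ?_ (hxy hs)
    rw [Real.dist_eq, abs_lt]; constructor <;> linarith [hs.1, hs.2]
  have hc' : ContinuousOn (fun s => extChartAt (𝓡 n) (σ t) (σ s)) (Icc x y) :=
    (continuousOn_extChartAt (σ t)).comp (hc.mono hxy) fun s hs => (hmem s hs).1
  refine AbsolutelyContinuousOnInterval.trans
    (g := fun s => Y (extChartAt (𝓡 n) (σ t) (σ s)) (w s)) hbx hyb
    (hY.bounded.intervalIntegrable k2 hc' (hw.mono_set ?_))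
    (A1 x b ⟨hx.1, hbx⟩ ⟨hab, le_rfl⟩ (by linarith) hbx (by linarith))
    (A2 b y ⟨le_rfl, hbc⟩ ⟨hyb, hy.2⟩ (by linarith) hyb (by linarith)) ?_
  · rwa [uIcc_of_le k2, uIcc_of_le hac]
  · filter_upwards [ae_mono (Measure.restrict_mono hxy le_rfl) hd,
      ae_restrict_mem measurableSet_Icc] with s hs hsm
    rw [hY.apply (hmem s hsm)]
    exact hasDerivAt_comp_of_hasMFDerivAt hs (mdifferentiableAt_extChartAt_of_mem (hmem s hsm).1)

/-- Concatenation of trajectories. -/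
theorem IsTrajectoryOn.exists_concat (hX : SmoothFields X) {w : ℝ → 𝔸} {σ₁ σ₂ : ℝ → M} {a b c : ℝ}
    (hab : a ≤ b) (hbc : b ≤ c) (hw : IntervalIntegrable w volume a c)
    (h1 : IsTrajectoryOn X w σ₁ a b) (h2 : IsTrajectoryOn X w σ₂ b c) (h : σ₁ b = σ₂ b) :
    ∃ σ, IsTrajectoryOn X w σ a c ∧ σ a = σ₁ a ∧ σ c = σ₂ c := by
  classical
  have e1 : EqOn (fun t => if t ≤ b then σ₁ t else σ₂ t) σ₁ (Icc a b) := fun t ht => if_pos ht.2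
  have e2 : EqOn (fun t => if t ≤ b then σ₁ t else σ₂ t) σ₂ (Icc b c) := fun t ht => by
    by_cases htb : t ≤ b
    · have : t = b := le_antisymm htb ht.1
      subst this
      simp [h]
    · simp [htb]
  exact ⟨_, (h1.congr e1 fun _ _ => rfl).trans hX hab hbc hw (h2.congr e2 fun _ _ => rfl),
    e1 ⟨le_rfl, hab⟩, e2 ⟨hbc, le_rfl⟩⟩

end Trajectories

end SubRiem

/-! ### Uniqueness and first-order perturbation of trajectories on the manifold. -/

namespace SubRiem

open Filter Topology

set_option linter.unusedSectionVars false

section Perturbations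

variable {n d : ℕ} {M : Type*} [TopologicalSpace M] [ChartedSpace (EuclideanSpace ℝ (Fin n)) M]
  [IsManifold (𝓡 n) ∞ M]

local notation "𝔼" => EuclideanSpace ℝ (Fin n)
local notation "𝔸" => EuclideanSpace ℝ (Fin d)

variable {X : Fin d → (q : M) → TangentSpace (𝓡 n) q}
  {Y : EuclideanSpace ℝ (Fin n) → EuclideanSpace ℝ (Fin d) →L[ℝ] EuclideanSpace ℝ (Fin n)}

theorem hasDerivAt_zero_of_isLittleO {V : Type*} [NormedAddCommGroup V] [NormedSpace ℝ V]
    {f : ℝ → V} {ρ : ℝ → ℝ} (hρ : ρ =o[𝓝 0] fun s : ℝ => s)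
    (h : ∀ᶠ s in 𝓝 0, ‖f s - f 0‖ ≤ ρ s) : HasDerivAt f 0 0 := by
  rw [hasDerivAt_iff_isLittleO]
  simp only [sub_zero, smul_zero]
  refine Asymptotics.IsBigO.trans_isLittleO (Asymptotics.IsBigO.of_bound 1 ?_) hρ
  filter_upwards [h] with s hs
  rw [one_mul]
  exact hs.trans (le_abs_self _)

/-- Near any time, a trajectory lies in the domain of a chart and its control is small. -/
theorem exists_chart_interval {γ : ℝ → M} {w : ℝ → 𝔸} {a b t₀ : ℝ} (hγ : ContinuousOn γ (Icc a b))
    (hw : IntervalIntegrable w volume a b) (ht₀ : t₀ ∈ Icc a b) (L : ℝ) {U : Set M}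
    (hU : U ∈ 𝓝 (γ t₀)) :
    ∃ ε > 0, ∀ r s, r ∈ Icc a b → s ∈ Icc a b → t₀ - ε < r → r ≤ s → s < t₀ + ε →
      (∀ t ∈ Icc r s, γ t ∈ U) ∧ L * ∫ t in r..s, ‖w t‖ ≤ 1 / 2 := by
  have hab : a ≤ b := ht₀.1.trans ht₀.2
  have h1 := (hγ t₀ ht₀).eventually_mem hU
  have hG := (absolutelyContinuousOnInterval_integral hw.norm left_mem_uIcc).continuousOn
  rw [uIcc_of_le hab] at hG
  -- Two radii 1/(4(|L| + 1)), one for each end of the interval, add up to a bound 1/2 after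
  -- multiplication by L.
  have h2 := (hG t₀ ht₀).eventually (Metric.ball_mem_nhds _
    (show 0 < 1 / (4 * (|L| + 1)) by positivity))
  rw [eventually_nhdsWithin_iff] at h1 h2
  obtain ⟨ε, hε, h⟩ := Metric.eventually_nhds_iff.1 (h1.and h2)
  refine ⟨ε, hε, fun r s hr hs k1 k2 k3 => ?_⟩
  have hd : ∀ t ∈ Icc r s, dist t t₀ < ε := fun t ht => by
    rw [Real.dist_eq, abs_lt]; constructor <;> linarith [ht.1, ht.2]
  refine ⟨fun t ht => (h (hd t ht)).1 ⟨hr.1.trans ht.1, ht.2.trans hs.2⟩, ?_⟩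
  have i1 := (h (hd r ⟨le_rfl, k2⟩)).2 hr
  have i2 := (h (hd s ⟨k2, le_rfl⟩)).2 hs
  rw [dist_comm] at i1
  have i3 := (dist_triangle _ _ _).trans_lt (add_lt_add i2 i1)
  have hi : ∀ t ∈ Icc a b, IntervalIntegrable (fun x => ‖w x‖) volume a t := fun t ht =>
    hw.norm.mono_set (uIcc_subset_uIcc_left (by rwa [uIcc_of_le hab]))
  rw [Real.dist_eq, intervalIntegral.integral_interval_sub_left (hi s hs) (hi r hr)] at i3
  have i4 : 0 ≤ ∫ t in r..s, ‖w t‖ :=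
    intervalIntegral.integral_nonneg k2 fun _ _ => norm_nonneg _
  rw [abs_of_nonneg i4] at i3
  calc L * ∫ t in r..s, ‖w t‖ ≤ (|L| + 1) * ∫ t in r..s, ‖w t‖ := by
        gcongr; linarith [le_abs_self L]
    _ ≤ (|L| + 1) * (1 / (4 * (|L| + 1)) + 1 / (4 * (|L| + 1))) := by gcongr
    _ = 1 / 2 := by field_simp; norm_num

/-- Trajectories are determined by their control and their starting point. -/
theorem IsTrajectoryOn.eq_right [T2Space M] (hX : SmoothFields X) {w : ℝ → 𝔸} {σ τ : ℝ → M}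
    {a b : ℝ} (hab : a ≤ b) (hw : IntervalIntegrable w volume a b)
    (hσ : IsTrajectoryOn X w σ a b) (hτ : IsTrajectoryOn X w τ a b) (h : σ a = τ a) :
    σ b = τ b := by
  refine relation_of_locally (R := fun s t => σ s = τ s → σ t = τ t) hab (fun t _ h => h)
    (fun r s t _ _ _ _ h1 h2 h => h2 (h1 h)) (fun t ht => ?_) h
  by_cases heq : σ t = τ t
  · obtain ⟨Y, L, ρ, hY⟩ := exists_isChartModel hX (σ t)
    have hU : chartNhd n (σ t) ρ ∈ 𝓝 (σ t) :=
      (isOpen_chartNhd _ _).mem_nhds (mem_chartNhd_self _ hY.pos)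
    obtain ⟨ε₁, hε₁, h1⟩ := exists_chart_interval hσ.absCont.1 hw ht L hU
    obtain ⟨ε₂, hε₂, h2⟩ := exists_chart_interval hτ.absCont.1 hw ht L
      (show chartNhd n (σ t) ρ ∈ 𝓝 (τ t) by rw [← heq]; exact hU)
    refine ⟨min ε₁ ε₂, lt_min hε₁ hε₂, fun r s hr hs k1 k2 k3 hrs => ?_⟩
    have m1 := min_le_left ε₁ ε₂
    have m2 := min_le_right ε₁ ε₂
    obtain ⟨j1, hK⟩ := h1 r s hr hs (by linarith) k2 (by linarith)
    obtain ⟨j2, -⟩ := h2 r s hr hs (by linarith) k2 (by linarith)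
    have hw' : IntervalIntegrable w volume r s := hw.mono_set (by
      rw [uIcc_of_le k2, uIcc_of_le hab]; exact Icc_subset_Icc hr.1 hs.2)
    have := IsSol.unique hY.bounded k2 hw' hK ((hσ.mono hr.1 k2 hs.2).isSol hY k2 hw' j1)
      ((hτ.mono hr.1 k2 hs.2).isSol hY k2 hw' j2) (congrArg _ hrs) ⟨k2, le_rfl⟩
    exact (extChartAt (𝓡 n) (σ t)).injOn (j1 s ⟨k2, le_rfl⟩).1 (j2 s ⟨k2, le_rfl⟩).1 this
  -- If the curves differ at t, the Hausdorff property keeps them apart near t, so the implication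
  -- to be propagated has a false premise there.
  · obtain ⟨U, V, hU, hV, hσU, hτV, hUV⟩ := t2_separation heq
    obtain ⟨ε₁, hε₁, h1⟩ := exists_chart_interval hσ.absCont.1 hw ht 0 (hU.mem_nhds hσU)
    obtain ⟨ε₂, hε₂, h2⟩ := exists_chart_interval hτ.absCont.1 hw ht 0 (hV.mem_nhds hτV)
    refine ⟨min ε₁ ε₂, lt_min hε₁ hε₂, fun r s hr hs k1 k2 k3 hrs => ?_⟩
    have m1 := min_le_left ε₁ ε₂
    have m2 := min_le_right ε₁ ε₂
    have j1 := (h1 r s hr hs (by linarith) k2 (by linarith)).1 r ⟨le_rfl, k2⟩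
    have j2 := (h2 r s hr hs (by linarith) k2 (by linarith)).1 r ⟨le_rfl, k2⟩
    exact absurd (hrs ▸ j2) (disjoint_left.1 hUV j1)

/-- The curve `c` has zero velocity at time `0`. -/
def IsStationary (n : ℕ) {M : Type*} [TopologicalSpace M]
    [ChartedSpace (EuclideanSpace ℝ (Fin n)) M] (c : ℝ → M) : Prop :=
  HasMFDerivAt 𝓘(ℝ, ℝ) (𝓡 n) c 0 (0 : ℝ →L[ℝ] EuclideanSpace ℝ (Fin n))

/-- If a curve of initial points has zero velocity and the linearised equation has a solution that
vanishes at both ends, then the curve of end points has zero velocity. -/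
theorem IsTrajectoryOn.exists_perturbation {q₀ : M} {L r : ℝ} (hY : IsChartModel X q₀ Y L r)
    {w v : ℝ → 𝔸} {γ : ℝ → M} {ξ : ℝ → 𝔼} {a b : ℝ} (hab : a ≤ b)
    (hw : IntervalIntegrable w volume a b) (hv : IntervalIntegrable v volume a b)
    (hK : L * ∫ t in a..b, ‖w t‖ ≤ 1 / 2) (hγ : IsTrajectoryOn X w γ a b)
    (hm : ∀ t ∈ Icc a b, γ t ∈ chartNhd n q₀ r)
    (hξ : IsLinearised Y w (fun t => extChartAt (𝓡 n) q₀ (γ t)) v ξ a b) (hξa : ξ a = 0)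
    (hξb : ξ b = 0) {c : ℝ → M} (hc0 : c 0 = γ a) (hc : IsStationary n c) :
    ∃ e : ℝ → M, e 0 = γ b ∧ IsStationary n e ∧ ∀ᶠ s in 𝓝 (0 : ℝ), ∃ σ,
      IsTrajectoryOn X (fun t => w t + s • v t) σ a b ∧ σ a = c s ∧ σ b = e s := by
  have : IsManifold (𝓡 n) 1 M := isManifold_one
  set φ := extChartAt (𝓡 n) q₀ with hφ
  set f : ℝ → 𝔼 := fun t => φ (γ t) with hf
  have ha : a ∈ Icc a b := ⟨le_rfl, hab⟩
  have hb : b ∈ Icc a b := ⟨hab, le_rfl⟩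
  have hsol := hγ.isSol hY hab hw hm
  have hcsrc : c 0 ∈ φ.source := hc0 ▸ (hm a ha).1
  have hcd : HasDerivAt (fun s => φ (c s)) 0 0 := by
    have h1 : HasMFDerivAt 𝓘(ℝ, ℝ) (𝓡 n) c 0
        ((1 : ℝ →L[ℝ] ℝ).smulRight (0 : TangentSpace (𝓡 n) (c 0))) := by
      rw [ContinuousLinearMap.smulRight_zero]; exact hc
    have := hasDerivAt_comp_of_hasMFDerivAt h1 (mdifferentiableAt_extChartAt_of_mem hcsrc)
    rwa [map_zero] at this
  have hco : (fun s => φ (c s) - f a - s • ξ a) =o[𝓝 0] fun s : ℝ => s := by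
    rw [hasDerivAt_iff_isLittleO] at hcd
    simpa [hξa, hc0, hf] using hcd
  obtain ⟨σ, ρ, hρ, hσ⟩ := exists_perturbed_solutions hY.bounded hab hw hv hK hsol hξ hco
  have hρ0 : ρ 0 = 0 := by
    have := (hρ.def one_pos).self_of_nhds
    simpa using this
  have hσ0 : ∀ t ∈ Icc a b, σ 0 t = f t := fun t ht => by
    have := hσ.self_of_nhds.2.2 t ht
    rw [hρ0, zero_smul, sub_zero] at this
    exact sub_eq_zero.1 (norm_le_zero_iff.1 this)
  have hder : HasDerivAt (fun s => σ s b) 0 0 := by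
    refine hasDerivAt_zero_of_isLittleO hρ ?_
    filter_upwards [hσ] with s hs
    have : ‖σ s b - f b - s • ξ b‖ ≤ ρ s := hs.2.2 b hb
    rwa [hξb, smul_zero, sub_zero, ← hσ0 b hb] at this
  have hsymm : MDifferentiableAt 𝓘(ℝ, 𝔼) (𝓡 n) φ.symm (σ 0 b) := by
    rw [hσ0 b hb]
    exact ((contMDiffOn_extChartAt_symm (n := 1) q₀).contMDiffAt
      ((isOpen_extChartAt_target q₀).mem_nhds
        (hY.subset (hm b hb).2))).mdifferentiableAt one_ne_zero
  refine ⟨fun s => φ.symm (σ s b), ?_, ?_, ?_⟩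
  · change φ.symm (σ 0 b) = γ b
    rw [hσ0 b hb]; exact φ.left_inv (hm b hb).1
  · have h2 : HasMFDerivAt 𝓘(ℝ, ℝ) 𝓘(ℝ, 𝔼) (fun s => σ s b) 0 (0 : ℝ →L[ℝ] 𝔼) := by
      have := hder.hasFDerivAt.hasMFDerivAt
      rwa [ContinuousLinearMap.toSpanSingleton_zero] at this
    have h3 := HasMFDerivAt.comp (0 : ℝ) hsymm.hasMFDerivAt h2
    have h4 : (mfderiv 𝓘(ℝ, 𝔼) (𝓡 n) φ.symm (σ 0 b) : 𝔼 →L[ℝ] 𝔼).comp (0 : ℝ →L[ℝ] 𝔼) = 0 :=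
      ContinuousLinearMap.comp_zero _
    exact Eq.mp (congrArg (fun D : ℝ →L[ℝ] 𝔼 => HasMFDerivAt 𝓘(ℝ, ℝ) (𝓡 n)
      (fun s => φ.symm (σ s b)) 0 D) h4) h3
  -- By compactness the perturbed coordinate curves stay, for small s, in the ball where Y
  -- represents the system, so they come from trajectories on M.
  · have hcomp : IsCompact (f '' Icc a b) := isCompact_Icc.image_of_continuousOn hsol.continuousOn
    obtain ⟨δ, hδ, hsub⟩ := hcomp.exists_thickening_subset_open Metric.isOpen_ball
      (show f '' Icc a b ⊆ Metric.ball (extChartAt (𝓡 n) q₀ q₀) r by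
        rintro _ ⟨t, ht, rfl⟩; exact (hm t ht).2)
    obtain ⟨B, hB⟩ := isCompact_Icc.exists_bound_of_continuousOn hξ.continuousOn
    have hsmall : ∀ᶠ s in 𝓝 (0 : ℝ), ρ s + |s| * B < δ := by
      have t1 : Tendsto ρ (𝓝 0) (𝓝 0) := hρ.trans_tendsto tendsto_id
      have t2 : Tendsto (fun s : ℝ => ρ s + |s| * B) (𝓝 0) (𝓝 (0 + |0| * B)) :=
        t1.add (tendsto_id.abs.mul_const B)
      rw [abs_zero, zero_mul, add_zero] at t2
      exact t2.eventually_lt_const hδ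
    have hcs : ∀ᶠ s in 𝓝 (0 : ℝ), c s ∈ φ.source :=
      hc.1.eventually_mem ((isOpen_extChartAt_source q₀).mem_nhds hcsrc)
    filter_upwards [hσ, hsmall, hcs] with s hs hsm hcs
    refine ⟨fun t => φ.symm (σ s t), hY.isTrajectoryOn hab
      (hw.add (hv.smul s)) hs.1 fun t ht => hsub ?_, ?_, rfl⟩
    · rw [Metric.mem_thickening_iff]
      refine ⟨f t, ⟨t, ht, rfl⟩, ?_⟩
      rw [dist_eq_norm]
      calc ‖σ s t - f t‖ = ‖(σ s t - f t - s • ξ t) + s • ξ t‖ := by rw [sub_add_cancel]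
        _ ≤ ρ s + |s| * B := (norm_add_le _ _).trans (add_le_add (hs.2.2 t ht) (by
            rw [norm_smul, Real.norm_eq_abs]; gcongr; exact hB t ht))
        _ < δ := hsm
    · change φ.symm (σ s a) = c s
      rw [hs.2.1]; exact φ.left_inv hcs

theorem isTrajectoryOn_self (w : ℝ → 𝔸) (q : M) (a : ℝ) :
    IsTrajectoryOn X w (fun _ => q) a a := by
  refine ⟨absContCurve_of_exists continuousOn_const fun t _ => ⟨1, one_pos, fun x y _ _ _ _ _ =>
    (LipschitzWith.const' (K := 0) _).lipschitzOnWith.absolutelyContinuousOnInterval⟩, ?_⟩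
  rw [Icc_self, Measure.restrict_singleton, Real.volume_singleton, zero_smul, ae_zero]
  exact eventually_bot

/-- Propagation of a first-order stationary perturbation along a trajectory. -/
theorem IsTrajectoryOn.exists_propagation (hX : SmoothFields X) {w : ℝ → 𝔸} {γ : ℝ → M} {a b : ℝ}
    (hab : a ≤ b) (hw : IntervalIntegrable w volume a b) (hγ : IsTrajectoryOn X w γ a b)
    {c : ℝ → M} (hc0 : c 0 = γ a) (hc : IsStationary n c) :
    ∃ e : ℝ → M, e 0 = γ b ∧ IsStationary n e ∧ ∀ᶠ s in 𝓝 (0 : ℝ), ∃ σ,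
      IsTrajectoryOn X w σ a b ∧ σ a = c s ∧ σ b = e s := by
  have hsubw : ∀ x y, a ≤ x → x ≤ y → y ≤ b → IntervalIntegrable w volume x y :=
    fun x y h1 h2 h3 => hw.mono_set (by
      rw [uIcc_of_le h2, uIcc_of_le hab]; exact Icc_subset_Icc h1 h3)
  refine relation_of_locally (R := fun a b => ∀ c : ℝ → M, c 0 = γ a → IsStationary n c →
    ∃ e : ℝ → M, e 0 = γ b ∧ IsStationary n e ∧ ∀ᶠ s in 𝓝 (0 : ℝ), ∃ σ,
      IsTrajectoryOn X w σ a b ∧ σ a = c s ∧ σ b = e s) hab (fun t _ c h1 h2 =>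
        ⟨c, h1, h2, Eventually.of_forall fun s => ⟨_, isTrajectoryOn_self w (c s) t, rfl, rfl⟩⟩)
    (fun x y z hx hxy hyz hz h1 h2 c hc0 hc => ?_) (fun t ht => ?_) c hc0 hc
  · obtain ⟨e, he0, he, h3⟩ := h1 c hc0 hc
    obtain ⟨e', he0', he', h4⟩ := h2 e he0 he
    refine ⟨e', he0', he', ?_⟩
    filter_upwards [h3, h4] with s ⟨σ, k1, k2, k3⟩ ⟨σ', k1', k2', k3'⟩
    obtain ⟨τ, j1, j2, j3⟩ := k1.exists_concat hX hxy hyz (hsubw _ _ hx (hxy.trans hyz) hz) k1'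
      (k3.trans k2'.symm)
    exact ⟨τ, j1, j2.trans k2, j3.trans k3'⟩
  · obtain ⟨Y, L, ρ, hY⟩ := exists_isChartModel hX (γ t)
    obtain ⟨ε, hε, h⟩ := exists_chart_interval hγ.absCont.1 hw ht L
      ((isOpen_chartNhd (n := n) (γ t) ρ).mem_nhds (mem_chartNhd_self _ hY.pos))
    refine ⟨ε, hε, fun x y hx hy k1 k2 k3 c hc0 hc => ?_⟩
    obtain ⟨hm, hK⟩ := h x y hx hy k1 k2 k3
    -- With v = 0 and ξ = 0 only the starting point is perturbed, and only to higher order.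
    obtain ⟨e, he0, he, h2⟩ := (hγ.mono hx.1 k2 hy.2).exists_perturbation hY (v := 0) (ξ := 0) k2
      (hsubw _ _ hx.1 k2 hy.2) (continuous_zero.intervalIntegrable _ _) hK hm
      ⟨continuousOn_const, fun t _ => by simp⟩ rfl rfl hc0 hc
    refine ⟨e, he0, he, ?_⟩
    simpa using h2

/-- A variation of the control on a short interval, along which the linearised equation has a
solution vanishing at both ends, does not move the end point to first order. -/
theorem IsTrajectoryOn.exists_stationary_endpoint (hX : SmoothFields X) {q₀ : M} {L r : ℝ}
    (hY : IsChartModel X q₀ Y L r) {w v : ℝ → 𝔸} {γ : ℝ → M} {ξ : ℝ → 𝔼} {a b a' b' : ℝ}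
    (haa' : a ≤ a') (hab' : a' ≤ b') (hbb' : b' ≤ b) (hw : IntervalIntegrable w volume a b)
    (hv : Continuous v) (hK : L * ∫ t in a'..b', ‖w t‖ ≤ 1 / 2)
    (hγ : IsTrajectoryOn X w γ a b) (hm : ∀ t ∈ Icc a' b', γ t ∈ chartNhd n q₀ r)
    (hξ : IsLinearised Y w (fun t => extChartAt (𝓡 n) q₀ (γ t)) v ξ a' b') (hξa : ξ a' = 0)
    (hξb : ξ b' = 0) :
    ∃ e : ℝ → M, e 0 = γ b ∧ IsStationary n e ∧ ∀ᶠ s in 𝓝 (0 : ℝ), ∃ σ,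
      IsTrajectoryOn X (fun t => w t + s • (Ioo a' b').indicator v t) σ a b ∧
        σ a = γ a ∧ σ b = e s := by
  have hab : a ≤ b := haa'.trans (hab'.trans hbb')
  have hsubw : ∀ x y, a ≤ x → x ≤ y → y ≤ b → IntervalIntegrable w volume x y :=
    fun x y h1 h2 h3 => hw.mono_set (by
      rw [uIcc_of_le h2, uIcc_of_le hab]; exact Icc_subset_Icc h1 h3)
  obtain ⟨e, he0, he, h1⟩ := (hγ.mono haa' hab' hbb').exists_perturbation hY hab'
    (hsubw _ _ haa' hab' hbb') (hv.intervalIntegrable _ _) hK hm hξ hξa hξb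
    (c := fun _ => γ a') rfl (hasMFDerivAt_const (γ a') 0)
  obtain ⟨e', he0', he', h2⟩ := (hγ.mono (haa'.trans hab') hbb' le_rfl).exists_propagation hX hbb'
    (hsubw _ _ (haa'.trans hab') hbb' le_rfl) he0 he
  refine ⟨e', he0', he', ?_⟩
  filter_upwards [h1, h2] with s ⟨σ, k1, k2, k3⟩ ⟨σ', k1', k2', k3'⟩
  have hwi : IntervalIntegrable (fun t => w t + s • (Ioo a' b').indicator v t) volume a b := by
    have hv' : IntervalIntegrable ((Ioo a' b').indicator v) volume a b := by
      rw [intervalIntegrable_iff_integrableOn_Ioc_of_le hab]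
      exact ((hv.intervalIntegrable a b).1).indicator measurableSet_Ioo
    exact hw.add (hv'.smul s)
  -- The perturbed trajectory has three pieces: γ itself before a', the perturbed solution on [a',
  -- b'], and the propagation under the original control after b'.
  have j1 : IsTrajectoryOn X (fun t => w t + s • (Ioo a' b').indicator v t) γ a a' :=
    (hγ.mono le_rfl haa' (hab'.trans hbb')).congr (fun _ _ => rfl) fun t ht => by
      rw [indicator_of_notMem fun h => absurd h.1 (not_lt.2 ht.2.le), smul_zero, add_zero]
  have j2 : IsTrajectoryOn X (fun t => w t + s • (Ioo a' b').indicator v t) σ a' b' :=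
    k1.congr (fun _ _ => rfl) fun t ht => by rw [indicator_of_mem ht]
  have j3 : IsTrajectoryOn X (fun t => w t + s • (Ioo a' b').indicator v t) σ' b' b :=
    k1'.congr (fun _ _ => rfl) fun t ht => by
      rw [indicator_of_notMem fun h => absurd h.2 (not_lt.2 ht.1.le), smul_zero, add_zero]
  obtain ⟨τ, l1, l2, l3⟩ := j2.exists_concat hX hab' hbb' (hwi.mono_set (by
    rw [uIcc_of_le (hab'.trans hbb'), uIcc_of_le hab]; exact Icc_subset_Icc_left haa'))
    j3 (k3.trans k2'.symm)
  obtain ⟨τ', m1, m2, m3⟩ := j1.exists_concat hX haa' (hab'.trans hbb') hwi l1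
    (k2.symm.trans l2.symm)
  exact ⟨τ', m1, m2, m3.trans (l3.trans k3')⟩

end Perturbations

end SubRiem

/-! ### Critical controls are normal extremals. -/

namespace SubRiem

open Filter Topology
open scoped BoundedContinuousFunction

set_option linter.unusedSectionVars false

section Critical

variable {n d : ℕ} {M : Type*} [TopologicalSpace M] [ChartedSpace (EuclideanSpace ℝ (Fin n)) M]
  [IsManifold (𝓡 n) ∞ M] {X : Fin d → (q : M) → TangentSpace (𝓡 n) q} {p : ℝ≥0∞} {x y : M}

local notation "𝔼" => EuclideanSpace ℝ (Fin n)
local notation "𝔸" => EuclideanSpace ℝ (Fin d)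

theorem intervalIntegrable_control (hp : 1 ≤ p) (u : Control d p) :
    IntervalIntegrable u volume 0 1 := by
  rw [intervalIntegrable_iff_integrableOn_Icc_of_le zero_le_one]
  exact (Lp.memLp u).integrable hp

theorem IsTrajectory.isTrajectoryOn {u : Control d p} {γ : ℝ → M} (h : IsTrajectory X x u γ) :
    IsTrajectoryOn X u γ 0 1 := ⟨h.absCont, h.deriv⟩

/-- `endpoint` is defined by choosing a trajectory; uniqueness makes the choice irrelevant. -/
theorem endpoint_eq [T2Space M] (hX : SmoothFields X) (hp : 1 ≤ p) {u : Control d p} {γ : ℝ → M}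
    (hγ : IsTrajectory X x u γ) : endpoint X x u = γ 1 := by
  have h : ∃ γ, IsTrajectory X x u γ := ⟨γ, hγ⟩
  have e : endpoint X x u = h.choose 1 := dif_pos h
  rw [e]
  exact h.choose_spec.isTrajectoryOn.eq_right hX zero_le_one (intervalIntegrable_control hp u)
    hγ.isTrajectoryOn (h.choose_spec.start.trans hγ.start.symm)

/-- If F is differentiable at u this is the chain rule along the line u + s • v. If not, `mfderiv`
is zero by convention, so differentiability of the endpoint map need not be established. -/
theorem mfderiv_apply_eq_zero_of_isStationary {V : Type*} [NormedAddCommGroup V] [NormedSpace ℝ V]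
    {F : V → M} {u v : V} {e : ℝ → M} (he : IsStationary n e)
    (h : ∀ᶠ s in 𝓝 (0 : ℝ), F (u + s • v) = e s) :
    mfderiv 𝓘(ℝ, V) (𝓡 n) F u v = 0 := by
  by_cases hF : MDifferentiableAt 𝓘(ℝ, V) (𝓡 n) F u
  · have hl : HasDerivAt (fun s : ℝ => u + s • v) v 0 := by
      simpa using ((hasDerivAt_id (0 : ℝ)).smul_const v).const_add u
    have h0 : u + (0 : ℝ) • v = u := by simp
    have h1 : HasMFDerivAt 𝓘(ℝ, V) (𝓡 n) F (u + (0 : ℝ) • v)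
        (mfderiv 𝓘(ℝ, V) (𝓡 n) F u : V →L[ℝ] 𝔼) := by
      rw [h0]; exact hF.hasMFDerivAt
    have h2 : HasMFDerivAt 𝓘(ℝ, ℝ) (𝓡 n) (fun s : ℝ => F (u + s • v)) 0
        ((mfderiv 𝓘(ℝ, V) (𝓡 n) F u : V →L[ℝ] 𝔼).comp (ContinuousLinearMap.toSpanSingleton ℝ v)) :=
      HasMFDerivAt.comp (0 : ℝ) h1 hl.hasFDerivAt.hasMFDerivAt
    have h3 := HasMFDerivAt.congr_of_eventuallyEq he h
    have h4 := hasMFDerivAt_unique h2 h3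
    have h5 := congrArg (fun D : ℝ →L[ℝ] 𝔼 => D 1) h4
    change (mfderiv 𝓘(ℝ, V) (𝓡 n) F u : V →L[ℝ] 𝔼) ((1 : ℝ) • v) = 0 at h5
    rwa [one_smul] at h5
  · rw [mfderiv_zero_of_not_mdifferentiableAt hF]
    rfl

variable [Fact (1 ≤ p)]

/-- The gradient of the energy pairs with a control supported in an interval. -/
theorem fderiv_energy_indicator (hp : 1 < p) (hp' : p ≠ ⊤) (u v : Control d p) {a b : ℝ}
    (ha : 0 ≤ a) (hab : a ≤ b) (hb : b ≤ 1) {w : ℝ → 𝔸}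
    (hv : v =ᵐ[volume.restrict (Icc (0 : ℝ) 1)] (Ioo a b).indicator w) :
    fderiv ℝ (energy : Control d p → ℝ) u v =
      ∫ t in a..b, inner ℝ ((p.toReal * ‖u t‖ ^ (p.toReal - 2)) • u t) (w t) := by
  obtain ⟨D, hD, hDv⟩ := exists_hasFDerivAt_integral_norm_rpow
    (μ := volume.restrict (Icc (0 : ℝ) 1)) hp hp' u
  have e1 : fderiv ℝ (energy : Control d p → ℝ) u = D := HasFDerivAt.fderiv hD
  rw [e1, hDv, intervalIntegral.integral_of_le hab, integral_Ioc_eq_integral_Ioo,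
    ← integral_indicator measurableSet_Ioo]
  have hsub : Ioo a b ⊆ Icc (0 : ℝ) 1 := fun t ht => ⟨ha.trans ht.1.le, ht.2.le.trans hb⟩
  rw [← integral_indicator measurableSet_Icc]
  rw [EventuallyEq, ae_restrict_iff' measurableSet_Icc] at hv
  refine integral_congr_ae ?_
  filter_upwards [hv] with t ht
  by_cases h1 : t ∈ Icc (0 : ℝ) 1
  · rw [indicator_of_mem h1, ht h1, normPowDeriv_apply]
    by_cases h2 : t ∈ Ioo a b
    · rw [indicator_of_mem h2, indicator_of_mem h2, inner_smul_left]; rfl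
    · rw [indicator_of_notMem h2, indicator_of_notMem h2, inner_zero_right, mul_zero]
  · rw [indicator_of_notMem h1, indicator_of_notMem fun h => h1 (hsub h)]

/-- The norm of the gradient is p‖u‖^(p-1) ≤ p(1 + ‖u‖^p). -/
theorem intervalIntegrable_energy_gradient (hp : 1 < p) (hp' : p ≠ ⊤) (u : Control d p) :
    IntervalIntegrable (fun t => (p.toReal * ‖u t‖ ^ (p.toReal - 2)) • u t) volume 0 1 := by
  have hp0 : p ≠ 0 := (one_pos.trans hp).ne'
  have hq : 1 < p.toReal := by
    rwa [← ENNReal.toReal_one, ENNReal.toReal_lt_toReal ENNReal.one_ne_top hp']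
  rw [intervalIntegrable_iff_integrableOn_Icc_of_le zero_le_one]
  have hm := Lp.aestronglyMeasurable u
  refine Integrable.mono' (g := fun t => p.toReal * (1 + ‖u t‖ ^ p.toReal))
    (((integrable_const 1).add (integrable_norm_rpow_Lp hp0 hp' u)).const_mul _)
    (((hm.norm.aemeasurable.pow_const _).const_mul _).aestronglyMeasurable.smul hm)
    (Eventually.of_forall fun t => ?_)
  have h3 : ‖u t‖ ^ (p.toReal - 2) * ‖u t‖ = ‖u t‖ ^ (p.toReal - 1) := by
    rw [← Real.rpow_add_one' (norm_nonneg _) (by linarith)]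
    congr 1; ring
  rw [norm_smul, Real.norm_of_nonneg (by positivity), mul_assoc, h3]
  gcongr
  rcases le_total ‖u t‖ 1 with h | h
  · have := Real.rpow_le_one (norm_nonneg (u t)) h (show 0 ≤ p.toReal - 1 by linarith)
    have := Real.rpow_nonneg (norm_nonneg (u t)) p.toReal
    linarith
  · have := Real.rpow_le_rpow_of_exponent_le h (show p.toReal - 1 ≤ p.toReal by linarith)
    linarith

theorem velocity_eq {γ : ℝ → M} {t : ℝ} {v : TangentSpace (𝓡 n) (γ t)}
    (h : HasMFDerivAt 𝓘(ℝ, ℝ) (𝓡 n) γ t ((1 : ℝ →L[ℝ] ℝ).smulRight v)) : velocity γ t = v := by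
  unfold velocity
  rw [h.mfderiv]
  exact one_smul ℝ v

theorem srNorm_combination_le (q : M) (a : 𝔸) : srNorm X q (combination X q a) ≤ ‖a‖ₑ :=
  iInf₂_le (f := fun (b : 𝔸) (_ : combination X q b = combination X q a) => ‖b‖ₑ) a rfl

/-- A control all of whose coefficients are momenta of one covector has minimal norm. -/
theorem IsChartModel.srNorm_eq {q₀ q : M} {L r : ℝ}
    {Y : EuclideanSpace ℝ (Fin n) → EuclideanSpace ℝ (Fin d) →L[ℝ] EuclideanSpace ℝ (Fin n)}
    (hY : IsChartModel X q₀ Y L r) (hq : q ∈ chartNhd n q₀ r) {a : 𝔸} {η : 𝔼}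
    (ha : a = momentum Y (extChartAt (𝓡 n) q₀ q) η) :
    srNorm X q (combination X q a) = ‖a‖ₑ := by
  refine le_antisymm (srNorm_combination_le q a) (le_iInf₂ fun b hb => ?_)
  rw [enorm_le_iff_norm_le]
  have h1 : Y (extChartAt (𝓡 n) q₀ q) b = Y (extChartAt (𝓡 n) q₀ q) a := by
    rw [hY.apply hq, hY.apply hq, hb]
  -- The pairing of a with coefficients b depends only on the velocity Y b, because a consists of
  -- momenta of η; Cauchy-Schwarz then gives ‖a‖ ≤ ‖b‖.
  have h2 : inner ℝ a b = inner ℝ a a := by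
    have e : ∀ c, inner ℝ a c = inner ℝ η (Y (extChartAt (𝓡 n) q₀ q) c) := fun c => by
      rw [ha, inner_momentum]
    rw [e, e, h1]
  have h3 := real_inner_le_norm a b
  rw [h2, real_inner_self_eq_norm_sq] at h3
  rcases (norm_nonneg a).eq_or_lt with h | h
  · rw [← h]; exact norm_nonneg _
  · exact le_of_mul_le_mul_left (by nlinarith) h

theorem srNorm_combination_zero (q : M) :
    srNorm X q (combination X q (0 : 𝔸)) = 0 :=
  le_antisymm ((srNorm_combination_le q 0).trans_eq enorm_zero) zero_le

/-- Near every time, the trajectory of a critical control is a normal extremal in a chart. -/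
theorem exists_adjoint_of_isCriticalOnFiber [T2Space M] (hX : SmoothFields X) (hp : 1 < p)
    (hp' : p ≠ ⊤) {u : Control d p} (hu : IsCriticalOnFiber X x y u) {γ : ℝ → M}
    (hγ : IsTrajectory X x u γ) {t₀ : ℝ} (ht₀ : t₀ ∈ Icc (0 : ℝ) 1) :
    ∃ (Y : 𝔼 → 𝔸 →L[ℝ] 𝔼) (L r ε : ℝ), IsChartModel X (γ t₀) Y L r ∧ 0 < ε ∧
      ∃ (a b : ℝ) (η : ℝ → 𝔼), 0 ≤ a ∧ a ≤ b ∧ b ≤ 1 ∧ t₀ ∈ Icc a b ∧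
        (∀ t ∈ Icc (0 : ℝ) 1, |t - t₀| < ε → t ∈ Icc a b) ∧
        (∀ t ∈ Icc a b, γ t ∈ chartNhd n (γ t₀) r) ∧
        IsSol Y u (fun t => extChartAt (𝓡 n) (γ t₀) (γ t)) a b ∧
        IsAdjoint Y u (fun t => extChartAt (𝓡 n) (γ t₀) (γ t)) η a b ∧
        ∀ᵐ t ∂volume.restrict (Icc a b), (p.toReal * ‖u t‖ ^ (p.toReal - 2)) • u t =
          momentum Y (extChartAt (𝓡 n) (γ t₀) (γ t)) (η t) := by
  have hw := intervalIntegrable_control hp.le u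
  obtain ⟨Y, L, r, hY⟩ := exists_isChartModel hX (γ t₀)
  obtain ⟨ε, hε, h⟩ := exists_chart_interval hγ.absCont.1 hw ht₀ L
    ((isOpen_chartNhd (n := n) (γ t₀) r).mem_nhds (mem_chartNhd_self _ hY.pos))
  set a := max 0 (t₀ - ε / 2) with ha
  set b := min 1 (t₀ + ε / 2) with hb
  have ha0 : 0 ≤ a := le_max_left _ _
  have hb1 : b ≤ 1 := min_le_left _ _
  have hat : a ≤ t₀ := max_le ht₀.1 (by linarith)
  have htb : t₀ ≤ b := le_min ht₀.2 (by linarith)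
  have hab := hat.trans htb
  obtain ⟨hm, hK⟩ := h a b ⟨ha0, hab.trans hb1⟩ ⟨ha0.trans hab, hb1⟩
    (lt_of_lt_of_le (by linarith) (le_max_right _ _)) hab
    (lt_of_le_of_lt (min_le_right _ _) (by linarith))
  have hsub : uIcc a b ⊆ uIcc 0 1 := by
    rw [uIcc_of_le hab, uIcc_of_le zero_le_one]; exact Icc_subset_Icc ha0 hb1
  have hwab := hw.mono_set hsub
  have hsol := (hγ.isTrajectoryOn.mono ha0 hab hb1).isSol hY hab hwab hm
  obtain ⟨η, hη, hmom⟩ := exists_adjoint_of_critical hY.bounded hab hwab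
    ((intervalIntegrable_energy_gradient hp hp' u).mono_set hsub) hK hsol.continuousOn
    (fun v ξ hξ hξa hξb => by
      have hvm : MemLp ((Ioo a b).indicator v) p (volume.restrict (Icc (0 : ℝ) 1)) :=
        (MemLp.of_bound v.continuous.aestronglyMeasurable ‖v‖
          (Eventually.of_forall fun t => v.norm_coe_le_norm t)).indicator measurableSet_Ioo
      obtain ⟨e, he0, he, h1⟩ := hγ.isTrajectoryOn.exists_stationary_endpoint hX hY ha0 hab hb1 hw
        v.continuous hK hm hξ hξa hξb
      rw [← fderiv_energy_indicator hp hp' u hvm.toLp ha0 hab hb1 hvm.coeFn_toLp]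
      -- The variation, cut off to (a, b), lies in the kernel of the differential of the endpoint
      -- map because it moves the end point along a stationary curve.
      refine hu.2 _ (mfderiv_apply_eq_zero_of_isStationary he ?_)
      filter_upwards [h1] with s ⟨σ, k1, k2, k3⟩
      rw [← k3]
      refine endpoint_eq hX hp.le ⟨k1.absCont, k2.trans hγ.start, ?_⟩
      filter_upwards [k1.deriv, Lp.coeFn_add u (s • hvm.toLp), Lp.coeFn_smul s hvm.toLp,
        hvm.coeFn_toLp] with t j1 j2 j3 j4
      rw [j2, Pi.add_apply, j3, Pi.smul_apply, j4]
      exact j1)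
  refine ⟨Y, L, r, ε / 2, hY, by positivity, a, b, η, ha0, hab, hb1, ⟨hat, htb⟩,
    fun t ht h => ?_, hm, hsol, hη, hmom⟩
  have := abs_lt.1 h
  exact ⟨max_le ht.1 (by linarith), le_min ht.2 (by linarith)⟩

/-- The derivative of the function `g` along `∑ a_i X_i(q)`. -/
noncomputable def derivAlong (X : Fin d → (q : M) → TangentSpace (𝓡 n) q) (g : M → ℝ) (q : M)
    (a : EuclideanSpace ℝ (Fin d)) : ℝ :=
  mfderiv (𝓡 n) 𝓘(ℝ, ℝ) g q (combination X q a)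

theorem IsChartModel.derivAlong_comp {q₀ q : M} {L r : ℝ}
    {Y : EuclideanSpace ℝ (Fin n) → EuclideanSpace ℝ (Fin d) →L[ℝ] EuclideanSpace ℝ (Fin n)}
    (hY : IsChartModel X q₀ Y L r) (hq : q ∈ chartNhd n q₀ r) {S : 𝔼 → ℝ}
    (hS : DifferentiableAt ℝ S (extChartAt (𝓡 n) q₀ q)) (a : 𝔸) :
    derivAlong X (fun q => S (extChartAt (𝓡 n) q₀ q)) q a =
      fderiv ℝ S (extChartAt (𝓡 n) q₀ q) (Y (extChartAt (𝓡 n) q₀ q) a) := by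
  have h1 := mfderiv_comp q (g := S) (I' := 𝓘(ℝ, 𝔼)) (I'' := 𝓘(ℝ, ℝ)) hS.mdifferentiableAt
    (mdifferentiableAt_extChartAt_of_mem hq.1)
  rw [hY.apply hq, ← mfderiv_eq_fderiv]
  exact congrArg (fun D : 𝔼 →L[ℝ] ℝ => D (combination X q a : 𝔼)) h1

/-- Near every time, the trajectory of a critical control has constant speed and, unless it is
constant, is calibrated. -/
theorem exists_calibration_of_isCriticalOnFiber [T2Space M] (hX : SmoothFields X) (hp : 1 < p)
    (hp' : p ≠ ⊤) {u : Control d p} (hu : IsCriticalOnFiber X x y u) {γ : ℝ → M}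
    (hγ : IsTrajectory X x u γ) {t₀ : ℝ} (ht₀ : t₀ ∈ Icc (0 : ℝ) 1) :
    ∃ (c : ℝ≥0) (ε : ℝ), 0 < ε ∧
      (∀ᵐ t ∂volume.restrict (Icc (0 : ℝ) 1), |t - t₀| < ε →
        srNorm X (γ t) (velocity γ t) = c) ∧
      (0 < c → ∃ (g : M → ℝ), (∀ᶠ q in 𝓝 (γ t₀), ContMDiffAt (𝓡 n) 𝓘(ℝ, ℝ) 1 g q ∧
        ∀ a : 𝔸, derivAlong X g q a ≤ ‖a‖) ∧
        ∀ t ∈ Icc (0 : ℝ) 1, |t - t₀| < ε → g (γ t) = c * (t - t₀)) := by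
  obtain ⟨Y, L, r, ε, hY, hε, a, b, η, ha0, hab, hb1, ht₀ab, hεab, hm, hsol, hη, hmom⟩ :=
    exists_adjoint_of_isCriticalOnFiber hX hp hp' hu hγ ht₀
  have hq : 1 < p.toReal := by
    rwa [← ENNReal.toReal_one, ENNReal.toReal_lt_toReal ENNReal.one_ne_top hp']
  have hwab : IntervalIntegrable u volume a b := (intervalIntegrable_control hp.le u).mono_set (by
    rw [uIcc_of_le hab, uIcc_of_le zero_le_one]; exact Icc_subset_Icc ha0 hb1)
  obtain ⟨c, hc0, hcn, hcz⟩ := exists_hamiltonian_lift hY.bounded hab hq hwab hsol hη hmom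
  have hvel : ∀ᵐ t ∂volume.restrict (Icc (0 : ℝ) 1),
      velocity γ t = combination X (γ t) (u t) := hγ.deriv.mono fun t ht => velocity_eq ht
  rw [ae_restrict_iff' measurableSet_Icc] at hvel hcn
  rcases hc0.eq_or_lt with rfl | hcpos
  · refine ⟨0, ε, hε, ?_, fun h => absurd h (lt_irrefl _)⟩
    rw [ae_restrict_iff' measurableSet_Icc]
    filter_upwards [hvel, hcn] with t h1 h2 ht hlt
    rw [h1 ht, norm_eq_zero.1 (h2 (hεab t ht hlt)), srNorm_combination_zero]; rfl
  obtain ⟨z, hz1, hzu, hz⟩ := hcz hcpos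
  -- The time t₀ may be an end point of [a, b], whereas the calibration needs the extremal on both
  -- sides of t₀.
  obtain ⟨ζ, δ, hδ, hζ, hζz⟩ := exists_hamiltonian_extension hY.bounded ht₀ab fun t ht => (hz t ht).2
  have hζ0 : ζ t₀ = z t₀ := hζz t₀ ht₀ab (by simpa using hδ)
  obtain ⟨S, hS, hSζ⟩ := exists_calibration hY.bounded hδ hcpos hζ (by
    rw [hζ0]; exact (hz t₀ ht₀ab).1)
  have hζ0' : (ζ t₀).1 = extChartAt (𝓡 n) (γ t₀) (γ t₀) := by rw [hζ0, hz1]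
  rw [hζ0'] at hS
  obtain ⟨δ', hδ', hSδ⟩ := Metric.eventually_nhds_iff.1 hSζ
  refine ⟨⟨c, hc0⟩, min ε (min δ δ'), lt_min hε (lt_min hδ hδ'), ?_, fun _ =>
    ⟨fun q => S (extChartAt (𝓡 n) (γ t₀) q), ?_, fun t ht hlt => ?_⟩⟩
  · rw [ae_restrict_iff' measurableSet_Icc] at hzu ⊢
    filter_upwards [hvel, hcn, hzu] with t h1 h2 h3 ht hlt
    have htab := hεab t ht (hlt.trans_le (min_le_left _ _))
    have h4 := h3 htab
    rw [hz1] at h4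
    rw [h1 ht, hY.srNorm_eq (hm t htab) h4, ← ofReal_norm, h2 htab,
      ENNReal.ofReal_eq_coe_nnreal hc0]
    rfl
  · filter_upwards [(isOpen_chartNhd (n := n) (γ t₀) r).mem_nhds (mem_chartNhd_self _ hY.pos),
      (continuousAt_extChartAt (I := 𝓡 n) (γ t₀)).eventually hS] with q hqm hq
    refine ⟨ContMDiffAt.comp q hq.1.contMDiffAt (contMDiffAt_extChartAt_of_mem hqm.1),
      fun a => ?_⟩
    rw [hY.derivAlong_comp hqm (hq.1.differentiableAt one_ne_zero)]
    exact hq.2 a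
  · have k1 := hlt.trans_le ((min_le_right _ _).trans (min_le_left δ δ'))
    have k2 := hlt.trans_le ((min_le_right _ _).trans (min_le_right δ δ'))
    have := hSδ (y := t) (by rwa [Real.dist_eq])
    rw [hζz t (hεab t ht (hlt.trans_le (min_le_left _ _))) k1, hz1] at this
    exact this

end Critical

end SubRiem

/-! ### Constant speed from local constancy. -/

namespace SubRiem

open Filter Topology

set_option linter.unusedSectionVars false

/-- A locally constant function (almost everywhere) on the unit interval is constant. -/
theorem exists_const_of_locally {α : Type*} {v : ℝ → α}
    (h : ∀ t₀ ∈ Icc (0 : ℝ) 1, ∃ (c : α) (ε : ℝ), 0 < ε ∧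
      ∀ᵐ t ∂volume.restrict (Icc (0 : ℝ) 1), |t - t₀| < ε → v t = c) :
    ∃ c : α, (∀ᵐ t ∂volume.restrict (Icc (0 : ℝ) 1), v t = c) ∧
      ∀ (c' : α) (t₀ ε : ℝ), t₀ ∈ Icc (0 : ℝ) 1 → 0 < ε →
        (∀ᵐ t ∂volume.restrict (Icc (0 : ℝ) 1), |t - t₀| < ε → v t = c') → c' = c := by
  have huniq : ∀ (c c' : α) (r ρ : ℝ), r ∈ Icc (0 : ℝ) 1 → 0 < ρ →
      (∀ᵐ t ∂volume.restrict (Icc (0 : ℝ) 1), |t - r| < ρ → v t = c) →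
      (∀ᵐ t ∂volume.restrict (Icc (0 : ℝ) 1), |t - r| < ρ → v t = c') → c = c' := by
    intro c c' r ρ hr hρ h1 h2
    set α := max 0 (r - ρ)
    set β := min 1 (r + ρ)
    have hαβ : α < β := max_lt (lt_min one_pos (by linarith [hr.1]))
      (lt_min (by linarith [hr.2]) (by linarith))
    have hsub : Ioo α β ⊆ Icc (0 : ℝ) 1 := fun t ht =>
      ⟨(le_max_left _ _).trans ht.1.le, ht.2.le.trans (min_le_left _ _)⟩
    -- The two local constants are compared at a point of a nonempty open interval, which has
    -- positive measure.
    have hne : (ae (volume.restrict (Ioo α β))).NeBot := by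
      rw [ae_neBot, Ne, Measure.restrict_eq_zero, Real.volume_Ioo, ENNReal.ofReal_eq_zero]
      linarith
    obtain ⟨t, k1, k2, ht⟩ := ((ae_restrict_of_ae_restrict_of_subset hsub h1).and
      ((ae_restrict_of_ae_restrict_of_subset hsub h2).and
        (ae_restrict_mem measurableSet_Ioo))).exists
    have hlt : |t - r| < ρ := abs_lt.2
      ⟨by linarith [(le_max_right 0 (r - ρ)).trans_lt ht.1],
        by linarith [ht.2.trans_le (min_le_right 1 (r + ρ))]⟩
    rw [← k1 hlt, ← k2 hlt]
  have hne : Nonempty α := ⟨(h 0 ⟨le_rfl, zero_le_one⟩).choose⟩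
  choose! c ε hε hc using h
  have hloc : ∀ t ∈ Icc (0 : ℝ) 1, ∀ r ∈ Icc (0 : ℝ) 1, |r - t| < ε t → c r = c t := by
    intro t ht r hr hrt
    refine huniq _ _ r (min (ε r) (ε t - |r - t|)) hr (lt_min (hε r hr) (by linarith)) ?_ ?_
    · filter_upwards [hc r hr] with s hs hlt using hs (hlt.trans_le (min_le_left _ _))
    · filter_upwards [hc t ht] with s hs hlt
      have := hlt.trans_le (min_le_right _ _)
      exact hs (by linarith [abs_sub_le s r t])
  have hconst : ∀ t ∈ Icc (0 : ℝ) 1, c 0 = c t := by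
    intro t ht
    have hsub : Icc 0 t ⊆ Icc (0 : ℝ) 1 := Icc_subset_Icc_right ht.2
    refine relation_of_locally (R := fun r s => c r = c s) ht.1 (fun _ _ => rfl)
      (fun _ _ _ _ _ _ _ h1 h2 => h1.trans h2) fun s hs => ⟨ε s, hε s (hsub hs),
        fun r r' hr hr' k1 k2 k3 => ?_⟩
    rw [hloc s (hsub hs) r (hsub hr) (abs_lt.2 ⟨by linarith, by linarith⟩),
      hloc s (hsub hs) r' (hsub hr') (abs_lt.2 ⟨by linarith, by linarith⟩)]
  refine ⟨c 0, ?_, fun c' t₀ ε' ht₀ hε' h' => ?_⟩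
  · refine relation_of_locally (R := fun r s => ∀ᵐ t ∂volume.restrict (Icc r s), v t = c 0)
      zero_le_one (fun t _ => ?_) (fun r s t _ hrs hst _ h1 h2 => ae_restrict_Icc_union hrs hst h1 h2)
      fun s hs => ⟨ε s, hε s hs, fun r r' hr hr' k1 k2 k3 => ?_⟩
    · rw [Icc_self, Measure.restrict_singleton, Real.volume_singleton, zero_smul, ae_zero]
      exact eventually_bot
    · filter_upwards [ae_mono (Measure.restrict_mono (Icc_subset_Icc hr.1 hr'.2) le_rfl) (hc s hs),
        ae_restrict_mem measurableSet_Icc] with t ht htm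
      rw [ht (abs_lt.2 ⟨by linarith [htm.1], by linarith [htm.2]⟩), hconst s hs]
  · rw [hconst t₀ ht₀]
    refine huniq _ _ t₀ (min ε' (ε t₀)) ht₀ (lt_min hε' (hε t₀ ht₀)) ?_ ?_
    · filter_upwards [h'] with s hs hlt using hs (hlt.trans_le (min_le_left _ _))
    · filter_upwards [hc t₀ ht₀] with s hs hlt using hs (hlt.trans_le (min_le_right _ _))

/-! ### Calibrated curves are locally length minimizing. -/

section Geodesics

variable {n d : ℕ} {M : Type*} [TopologicalSpace M] [ChartedSpace (EuclideanSpace ℝ (Fin n)) M]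
  [IsManifold (𝓡 n) ∞ M] {X : Fin d → (q : M) → TangentSpace (𝓡 n) q} {p : ℝ≥0∞} {x y : M}

local notation "𝔼" => EuclideanSpace ℝ (Fin n)
local notation "𝔸" => EuclideanSpace ℝ (Fin d)

theorem IsHorizontal.mono {γ : ℝ → M} {a b a' b' : ℝ} (hγ : IsHorizontal X γ a b) (ha : a ≤ a')
    (hab : a' ≤ b') (hb : b' ≤ b) : IsHorizontal X γ a' b' :=
  ⟨hγ.absCont.mono ha hab hb,
    ae_mono (Measure.restrict_mono (Icc_subset_Icc ha hb) le_rfl) hγ.tangent⟩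

theorem srLength_mono {γ : ℝ → M} {a b a' b' : ℝ} (ha : a ≤ a') (hb : b' ≤ b) :
    srLength X γ a' b' ≤ srLength X γ a b :=
  lintegral_mono_set (Icc_subset_Icc ha hb)

theorem srLength_add_le {γ : ℝ → M} {a b c : ℝ} (hab : a ≤ b) (hbc : b ≤ c) :
    srLength X γ a b + srLength X γ b c ≤ srLength X γ a c := by
  unfold srLength
  rw [setLIntegral_congr (Ioc_ae_eq_Icc (μ := volume) (a := b) (b := c)).symm,
    ← lintegral_union measurableSet_Ioc (disjoint_left.2 fun t h1 h2 => not_lt.2 h1.2 h2.1),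
    Icc_union_Ioc_eq_Icc hab hbc]

/-- The bound holds for every coefficient vector of v, hence for the infimum. Positivity of C lets
it pass inside an infimum that may be over an empty set, where the norm is ∞. -/
theorem enorm_mfderiv_le_srNorm {g : M → ℝ} {q : M} {C : ℝ≥0} (hC : 0 < C)
    (h : ∀ a : 𝔸, |derivAlong X g q a| ≤ C * ‖a‖) (v : TangentSpace (𝓡 n) q) :
    ‖(show ℝ from mfderiv (𝓡 n) 𝓘(ℝ, ℝ) g q v)‖ₑ ≤ C * srNorm X q v := by
  have h0 : (C : ℝ≥0∞) ≠ 0 := by exact_mod_cast hC.ne'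
  unfold srNorm
  rw [ENNReal.mul_iInf_of_ne h0 ENNReal.coe_ne_top]
  refine le_iInf fun a => ?_
  rw [ENNReal.mul_iInf_of_ne h0 ENNReal.coe_ne_top]
  refine le_iInf fun ha => ?_
  have h1 := h a
  have h2 : (show ℝ from mfderiv (𝓡 n) 𝓘(ℝ, ℝ) g q v) = derivAlong X g q a := by
    rw [← ha]; rfl
  rw [h2, Real.enorm_eq_ofReal_abs, ← ofReal_norm, ← ENNReal.ofReal_coe_nnreal,
    ← ENNReal.ofReal_mul C.coe_nonneg]
  exact ENNReal.ofReal_le_ofReal h1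

/-- The increment of a function with bounded derivative along the distribution is bounded by the
length of a horizontal curve. -/
theorem IsHorizontal.enorm_sub_le {σ : ℝ → M} {a b : ℝ} (hab : a ≤ b)
    (hσ : IsHorizontal X σ a b) {g : M → ℝ} {C : ℝ≥0} (hC : 0 < C)
    (hg : ∀ t ∈ Icc a b, ContMDiffAt (𝓡 n) 𝓘(ℝ, ℝ) 1 g (σ t) ∧
      ∀ a : 𝔸, |derivAlong X g (σ t) a| ≤ C * ‖a‖) :
    ‖g (σ b) - g (σ a)‖ₑ ≤ C * srLength X σ a b := by
  refine relation_of_locally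
    (R := fun r s => ‖g (σ s) - g (σ r)‖ₑ ≤ C * srLength X σ r s) hab (fun t _ => by simp)
    (fun r s t _ hrs hst _ h1 h2 => ?_) fun t ht => ?_
  · calc ‖g (σ t) - g (σ r)‖ₑ = ‖(g (σ s) - g (σ r)) + (g (σ t) - g (σ s))‖ₑ := by
          congr 1; ring
      _ ≤ C * srLength X σ r s + C * srLength X σ s t :=
          (enorm_add_le _ _).trans (add_le_add h1 h2)
      _ ≤ C * srLength X σ r t := by
          rw [← mul_add]; gcongr; exact srLength_add_le hrs hst
  · obtain ⟨ε, hε, h⟩ := hσ.absCont.exists_comp ht (hg t ht).1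
    refine ⟨ε, hε, fun r s hr hs k1 k2 k3 => ?_⟩
    have hac := h r s hr hs k1 k2 k3
    rw [← hac.integral_deriv_eq_sub, intervalIntegral.integral_of_le k2]
    refine (enorm_integral_le_lintegral_enorm _).trans ?_
    unfold srLength
    rw [← lintegral_const_mul' _ _ ENNReal.coe_ne_top,
      setLIntegral_congr (Ioc_ae_eq_Icc (μ := volume) (a := r) (b := s))]
    have hsub : Icc r s ⊆ Icc a b := Icc_subset_Icc hr.1 hs.2
    refine lintegral_mono_ae ?_
    filter_upwards [ae_mono (Measure.restrict_mono hsub le_rfl) hσ.tangent,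
      ae_restrict_mem measurableSet_Icc] with t h1 h2
    have hv : HasMFDerivAt 𝓘(ℝ, ℝ) (𝓡 n) σ t ((1 : ℝ →L[ℝ] ℝ).smulRight (velocity σ t)) := by
      have e : (mfderiv 𝓘(ℝ, ℝ) (𝓡 n) σ t : ℝ →L[ℝ] 𝔼) =
          (1 : ℝ →L[ℝ] ℝ).smulRight (velocity σ t : 𝔼) :=
        ContinuousLinearMap.ext_ring (one_smul ℝ (velocity σ t : 𝔼)).symm
      exact Eq.mp (congrArg (fun D : ℝ →L[ℝ] 𝔼 => HasMFDerivAt 𝓘(ℝ, ℝ) (𝓡 n) σ t D) e)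
        h1.1.hasMFDerivAt
    have hd := hasDerivAt_comp_of_hasMFDerivAt hv
      ((hg t (hsub h2)).1.mdifferentiableAt one_ne_zero)
    rw [hd.deriv]
    exact enorm_mfderiv_le_srNorm hC (hg t (hsub h2)).2 _

theorem derivAlong_neg (g : M → ℝ) (q : M) (a : 𝔸) :
    derivAlong X g q (-a) = -derivAlong X g q a := by
  have h : combination X q (-a) = -combination X q a := by
    unfold combination
    rw [← Finset.sum_neg_distrib]
    exact Finset.sum_congr rfl fun i _ => by rw [PiLp.neg_apply, neg_smul]
  unfold derivAlong
  rw [h]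
  exact map_neg _ _

theorem derivAlong_congr {g g' : M → ℝ} {q : M} (h : g =ᶠ[𝓝 q] g') (a : 𝔸) :
    derivAlong X g q a = derivAlong X g' q a :=
  congrArg (fun D : 𝔼 →L[ℝ] ℝ => D (combination X q a : 𝔼)) h.mfderiv_eq

/-- In a chart the derivative along the system is dG(Y a), where dG is continuous at the point and Y
is bounded. -/
theorem exists_derivAlong_bound (hX : SmoothFields X) {g : M → ℝ} {q₀ : M}
    (hg : ContMDiffAt (𝓡 n) 𝓘(ℝ, ℝ) 1 g q₀) :
    ∃ C : ℝ, ∀ᶠ q in 𝓝 q₀, ∀ a : 𝔸, |derivAlong X g q a| ≤ C * ‖a‖ := by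
  have : IsManifold (𝓡 n) 1 M := isManifold_one
  obtain ⟨Y, L, r, hY⟩ := exists_isChartModel hX q₀
  set φ := extChartAt (𝓡 n) q₀ with hφ
  set G : 𝔼 → ℝ := fun z => g (φ.symm z) with hG
  have cG : ContDiffAt ℝ 1 G (φ q₀) := by
    rw [← contMDiffAt_iff_contDiffAt]
    refine ContMDiffAt.comp (φ q₀) ?_ ((contMDiffOn_extChartAt_symm q₀).contMDiffAt
      (extChartAt_target_mem_nhds q₀))
    rwa [hφ, extChartAt_to_inv]
  have cf : ContinuousAt (fderiv ℝ G) (φ q₀) :=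
    (cG.fderiv_right (m := 0) (by norm_num)).continuousAt
  have hb : ∀ᶠ z in 𝓝 (φ q₀), ‖fderiv ℝ G z‖ < ‖fderiv ℝ G (φ q₀)‖ + 1 :=
    cf.norm.eventually_lt_const (by linarith)
  have hdiff : ∀ᶠ z in 𝓝 (φ q₀), DifferentiableAt ℝ G z :=
    (cG.eventually (by simp)).mono fun z hz => hz.differentiableAt one_ne_zero
  refine ⟨(‖fderiv ℝ G (φ q₀)‖ + 1) * L, ?_⟩
  have hcφ := continuousAt_extChartAt (I := 𝓡 n) q₀
  filter_upwards [(isOpen_chartNhd (n := n) q₀ r).mem_nhds (mem_chartNhd_self _ hY.pos),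
    hcφ.eventually hb, hcφ.eventually hdiff] with q h1 h2 h3 a
  have hev : g =ᶠ[𝓝 q] fun q => G (φ q) := by
    filter_upwards [(isOpen_extChartAt_source q₀).mem_nhds h1.1] with q' hq'
    exact (congrArg g (φ.left_inv hq')).symm
  rw [derivAlong_congr hev, hY.derivAlong_comp h1 h3, ← Real.norm_eq_abs]
  refine (ContinuousLinearMap.le_opNorm _ _).trans ?_
  rw [mul_assoc]
  have h4 := ((Y (φ q)).le_opNorm a).trans
    (mul_le_mul_of_nonneg_right (hY.bounded.norm_le _) (norm_nonneg a))
  exact mul_le_mul h2.le h4 (norm_nonneg _) (by positivity)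

/-- Bump functions with bounded derivative along the distribution. -/
theorem exists_bump [T2Space M] (hX : SmoothFields X) {q₀ : M} {U : Set M} (hU : U ∈ 𝓝 q₀) :
    ∃ (F : M → ℝ) (C : ℝ≥0), 0 < C ∧ (∀ q, ContMDiffAt (𝓡 n) 𝓘(ℝ, ℝ) 1 F q ∧
      ∀ a : 𝔸, |derivAlong X F q a| ≤ C * ‖a‖) ∧ (∀ᶠ q in 𝓝 q₀, F q = 1) ∧
      ∀ q ∉ U, F q = 0 := by
  obtain ⟨F, -, hF⟩ := (SmoothBumpFunction.nhds_basis_tsupport (I := 𝓡 n) q₀).mem_iff.1 hU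
  have hF1 : ContMDiff (𝓡 n) 𝓘(ℝ, ℝ) 1 F := F.contMDiff.of_le ENat.LEInfty.out
  -- The local bounds become uniform by compactness of the support.
  have hb : ∃ C : ℝ, ∀ q ∈ tsupport F, ∀ a : 𝔸, |derivAlong X F q a| ≤ C * ‖a‖ := by
    refine F.hasCompactSupport.isCompact.induction_on ⟨0, fun q hq => absurd hq (by simp)⟩
      (fun s t hst ⟨C, hC⟩ => ⟨C, fun q hq => hC q (hst hq)⟩) ?_ fun q _ => ?_
    · rintro s t ⟨C, hC⟩ ⟨C', hC'⟩
      refine ⟨max C C', fun q hq a => ?_⟩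
      rcases hq with hq | hq
      · exact (hC q hq a).trans (by gcongr; exact le_max_left _ _)
      · exact (hC' q hq a).trans (by gcongr; exact le_max_right _ _)
    · obtain ⟨C, hC⟩ := exists_derivAlong_bound hX (hF1 q)
      exact ⟨_, mem_nhdsWithin_of_mem_nhds hC, C, fun q hq => hq⟩
  obtain ⟨C, hC⟩ := hb
  refine ⟨F, ⟨max C 1, zero_le_one.trans (le_max_right _ _)⟩, ?_, fun q => ⟨hF1 q, fun a => ?_⟩,
    F.eventuallyEq_one, fun q hq => ?_⟩
  · exact one_pos.trans_le (le_max_right C 1)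
  · by_cases hq : q ∈ tsupport F
    · exact (hC q hq a).trans (mul_le_mul_of_nonneg_right (le_max_left _ _) (norm_nonneg _))
    · have h0 : (F : M → ℝ) =ᶠ[𝓝 q] fun _ => (0 : ℝ) := notMem_tsupport_iff_eventuallyEq.1 hq
      have h1 : derivAlong X F q a = 0 := by
        rw [derivAlong_congr h0]
        unfold derivAlong
        rw [mfderiv_const]
        rfl
      rw [h1, abs_zero]
      exact mul_nonneg (zero_le_one.trans (le_max_right C 1)) (norm_nonneg _)
  · by_contra h
    exact hq (hF (subset_tsupport _ h))

/-- A calibrated curve of constant speed is locally length minimizing. -/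
theorem exists_isLengthMinimizing [T2Space M] (hX : SmoothFields X) {γ : ℝ → M}
    (hγ : ContinuousOn γ (Icc 0 1)) {t₀ ε : ℝ} {c : ℝ≥0} (ht₀ : t₀ ∈ Icc (0 : ℝ) 1) (hε : 0 < ε)
    (hspeed : ∀ᵐ t ∂volume.restrict (Icc (0 : ℝ) 1), |t - t₀| < ε →
      srNorm X (γ t) (velocity γ t) = c) {g : M → ℝ}
    (hg : ∀ᶠ q in 𝓝 (γ t₀), ContMDiffAt (𝓡 n) 𝓘(ℝ, ℝ) 1 g q ∧
      ∀ a : 𝔸, derivAlong X g q a ≤ ‖a‖)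
    (hgγ : ∀ t ∈ Icc (0 : ℝ) 1, |t - t₀| < ε → g (γ t) = c * (t - t₀)) :
    ∃ δ > 0, IsLengthMinimizing X γ (max 0 (t₀ - δ)) (min 1 (t₀ + δ)) := by
  obtain ⟨F, C, hC, hF, hF1, hF0⟩ := exists_bump hX hg
  have hev := (hγ t₀ ht₀).eventually hF1
  rw [eventually_nhdsWithin_iff] at hev
  obtain ⟨ε', hε', hFγ⟩ := Metric.eventually_nhds_iff.1 hev
  have hC' : (0 : ℝ) < C := hC
  -- Chosen so that C · c · (b - a) ≤ 1 whenever b - a ≤ η, while a curve leaving the domain of the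
  -- calibration has length at least 1 / C.
  set η : ℝ := 1 / (C * (c + 1)) with hη
  have hη0 : 0 < η := by positivity
  set m := min ε (min ε' η) with hm
  have hm0 : 0 < m := lt_min hε (lt_min hε' hη0)
  have m1 : m ≤ ε := min_le_left _ _
  have m2 : m ≤ ε' := (min_le_right _ _).trans (min_le_left _ _)
  have m3 : m ≤ η := (min_le_right _ _).trans (min_le_right _ _)
  refine ⟨m / 2, by positivity, ?_⟩
  set a := max 0 (t₀ - m / 2) with ha
  set b := min 1 (t₀ + m / 2) with hb
  have ha0 : 0 ≤ a := le_max_left _ _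
  have hb1 : b ≤ 1 := min_le_left _ _
  have hat : a ≤ t₀ := max_le ht₀.1 (by linarith)
  have htb : t₀ ≤ b := le_min ht₀.2 (by linarith)
  have hab : a ≤ b := hat.trans htb
  have hsub : Icc a b ⊆ Icc (0 : ℝ) 1 := Icc_subset_Icc ha0 hb1
  have ha' : t₀ - m / 2 ≤ a := le_max_right _ _
  have hb' : b ≤ t₀ + m / 2 := min_le_right _ _
  have hclose : ∀ t ∈ Icc a b, |t - t₀| < m := fun t ht =>
    abs_lt.2 ⟨by linarith [ht.1], by linarith [ht.2]⟩
  have hlen : srLength X γ a b = c * ENNReal.ofReal (b - a) := by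
    unfold srLength
    rw [← Real.volume_Icc, ← setLIntegral_const]
    refine lintegral_congr_ae ?_
    filter_upwards [ae_mono (Measure.restrict_mono hsub le_rfl) hspeed,
      ae_restrict_mem measurableSet_Icc] with t h1 h2 using h1 ((hclose t h2).trans_le m1)
  intro σ a' b' hab' hσ hσa hσb
  rw [hlen]
  by_cases hin : ∀ t ∈ Icc a' b', ContMDiffAt (𝓡 n) 𝓘(ℝ, ℝ) 1 g (σ t) ∧
      ∀ a : 𝔸, derivAlong X g (σ t) a ≤ ‖a‖
  -- The competitor stays where g calibrates. The one-sided bound, applied to v and to -v, gives the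
  -- two-sided one, and the increment of g between the end points is c(b - a).
  · have h1 := hσ.enorm_sub_le hab' (C := 1) one_pos (g := g) fun t ht => ⟨(hin t ht).1, fun v => by
      rw [NNReal.coe_one, one_mul, abs_le]
      have i1 := (hin t ht).2 v
      have i2 := (hin t ht).2 (-v)
      rw [derivAlong_neg, norm_neg] at i2
      exact ⟨by linarith, i1⟩⟩
    rw [hσa, hσb, hgγ a (hsub ⟨le_rfl, hab⟩) ((hclose a ⟨le_rfl, hab⟩).trans_le m1),
      hgγ b (hsub ⟨hab, le_rfl⟩) ((hclose b ⟨hab, le_rfl⟩).trans_le m1), ENNReal.coe_one, one_mul,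
      Real.enorm_eq_ofReal_abs] at h1
    rw [← ENNReal.ofReal_coe_nnreal, ← ENNReal.ofReal_mul c.coe_nonneg]
    refine (ENNReal.ofReal_le_ofReal (le_trans (le_of_eq ?_) (le_abs_self _))).trans h1
    ring
  -- The competitor leaves the good region at some time t. The bump function drops from 1 to 0 along
  -- it before t, which already costs length 1 / C.
  · push Not at hin
    obtain ⟨t, ht, hout⟩ := hin
    have hFt : F (σ t) = 0 := hF0 _ fun h => by
      obtain ⟨v, hv⟩ := hout h.1
      exact absurd (h.2 v) (not_le.2 hv)
    have hFa : F (σ a') = 1 := by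
      rw [hσa]
      refine hFγ ?_ (hsub ⟨le_rfl, hab⟩)
      rw [Real.dist_eq]
      exact (hclose a ⟨le_rfl, hab⟩).trans_le m2
    have h1 := (hσ.mono le_rfl ht.1 ht.2).enorm_sub_le ht.1 hC (g := F) fun s _ => hF (σ s)
    rw [hFt, hFa, zero_sub, enorm_neg, enorm_one] at h1
    have h2 : (C : ℝ≥0∞) * (c * ENNReal.ofReal (b - a)) ≤ 1 := by
      rw [← ENNReal.ofReal_coe_nnreal, ← ENNReal.ofReal_coe_nnreal (p := c),
        ← ENNReal.ofReal_mul c.coe_nonneg, ← ENNReal.ofReal_mul C.coe_nonneg,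
        ← ENNReal.ofReal_one]
      refine ENNReal.ofReal_le_ofReal ?_
      have hc0 := c.coe_nonneg
      calc (C : ℝ) * (c * (b - a)) ≤ C * ((c + 1) * η) := by
            gcongr
            · linarith
            · linarith
        _ = 1 := by rw [hη]; field_simp
    have h3 := h2.trans (h1.trans (mul_le_mul_right (srLength_mono (X := X) (γ := σ) le_rfl ht.2) _))
    exact (ENNReal.mul_le_mul_iff_right (by exact_mod_cast hC.ne') ENNReal.coe_ne_top).1 h3

/-- A trajectory is horizontal. -/
theorem IsTrajectory.isHorizontal {u : Control d p} {γ : ℝ → M} (hγ : IsTrajectory X x u γ) :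
    IsHorizontal X γ 0 1 := by
  refine ⟨hγ.absCont, ?_⟩
  filter_upwards [hγ.deriv] with t ht
  refine ⟨ht.mdifferentiableAt, ?_⟩
  rw [velocity_eq ht]
  exact Submodule.sum_mem _ fun i _ => Submodule.smul_mem _ _ (Submodule.subset_span ⟨i, rfl⟩)

/-- The trajectory of a critical control is a geodesic. -/
theorem isGeodesic_of_isCriticalOnFiber [T2Space M] [Fact (1 ≤ p)] (hX : SmoothFields X)
    (hp : 1 < p) (hp' : p ≠ ⊤) {u : Control d p} (hu : IsCriticalOnFiber X x y u) {γ : ℝ → M}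
    (hγ : IsTrajectory X x u γ) : IsGeodesic X x y γ := by
  have hloc := fun t₀ (ht₀ : t₀ ∈ Icc (0 : ℝ) 1) =>
    exists_calibration_of_isCriticalOnFiber hX hp hp' hu hγ ht₀
  refine ⟨hγ.isHorizontal, ?_, hγ.start, ?_, fun t₀ ht₀ => ?_⟩
  · obtain ⟨c, hc, huniq⟩ := exists_const_of_locally
      (v := fun t => srNorm X (γ t) (velocity γ t)) fun t₀ ht₀ => by
        obtain ⟨c, ε, hε, h, -⟩ := hloc t₀ ht₀
        exact ⟨c, ε, hε, h⟩
    -- The global constant lives in `ℝ≥0∞`; the uniqueness clause identifies it with a local one,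
    -- which is finite.
    obtain ⟨c', ε, hε, h, -⟩ := hloc 0 ⟨le_rfl, zero_le_one⟩
    exact ⟨c', by rwa [huniq c' 0 ε ⟨le_rfl, zero_le_one⟩ hε h]⟩
  · rw [← endpoint_eq hX hp.le hγ]; exact hu.1.2
  · obtain ⟨c, ε, hε, h, hg⟩ := hloc t₀ ht₀
    rcases (zero_le (a := c)).eq_or_lt with rfl | hc
    · refine ⟨ε / 2, by positivity, fun σ a' b' _ _ _ _ => ?_⟩
      refine le_of_eq_of_le ?_ zero_le
      unfold srLength
      rw [← lintegral_zero (μ := volume.restrict (Icc (max 0 (t₀ - ε / 2)) (min 1 (t₀ + ε / 2))))]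
      refine lintegral_congr_ae ?_
      filter_upwards [ae_mono (Measure.restrict_mono
        (Icc_subset_Icc (le_max_left _ _) (min_le_left _ _)) le_rfl) h,
        ae_restrict_mem measurableSet_Icc] with t h1 h2
      refine h1 (abs_lt.2 ⟨?_, ?_⟩)
      · linarith [(le_max_right 0 (t₀ - ε / 2)).trans h2.1]
      · linarith [h2.2.trans (min_le_right 1 (t₀ + ε / 2))]
    · obtain ⟨g, hg1, hg2⟩ := hg hc
      exact exists_isLengthMinimizing hX hγ.absCont.1 ht₀ hε h hg1 hg2

end Geodesics

end SubRiem

theorem mainTheorem10 {n d : ℕ} {M : Type*} [TopologicalSpace M] [T2Space M]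
    [ChartedSpace (EuclideanSpace ℝ (Fin n)) M] [IsManifold (𝓡 n) ∞ M]
    (X : Fin d → (q : M) → TangentSpace (𝓡 n) q)
    (hX : SubRiem.SmoothFields X) (hgen : SubRiem.BracketGenerating X)
    (x y : M) (p : ℝ≥0∞) [Fact (1 ≤ p)] (hp : 1 < p) (hp' : p ≠ ⊤)
    (hy : SubRiem.IsRegularValue X x p y)
    (u : SubRiem.Control d p) (hu : SubRiem.IsCriticalOnFiber X x y u)
    (γ : ℝ → M) (hγ : SubRiem.IsTrajectory X x u γ) :
    SubRiem.IsGeodesic X x y γ :=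
  SubRiem.isGeodesic_of_isCriticalOnFiber hX hp hp' hu hγ
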